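/- **Setting.** A conformal graph directed system (cGDS) $\Phi=(\phi_e)_{e\in E}$ on $\mathbb R$ consists of a finite directed multigraph with vertex set $V$, edge set $E$ and maps $i,t\colon E\to V$ (initial and terminal vertex); of non-empty compact intervals $X_v=\overline{\mathrm{int}(X_v)}\subset\mathbb R$, $v\in V$; and of injective maps $\phi_e\colon X_{t(e)}\to X_{i(e)}$ with a common Lipschitz constant $r\in(0,1)$, such that $\phi_e(\mathrm{int}\,X_{t(e)})\cap\phi_{e'}(\mathrm{int}\,X_{t(e')})=\varnothing$ for all $e\ne e'$, and such that, for some $\alpha\in(0,1]$ and suitable open connected sets $W_v\supset X_v$, every $\phi_e$ extends to a $\mathcal C^{1+\alpha}$-diffeomorphism from $W_{t(e)}$ into $W_{i(e)}$ with derivative bounded away from zero. It is an sGDS if every $\phi_e$ is a similarity. Its incidence matrix $A\in\{0,1\}^{E\times E}$ has $A_{e,e'}=1$ if and only if $t(e)=i(e')$; it is aperiodic and irreducible if for some $n\ge1$ all entries of $A^n$ are positive. Let $E_A^\infty$ be the set of infinite words $\omega=\omega_1\omega_2\cdots$ with $A_{\omega_n,\omega_{n+1}}=1$ for all $n$, with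 the topology induced from the product of the discrete topologies, let $\sigma$ be the shift, and let $E_A^*$ be the set of finite admissible words (including the empty word $\varnothing$). For $u=u_1\cdots u_n\in E_A^*$ let $[u]$ be the cylinder of all $\omega\in E_A^\infty$ that start with $u$, and $\phi_u=\phi_{u_1}\circ\cdots\circ\phi_{u_n}$. Let $\pi(\omega)$ be the unique point of $\bigcap_n\phi_{\omega_1\cdots\omega_n}(X_{t(\omega_n)})$, and let $F=\pi(E_A^\infty)$ be the limit set. For $v\in V$ let $I_v=\{e\in E: i(e)=v\}$, let $I_v^\infty$ be the set of $\omega\in E_A^\infty$ with $i(\omega_1)=v$, and let $T_v^m$ be the set of admissible words of length $m$ with $t(\omega_m)=v$. With $\langle\cdot\rangle$ denoting the convex hull, let $L^{v,1},\dots,L^{v,n_v}$ be the connected components of $$L^v=\Big\langle\bigcup_{e\in I_v}\pi[e]\Big\rangle\setminus\bigcup_{e\in I_v}\langle\pi[e]\rangle ,$$ and let $|L|$ denote the length of an interval $L$. The geometric potential is $\xi(\omega)=-\ln|\phi_{\omega_1}'(\pi(\sigma\omega))|$. It is called lattice if there are continuous $\zeta,\psi\colon E_A^\infty\to\mathbb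 R$ with $\xi-\zeta=\psi-\psi\circ\sigma$ such that the range of $\zeta$ is contained in a discrete subgroup of $\mathbb R$. For a continuous function $f$ on $E_A^\infty$ let $\mathcal L_f\psi(\omega)=\sum_{u:\sigma u=\omega}e^{f(u)}\psi(u)$ be the Perron–Frobenius operator. For $Y\subset\mathbb R$ and $\varepsilon>0$ let $Y_\varepsilon=\{x:\inf_{y\in Y}|x-y|\le\varepsilon\}$; let $\lambda^0$ be counting measure and $\lambda^1$ Lebesgue measure. The Minkowski dimension of a non-empty compact set $Y$ is $\dim_M(Y)=1-\lim_{\varepsilon\searrow0}\ln\lambda^1(Y_\varepsilon)/\ln\varepsilon$ if the limit exists. Let $s_0(Y)=\inf\{t\in\mathbb R:\varepsilon^t\lambda^0(\partial Y_\varepsilon)\to0\text{ as }\varepsilon\to0\}$ and $s_1(Y)=\inf\{t\in\mathbb R:\varepsilon^t\lambda^1(Y_\varepsilon)\to0\text{ as }\varepsilon\to0\}$. For a Borel set $B$ let $\underline C_0^f(Y,B)$ and $\overline C_0^f(Y,B)$ be the lower and upper limit, as $\varepsilon\to0$, of $\varepsilon^{s_0(Y)}\lambda^0(\partial Y_\varepsilon\cap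 B)/2$, and let $\underline C_1^f(Y,B)$ and $\overline C_1^f(Y,B)$ be those of $\varepsilon^{s_1(Y)}\lambda^1(Y_\varepsilon\cap B)$. **Theorem (sGDS – Fractal Curvature Measures).** Let $\Phi$ be an sGDS with at least two edges and with aperiodic irreducible incidence matrix, and assume that its limit set $F$ satisfies $\lambda^1(F)=0$. Then the Minkowski dimension $\delta=\dim_M(F)$ exists, the numbers $n_v$ are finite, and there is exactly one strictly positive continuous function $h_{-\delta\xi}$ on $E_A^\infty$ with $\mathcal L_{-\delta\xi}h_{-\delta\xi}=h_{-\delta\xi}$ that is normalised by $\int h_{-\delta\xi}\,d\nu=1$, where $\nu$ is the Borel probability measure on $E_A^\infty$ with $\mathcal L_{-\delta\xi}^*\nu=\nu$. Moreover, the following hold. 1. The limit $$c=\lim_{m\to\infty}\sum_{v\in V}\sum_{j=1}^{n_v}\sum_{\omega\in T_v^m}|\phi_\omega(L^{v,j})|^\delta$$ exists, is positive and finite, and equals the finite sum $$c=\sum_{v\in V}\sum_{j=1}^{n_v}h_{-\delta\xi}(\omega^v)\,|L^{v,j}|^\delta$$ for every choice of words $\omega^v\in I_v^\infty$; in particular this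 sum does not depend on the choice. (A vertex $v$ with $I_v=\varnothing$ has $n_v=0$ and contributes nothing.) 2. If $\xi$ is lattice, then for $k\in\{0,1\}$ and every Borel set $B\subseteq\mathbb R$ for which $F\cap B$ is a non-empty finite union of sets of the form $\pi[\omega]$ with $\omega\in E_A^*$, and for which $F_\varepsilon\cap B=(F\cap B)_\varepsilon$ for all sufficiently small $\varepsilon>0$, one has $$0<\underline C_k^f(F,B)<\overline C_k^f(F,B)<\infty .$$ -/

import Mathlib

open MeasureTheory Filter Topology Set

open scoped NNReal ENNReal

noncomputable section

/-- A conformal graph directed system (cGDS) on the real line: a finite directed multigraph with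
vertices `V`, edges `E`, where the edge `e` goes from `init e` to `term e`, non-empty compact
intervals `X v` that are the closure of their interior, and for every edge `e` an injective
contraction `φ e : X (term e) → X (init e)`. The maps are represented by total functions `ℝ → ℝ`;
only their values on `X (term e)` are ever used. -/
structure ConformalGDS (V E : Type*) [Fintype V] [Fintype E] where
  init : E → V
  term : E → V
  X : V → Set ℝ
  φ : E → ℝ → ℝ
  nonempty_X : ∀ v, (X v).Nonempty
  isCompact_X : ∀ v, IsCompact (X v)
  isConnected_X : ∀ v, IsConnected (X v)
  closure_interior_X : ∀ v, closure (interior (X v)) = X v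
  mapsTo : ∀ e, MapsTo (φ e) (X (term e)) (X (init e))
  injOn : ∀ e, InjOn (φ e) (X (term e))
  /-- a common Lipschitz constant smaller than one -/
  contracting : ∃ r : ℝ≥0, 0 < r ∧ r < 1 ∧ ∀ e, LipschitzOnWith r (φ e) (X (term e))
  /-- the open set condition -/
  openSet : ∀ e e', e ≠ e' →
    Disjoint (φ e '' interior (X (term e))) (φ e' '' interior (X (term e')))
  /-- each `φ e` extends to a `C^{1+α}`-diffeomorphism from `W (term e)` into `W (init e)` whose
  derivative is bounded away from zero -/
  conformal : ∃ α : ℝ≥0, 0 < α ∧ α ≤ 1 ∧ ∃ W : V → Set ℝ,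
    (∀ v, IsOpen (W v) ∧ IsConnected (W v) ∧ X v ⊆ W v) ∧
    ∀ e, ∃ g : ℝ → ℝ, EqOn g (φ e) (X (term e)) ∧
      MapsTo g (W (term e)) (W (init e)) ∧ InjOn g (W (term e)) ∧
      DifferentiableOn ℝ g (W (term e)) ∧
      (∃ C : ℝ≥0, HolderOnWith C α (deriv g) (W (term e))) ∧
      ∃ c : ℝ, 0 < c ∧ ∀ x ∈ W (term e), c ≤ |deriv g x|

namespace ConformalGDS

variable {V E : Type*} [Fintype V] [Fintype E] (Φ : ConformalGDS V E)

/-- An sGDS is a cGDS all of whose maps are similarities. -/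
def IsSGDS : Prop :=
  ∀ e, ∃ ρ : ℝ, 0 < ρ ∧
    ∀ x ∈ Φ.X (Φ.term e), ∀ y ∈ Φ.X (Φ.term e), |Φ.φ e x - Φ.φ e y| = ρ * |x - y|

open Classical in
/-- The incidence matrix: `A e e' = 1` if and only if `term e = init e'`. -/
def incidence : Matrix E E ℕ := fun e e' => if Φ.term e = Φ.init e' then 1 else 0

open Classical in
/-- The incidence matrix is aperiodic and irreducible: some power has only positive entries. -/
def AperiodicIrreducible : Prop :=
  ∃ n : ℕ, 1 ≤ n ∧ ∀ e e', 0 < (Φ.incidence ^ n) e e'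

/-! ### Words and the shift space -/

/-- The set of infinite admissible words. -/
def Words : Type _ := {ω : ℕ → E // ∀ n, Φ.incidence (ω n) (ω (n + 1)) = 1}

/-- The topology induced by the product topology of the discrete topologies. -/
instance : TopologicalSpace Φ.Words :=
  TopologicalSpace.induced (fun ω => ω.1)
    (@Pi.topologicalSpace ℕ (fun _ => E) (fun _ => ⊥))

instance : MeasurableSpace Φ.Words := borel _

instance : BorelSpace Φ.Words := ⟨rfl⟩

/-- The shift map on infinite words. -/
def shift (ω : Φ.Words) : Φ.Words := ⟨fun n => ω.1 (n + 1), fun n => ω.2 (n + 1)⟩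

/-- Finite admissible words (including the empty word). -/
def IsAdmissible (u : List E) : Prop := u.IsChain (fun e e' => Φ.incidence e e' = 1)

/-- The admissible words of length `m` that end in the vertex `v`. -/
def wordsTo (v : V) (m : ℕ) : Set (List E) :=
  {u | u.length = m ∧ Φ.IsAdmissible u ∧ ∃ e ∈ u.getLast?, Φ.term e = v}

/-- The cylinder set of a finite word. -/
def cylinder (u : List E) : Set Φ.Words := {ω | ∀ k : Fin u.length, ω.1 k = u.get k}

/-- The map `φ_u = φ_{u₁} ∘ ⋯ ∘ φ_{uₙ}` of a finite word. -/
def wordMap : List E → ℝ → ℝ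
  | [] => id
  | e :: u => Φ.φ e ∘ wordMap u

/-- The initial word of length `n` of an infinite word. -/
def initialWord (ω : Φ.Words) (n : ℕ) : List E := (List.range n).map ω.1

/-- The set `φ_{ω|n}(X_{t(ω_n)})` for the initial word of length `n + 1`
(whose last letter is `ω.1 n`, since indices start with zero). -/
def piece (ω : Φ.Words) (n : ℕ) : Set ℝ :=
  Φ.wordMap (Φ.initialWord ω (n + 1)) '' Φ.X (Φ.term (ω.1 n))

/-! ### The code map -/

theorem term_eq_init (ω : Φ.Words) (n : ℕ) : Φ.term (ω.1 n) = Φ.init (ω.1 (n + 1)) := by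
  have h := ω.2 n
  unfold incidence at h
  by_contra hne
  simp [hne] at h

theorem wordMap_append (u w : List E) : Φ.wordMap (u ++ w) = Φ.wordMap u ∘ Φ.wordMap w := by
  induction u with
  | nil => rfl
  | cons e u ih => simp [wordMap, ih, Function.comp_assoc]

theorem wordMap_initialWord_succ (ω : Φ.Words) (n : ℕ) :
    Φ.wordMap (Φ.initialWord ω (n + 1)) = Φ.wordMap (Φ.initialWord ω n) ∘ Φ.φ (ω.1 n) := by
  simp [initialWord, List.range_succ, wordMap_append, wordMap]

theorem piece_succ_subset (ω : Φ.Words) (n : ℕ) : Φ.piece ω (n + 1) ⊆ Φ.piece ω n := by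
  unfold piece
  rw [wordMap_initialWord_succ, image_comp]
  refine image_mono ?_
  rw [term_eq_init Φ ω n]
  exact (Φ.mapsTo _).image_subset

theorem wordMap_lipschitz {r : ℝ≥0} (hr : ∀ e, LipschitzOnWith r (Φ.φ e) (Φ.X (Φ.term e)))
    (ω : Φ.Words) (n : ℕ) :
    LipschitzOnWith (r ^ (n + 1)) (Φ.wordMap (Φ.initialWord ω (n + 1)))
      (Φ.X (Φ.term (ω.1 n))) := by
  induction n with
  | zero => simpa [initialWord, wordMap] using hr (ω.1 0)
  | succ n ih =>
    rw [wordMap_initialWord_succ, pow_succ]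
    refine ih.comp (hr _) ?_
    rw [term_eq_init Φ ω n]
    exact Φ.mapsTo _

theorem isCompact_piece (ω : Φ.Words) (n : ℕ) : IsCompact (Φ.piece ω n) := by
  obtain ⟨r, -, -, hr⟩ := Φ.contracting
  exact (Φ.isCompact_X _).image_of_continuousOn (Φ.wordMap_lipschitz hr ω n).continuousOn

/-- The intersection of the sets `φ_{ω|n}(X_{t(ω_n)})` is a singleton. -/
theorem existsUnique_code (ω : Φ.Words) : ∃! x : ℝ, x ∈ ⋂ n, Φ.piece ω n := by
  have hne : (⋂ n, Φ.piece ω n).Nonempty :=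
    IsCompact.nonempty_iInter_of_sequence_nonempty_isCompact_isClosed _
      (Φ.piece_succ_subset ω) (fun n => (Φ.nonempty_X _).image _) (Φ.isCompact_piece ω 0)
      (fun n => (Φ.isCompact_piece ω n).isClosed)
  obtain ⟨x, hx⟩ := hne
  refine ⟨x, hx, fun y hy => ?_⟩
  obtain ⟨r, -, hr1, hr⟩ := Φ.contracting
  have hbd : ∃ D : ℝ, ∀ v, Metric.diam (Φ.X v) ≤ D :=
    ⟨∑ v, Metric.diam (Φ.X v), fun v =>
      Finset.single_le_sum (f := fun v => Metric.diam (Φ.X v))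
        (fun _ _ => Metric.diam_nonneg) (Finset.mem_univ v)⟩
  obtain ⟨D, hD⟩ := hbd
  have hle : ∀ n : ℕ, dist y x ≤ (r : ℝ) ^ (n + 1) * D := by
    intro n
    obtain ⟨a, ha, hax⟩ := mem_iInter.1 hx n
    obtain ⟨b, hb, hby⟩ := mem_iInter.1 hy n
    rw [← hax, ← hby]
    refine ((Φ.wordMap_lipschitz hr ω n).dist_le_mul b hb a ha).trans ?_
    push_cast
    exact mul_le_mul_of_nonneg_left
      ((Metric.dist_le_diam_of_mem (Φ.isCompact_X _).isBounded hb ha).trans (hD _))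
      (by positivity)
  have hlim : Tendsto (fun n : ℕ => (r : ℝ) ^ (n + 1) * D) atTop (𝓝 0) := by
    have h := (tendsto_pow_atTop_nhds_zero_of_lt_one r.2 (by exact_mod_cast hr1)).comp
      (tendsto_add_atTop_nat 1)
    simpa using h.mul_const D
  exact dist_le_zero.1 (ge_of_tendsto' hlim hle)

/-- The code map: `code ω` is the only element of `⋂ n, φ_{ω|n}(X_{t(ω_n)})`. -/
def code (ω : Φ.Words) : ℝ := (Φ.existsUnique_code ω).choose

/-- The limit set. -/
def limitSet : Set ℝ := range Φ.code

/-! ### Primary gaps and image gaps -/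

/-- `L^v`: the convex hull of the union of the sets `π[e]` over the edges `e` starting in `v`,
without the convex hulls of the individual sets `π[e]`. -/
def gapRegion (v : V) : Set ℝ :=
  convexHull ℝ (⋃ e ∈ {e | Φ.init e = v}, Φ.code '' Φ.cylinder [e]) \
    ⋃ e ∈ {e | Φ.init e = v}, convexHull ℝ (Φ.code '' Φ.cylinder [e])

/-- The primary gaps `L^{v,j}`: the connected components of `L^v`. -/
def primaryGaps (v : V) : Set (Set ℝ) :=
  {L | ∃ x ∈ Φ.gapRegion v, L = connectedComponentIn (Φ.gapRegion v) x}

/-- The sum of `|φ_u(L^{v,j})|^δ` over all primary gaps `L^{v,j}` and all admissible words `u` of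
length `m` that end in `v`. -/
def imageGapSum (δ : ℝ) (m : ℕ) : ℝ :=
  ∑ v, ∑ᶠ L ∈ Φ.primaryGaps v, ∑ᶠ u ∈ Φ.wordsTo v m, Metric.diam (Φ.wordMap u '' L) ^ δ

/-! ### Thermodynamic formalism -/

/-- The geometric potential function `ξ(ω) = - ln |φ'_{ω₁}(π(σω))|`. -/
def geometricPotential (ω : Φ.Words) : ℝ :=
  -Real.log |derivWithin (Φ.φ (ω.1 0)) (Φ.X (Φ.term (ω.1 0))) (Φ.code (Φ.shift ω))|

/-- A function on the shift space is lattice if it is cohomologous to a continuous function whose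
range is contained in a discrete subgroup of `ℝ`. -/
def IsLattice (f : Φ.Words → ℝ) : Prop :=
  ∃ ζ ψ : C(Φ.Words, ℝ), (∀ ω, f ω - ζ ω = ψ ω - ψ (Φ.shift ω)) ∧
    ∃ H : AddSubgroup ℝ, DiscreteTopology H ∧ ∀ ω, ζ ω ∈ H

/-- The Perron-Frobenius operator for the potential function `f`. -/
def perronFrobenius (f ψ : Φ.Words → ℝ) (ω : Φ.Words) : ℝ :=
  ∑ᶠ u ∈ {u | Φ.shift u = ω}, Real.exp (f u) * ψ u

/-- `ν` is a Borel probability measure with `L_f^* ν = γ ν`. -/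
def IsEigenmeasure (f : Φ.Words → ℝ) (γ : ℝ) (ν : Measure Φ.Words) : Prop :=
  IsProbabilityMeasure ν ∧
    ∀ ψ : C(Φ.Words, ℝ), ∫ ω, Φ.perronFrobenius f ψ ω ∂ν = γ * ∫ ω, ψ ω ∂ν

/-- `h` is a strictly positive continuous eigenfunction of the Perron-Frobenius operator for `f`
with eigenvalue one, normalised by `∫ h dν = 1` where `ν` is the eigenmeasure with eigenvalue one
of the dual operator. -/
def IsPerronEigenfunction (f : Φ.Words → ℝ) (h : C(Φ.Words, ℝ)) : Prop :=
  (∀ ω, 0 < h ω) ∧ (∀ ω, Φ.perronFrobenius f h ω = h ω) ∧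
    ∃ ν : Measure Φ.Words, Φ.IsEigenmeasure f 1 ν ∧ ∫ ω, h ω ∂ν = 1

end ConformalGDS

/-! ### Minkowski dimension and fractal curvatures of subsets of the line

The closed `ε`-parallel neighbourhood of `Y` is `Metric.cthickening ε Y`. -/

/-- The upper Minkowski dimension. -/
def upperMinkowskiDim (Y : Set ℝ) : EReal :=
  1 - liminf (fun ε : ℝ =>
    ((Real.log (volume (Metric.cthickening ε Y)).toReal / Real.log ε : ℝ) : EReal)) (𝓝[>] 0)

/-- The lower Minkowski dimension. -/
def lowerMinkowskiDim (Y : Set ℝ) : EReal :=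
  1 - limsup (fun ε : ℝ =>
    ((Real.log (volume (Metric.cthickening ε Y)).toReal / Real.log ε : ℝ) : EReal)) (𝓝[>] 0)

/-- The Minkowski dimension of `Y` exists and equals `δ`. -/
def HasMinkowskiDim (Y : Set ℝ) (δ : ℝ) : Prop :=
  upperMinkowskiDim Y = δ ∧ lowerMinkowskiDim Y = δ

/-- The 0-th curvature scaling exponent. -/
def scalingExponent0 (Y : Set ℝ) : ℝ :=
  sInf {t : ℝ | Tendsto (fun ε : ℝ => ENNReal.ofReal (ε ^ t) *
    Measure.count (frontier (Metric.cthickening ε Y))) (𝓝[>] 0) (𝓝 0)}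

/-- The 1-st curvature scaling exponent. -/
def scalingExponent1 (Y : Set ℝ) : ℝ :=
  sInf {t : ℝ | Tendsto (fun ε : ℝ => ENNReal.ofReal (ε ^ t) *
    volume (Metric.cthickening ε Y)) (𝓝[>] 0) (𝓝 0)}

/-- The rescaled 0-th curvature `ε^{s₀(Y)} λ⁰(∂Y_ε ∩ B) / 2`. -/
def rescaledCurvature0 (Y B : Set ℝ) (ε : ℝ) : ℝ≥0∞ :=
  ENNReal.ofReal (ε ^ scalingExponent0 Y) *
    Measure.count (frontier (Metric.cthickening ε Y) ∩ B) / 2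

/-- The rescaled 1-st curvature `ε^{s₁(Y)} λ¹(Y_ε ∩ B)`. -/
def rescaledCurvature1 (Y B : Set ℝ) (ε : ℝ) : ℝ≥0∞ :=
  ENNReal.ofReal (ε ^ scalingExponent1 Y) * volume (Metric.cthickening ε Y ∩ B)

/-- The rescaled `k`-th curvature, `k ∈ {0, 1}`. -/
def rescaledCurvature (k : Fin 2) (Y B : Set ℝ) (ε : ℝ) : ℝ≥0∞ :=
  if k = 0 then rescaledCurvature0 Y B ε else rescaledCurvature1 Y B ε

/-- `upper C_k^f(Y, B)`. -/
def upperFractalCurvature (k : Fin 2) (Y B : Set ℝ) : ℝ≥0∞ :=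
  limsup (rescaledCurvature k Y B) (𝓝[>] 0)

/-- `lower C_k^f(Y, B)`. -/
def lowerFractalCurvature (k : Fin 2) (Y B : Set ℝ) : ℝ≥0∞ :=
  liminf (rescaledCurvature k Y B) (𝓝[>] 0)

end

/-! Everything is reduced to two finite objects: the gaps (bounded complementary intervals) of
compact subsets of the line, and the matrix `weight s` with entries r_e^s A_{e,e'}, where r_e is the
contraction ratio of the edge e. The similarities extend to affine maps of the line (`AffineModel`),
so the geometric potential depends on the first letter only and equals -ln r_e there.

The dimension δ is the exponent at which `weight δ` has a positive fixed column vector q. It is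
obtained as the largest s in [0,1] for which some nonzero x ≥ 0 satisfies x ≤ `weight s` x
(`exists_exponent_mulVec_eq_self`). The value s = 1 is excluded by λ¹(F) = 0: such an x would
produce at least K/ε gaps longer than 2ε and keep the volume of the ε-neighbourhoods away from zero.
The value δ = 0 is excluded by the presence of two edges.

For compact Y, with N(ε) the number of gaps longer than 2ε, the boundary of Y_ε has 2 + 2N(ε) points
and the volume of Y_ε is the length of the hull plus 2ε minus the sum of (length - 2ε) over these
gaps. Each set π[e] is an affine image of the union of the π[e'] over the successors e' of e.
Comparison with q_e ε^(-δ), by induction over scales, shows that N(ε) is of order ε^(-δ) and the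
volume of order ε^(1-δ) (`gapGrowth_branch`). This yields the Minkowski dimension, both scaling
exponents and the finite positive bounds on the curvatures.

For statement 1, let H be the positive fixed row vector of `weight δ`, normalised by H·q = 1. The
eigenfunction is ω ↦ H(ω₁): the eigenmeasure, obtained by Hahn-Banach separation and Riesz
representation, gives mass q_e to [e], and a minimum argument on the quotient of two fixed functions
gives uniqueness. The image gap sums are linear combinations of entries of the row vectors
1·(`weight δ`)^m, which converge to H by a Doeblin contraction. The vector H depends only on the
initial vertex of an edge, whence the independence of the chosen words.

For statement 2, in the lattice case the logarithms of all gap lengths lie in finitely many cosets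
of a discrete group aℤ. Hence there are arbitrarily small windows [κu, u] with fixed κ < 1 such that
no gap length lies in (2κu, 2u]. On such a window N is constant and the volume is affine in ε. A
limit of the rescaled boundary count would force κ^δ = 1, and a limit of the rescaled volume would
make the strictly concave function t^(1-δ) affine at three points. -/

/-! ### Gaps of compact subsets of the line -/

/-- The bounded complementary intervals of `K`, given by their pairs of endpoints. -/
def gaps (K : Set ℝ) : Set (ℝ × ℝ) :=
  {p | p.1 ∈ K ∧ p.2 ∈ K ∧ p.1 < p.2 ∧ ∀ x ∈ K, x ≤ p.1 ∨ p.2 ≤ x}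

/-- The gaps that are longer than `2 * ε`. -/
def bigGaps (K : Set ℝ) (ε : ℝ) : Set (ℝ × ℝ) := {p | p ∈ gaps K ∧ 2 * ε < p.2 - p.1}

theorem gaps_eq_of_fst_eq {K : Set ℝ} {p q : ℝ × ℝ} (hp : p ∈ gaps K) (hq : q ∈ gaps K)
    (h : p.1 = q.1) : p = q := by
  obtain ⟨-, h2, h3, h4⟩ := hp
  obtain ⟨-, k2, k3, k4⟩ := hq
  refine Prod.ext h ?_
  rcases h4 _ k2 with h' | h' <;> rcases k4 _ h2 with k' | k' <;> linarith

theorem gaps_eq_of_snd_eq {K : Set ℝ} {p q : ℝ × ℝ} (hp : p ∈ gaps K) (hq : q ∈ gaps K)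
    (h : p.2 = q.2) : p = q := by
  obtain ⟨h1, -, h3, h4⟩ := hp
  obtain ⟨k1, -, k3, k4⟩ := hq
  refine Prod.ext ?_ h
  rcases h4 _ k1 with h' | h' <;> rcases k4 _ h1 with k' | k' <;> linarith

/-- The left ends of two different long gaps are more than 2ε apart, so they fall into different
cells of a grid of mesh ε. -/
theorem finite_bigGaps {K : Set ℝ} (hK : IsCompact K) {ε : ℝ} (hε : 0 < ε) :
    (bigGaps K ε).Finite := by
  obtain ⟨m, hm⟩ := hK.bddBelow
  obtain ⟨M, hM⟩ := hK.bddAbove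
  refine Set.Finite.of_injOn (f := fun p : ℝ × ℝ => ⌊p.1 / ε⌋) (t := Set.Icc ⌊m / ε⌋ ⌊M / ε⌋)
    (fun p hp => ⟨?_, ?_⟩) ?_ (Set.finite_Icc _ _)
  · exact Int.floor_le_floor (div_le_div_of_nonneg_right (hm hp.1.1) hε.le)
  · exact Int.floor_le_floor (div_le_div_of_nonneg_right (hM hp.1.1) hε.le)
  · have key : ∀ p ∈ bigGaps K ε, ∀ q ∈ bigGaps K ε, ⌊p.1 / ε⌋ = ⌊q.1 / ε⌋ → q.1 ≤ p.1 := by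
      intro p hp q hq h
      by_contra! hlt
      rcases hp.1.2.2.2 _ hq.1.1 with h' | h'
      · linarith
      · have h1 : q.1 ≥ p.1 + 2 * ε := by linarith [hp.2]
        have h2 : q.1 / ε ≥ p.1 / ε + 2 := by
          rw [ge_iff_le, le_div_iff₀ hε, add_mul, div_mul_cancel₀ _ hε.ne']; linarith
        have h3 := Int.floor_le (p.1 / ε)
        have h4 := Int.lt_floor_add_one (q.1 / ε)
        have h5 := Int.lt_floor_add_one (p.1 / ε)
        have h6 := Int.floor_le (q.1 / ε)
        rw [h] at h3 h5
        linarith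
    intro p hp q hq h
    exact gaps_eq_of_fst_eq hp.1 hq.1 (le_antisymm (key q hq p hp h.symm) (key p hp q hq h))

theorem exists_gap_of_notMem {K : Set ℝ} (hK : IsCompact K) {x a b : ℝ} (hx : x ∉ K)
    (ha : a ∈ K) (hax : a ≤ x) (hb : b ∈ K) (hxb : x ≤ b) :
    ∃ p ∈ gaps K, p.1 < x ∧ x < p.2 := by
  have hc1 : IsCompact (K ∩ Iic x) := hK.inter_right isClosed_Iic
  have hc2 : IsCompact (K ∩ Ici x) := hK.inter_right isClosed_Ici
  have h1 := hc1.sSup_mem ⟨a, ha, hax⟩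
  have h2 := hc2.sInf_mem ⟨b, hb, hxb⟩
  have h3 : sSup (K ∩ Iic x) < x := lt_of_le_of_ne h1.2 (fun h => hx (h ▸ h1.1))
  have h4 : x < sInf (K ∩ Ici x) := lt_of_le_of_ne h2.2 (fun h => hx (h ▸ h2.1))
  refine ⟨(_, _), ⟨h1.1, h2.1, h3.trans h4, fun y hy => ?_⟩, h3, h4⟩
  rcases le_total y x with h | h
  · exact Or.inl (le_csSup hc1.bddAbove ⟨hy, h⟩)
  · exact Or.inr (csInf_le hc2.bddBelow ⟨hy, h⟩)

theorem exists_gap_of_volume_eq_zero {K : Set ℝ} (hK : IsCompact K) (h0 : volume K = 0)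
    {a b : ℝ} (ha : a ∈ K) (hb : b ∈ K) (hab : a < b) : (gaps K).Nonempty := by
  have : ¬ Icc a b ⊆ K := fun h => by
    have := measure_mono_null h h0
    rw [Real.volume_Icc, ENNReal.ofReal_eq_zero] at this
    linarith
  obtain ⟨x, hx, hxK⟩ := Set.not_subset.1 this
  obtain ⟨p, hp, -⟩ := exists_gap_of_notMem hK hxK ha hx.1 hb hx.2
  exact ⟨p, hp⟩

theorem mem_cthickening_iff_of_isCompact {K : Set ℝ} (hK : IsCompact K) {ε : ℝ} (hε : 0 ≤ ε)
    {x : ℝ} : x ∈ Metric.cthickening ε K ↔ ∃ y ∈ K, |x - y| ≤ ε := by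
  rw [hK.cthickening_eq_biUnion_closedBall hε]
  simp [Real.dist_eq]

theorem notMem_cthickening_iff {K : Set ℝ} (hK : IsCompact K) (hne : K.Nonempty) {ε : ℝ}
    (hε : 0 < ε) {x : ℝ} : x ∉ Metric.cthickening ε K ↔
      x < sInf K - ε ∨ sSup K + ε < x ∨ ∃ p ∈ bigGaps K ε, p.1 + ε < x ∧ x < p.2 - ε := by
  rw [mem_cthickening_iff_of_isCompact hK hε.le]
  push Not
  constructor
  · intro h
    have hi := h _ (hK.sInf_mem hne)
    have hs := h _ (hK.sSup_mem hne)
    rcases lt_or_ge x (sInf K) with h1 | h1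
    · rw [abs_of_neg (by linarith)] at hi; left; linarith
    rcases lt_or_ge (sSup K) x with h2 | h2
    · rw [abs_of_pos (by linarith)] at hs; right; left; linarith
    have hxK : x ∉ K := fun hx => by have := h x hx; simp at this; linarith
    obtain ⟨p, hp, hp1, hp2⟩ := exists_gap_of_notMem hK hxK (hK.sInf_mem hne) h1
      (hK.sSup_mem hne) h2
    have e1 := h _ hp.1
    have e2 := h _ hp.2.1
    rw [abs_of_pos (by linarith)] at e1
    rw [abs_of_neg (by linarith)] at e2
    exact Or.inr (Or.inr ⟨p, ⟨hp, by linarith⟩, by linarith, by linarith⟩)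
  · rintro (h | h | ⟨p, hp, h1, h2⟩) y hy
    · have := csInf_le hK.bddBelow hy
      rw [abs_of_neg (by linarith)]; linarith
    · have := le_csSup hK.bddAbove hy
      rw [abs_of_pos (by linarith)]; linarith
    · rcases hp.1.2.2.2 y hy with h | h
      · rw [abs_of_pos (by linarith)]; linarith
      · rw [abs_of_neg (by linarith)]; linarith

theorem compl_cthickening_eq {K : Set ℝ} (hK : IsCompact K) (hne : K.Nonempty) {ε : ℝ}
    (hε : 0 < ε) : (Metric.cthickening ε K)ᶜ =
      Iio (sInf K - ε) ∪ (Ioi (sSup K + ε) ∪ ⋃ p ∈ bigGaps K ε, Ioo (p.1 + ε) (p.2 - ε)) := by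
  ext x
  rw [mem_compl_iff, notMem_cthickening_iff hK hne hε]
  simp only [mem_union, mem_Iio, mem_Ioi, mem_iUnion, mem_Ioo, exists_prop]

theorem frontier_cthickening_eq {K : Set ℝ} (hK : IsCompact K) (hne : K.Nonempty) {ε : ℝ}
    (hε : 0 < ε) : frontier (Metric.cthickening ε K) =
      ({sInf K - ε} ∪ {sSup K + ε}) ∪
        ((fun p => p.1 + ε) '' bigGaps K ε ∪ (fun p => p.2 - ε) '' bigGaps K ε) := by
  have hmem : ∀ x, x ∈ K → x + ε ∈ Metric.cthickening ε K ∧ x - ε ∈ Metric.cthickening ε K := by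
    intro x hx
    rw [mem_cthickening_iff_of_isCompact hK hε.le, mem_cthickening_iff_of_isCompact hK hε.le]
    refine ⟨⟨x, hx, ?_⟩, ⟨x, hx, ?_⟩⟩ <;> simp [abs_of_pos hε]
  rw [frontier_eq_closure_inter_closure, Metric.isClosed_cthickening.closure_eq,
    compl_cthickening_eq hK hne hε, closure_union, closure_union, closure_Iio, closure_Ioi,
    (finite_bigGaps hK hε).closure_biUnion]
  have hcl : ∀ p ∈ bigGaps K ε, closure (Ioo (p.1 + ε) (p.2 - ε)) = Icc (p.1 + ε) (p.2 - ε) :=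
    fun p hp => closure_Ioo (by linarith [hp.2])
  rw [iUnion₂_congr hcl]
  ext x
  constructor
  · rintro ⟨hx, hx'⟩
    have hn := (notMem_cthickening_iff hK hne hε (x := x)).not_right.1 hx
    push Not at hn
    simp only [mem_union, mem_Iic, mem_Ici, mem_iUnion, mem_Icc] at hx'
    rcases hx' with h | h | ⟨p, hp, h1, h2⟩
    · exact Or.inl (Or.inl (le_antisymm h hn.1))
    · exact Or.inl (Or.inr (le_antisymm hn.2.1 h))
    · rcases h1.eq_or_lt with h1 | h1
      · exact Or.inr (Or.inl ⟨p, hp, h1⟩)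
      · exact Or.inr (Or.inr ⟨p, hp, le_antisymm (hn.2.2 p hp h1) h2⟩)
  · simp only [mem_union, mem_inter_iff, mem_Iic, mem_Ici, mem_iUnion, mem_Icc, mem_singleton_iff,
      mem_image]
    rintro ((rfl | rfl) | (⟨p, hp, rfl⟩ | ⟨p, hp, rfl⟩))
    · exact ⟨(hmem _ (hK.sInf_mem hne)).2, Or.inl le_rfl⟩
    · exact ⟨(hmem _ (hK.sSup_mem hne)).1, Or.inr (Or.inl le_rfl)⟩
    · exact ⟨(hmem _ hp.1.1).1, Or.inr (Or.inr ⟨p, hp, le_rfl, by linarith [hp.2]⟩)⟩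
    · exact ⟨(hmem _ hp.1.2.1).2, Or.inr (Or.inr ⟨p, hp, by linarith [hp.2], le_rfl⟩)⟩

/-- Two outer boundary points, and two more inside every gap longer than 2ε. The strict inequality
in `bigGaps` is essential: a gap of length exactly 2ε is filled completely and has no boundary
point. -/
theorem count_frontier_cthickening {K : Set ℝ} (hK : IsCompact K) (hne : K.Nonempty) {ε : ℝ}
    (hε : 0 < ε) : Measure.count (frontier (Metric.cthickening ε K)) =
      ((2 + 2 * (bigGaps K ε).ncard : ℕ) : ℝ≥0∞) := by
  have hfin := finite_bigGaps hK hε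
  have hle : ∀ x ∈ K, sInf K ≤ x ∧ x ≤ sSup K := fun x hx =>
    ⟨csInf_le hK.bddBelow hx, le_csSup hK.bddAbove hx⟩
  have h0 : sInf K ≤ sSup K := (hle _ (hK.sInf_mem hne)).2
  have hfr : (frontier (Metric.cthickening ε K)).Finite := by
    rw [frontier_cthickening_eq hK hne hε]
    exact ((finite_singleton _).union (finite_singleton _)).union
      ((hfin.image _).union (hfin.image _))
  have hcard : (frontier (Metric.cthickening ε K)).ncard = 2 + 2 * (bigGaps K ε).ncard := by
    rw [frontier_cthickening_eq hK hne hε, ncard_union_eq _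
      ((finite_singleton _).union (finite_singleton _)) ((hfin.image _).union (hfin.image _)),
      ncard_union_eq _ (finite_singleton _) (finite_singleton _),
      ncard_union_eq _ (hfin.image _) (hfin.image _), InjOn.ncard_image, InjOn.ncard_image,
      ncard_singleton, ncard_singleton]
    · ring
    · intro p hp q hq h
      exact gaps_eq_of_snd_eq hp.1 hq.1 (by simpa using h)
    · intro p hp q hq h
      exact gaps_eq_of_fst_eq hp.1 hq.1 (by simpa using h)
    · rw [Set.disjoint_left]
      rintro x ⟨p, hp, rfl⟩ ⟨q, hq, h⟩
      simp only at h
      rcases hp.1.2.2.2 _ hq.1.2.1 with h' | h'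
      · linarith
      · linarith [hp.2]
    · rw [Set.disjoint_singleton]
      exact ne_of_lt (by linarith)
    · rw [Set.disjoint_left]
      rintro x (rfl | rfl) (⟨p, hp, h⟩ | ⟨p, hp, h⟩) <;> simp only at h <;>
        linarith [hle _ hp.1.1, hle _ hp.1.2.1, hp.1.2.2.1]
  rw [Measure.count_apply_finite _ hfr, ← hcard, ncard_eq_toFinset_card _ hfr]

/-- As long as `bigGaps K ε` does not change, the right-hand side is affine in ε. The oscillation of
the volume rests on this. -/
theorem volume_cthickening_eq {K : Set ℝ} (hK : IsCompact K) (hne : K.Nonempty) {ε : ℝ}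
    (hε : 0 < ε) : (volume (Metric.cthickening ε K)).toReal =
      (sSup K - sInf K + 2 * ε) -
        ∑ p ∈ (finite_bigGaps hK hε).toFinset, (p.2 - p.1 - 2 * ε) := by
  have hfin := finite_bigGaps hK hε
  have hle : ∀ x ∈ K, sInf K ≤ x ∧ x ≤ sSup K := fun x hx =>
    ⟨csInf_le hK.bddBelow hx, le_csSup hK.bddAbove hx⟩
  have h0 : sInf K ≤ sSup K := (hle _ (hK.sInf_mem hne)).2
  set U : Set ℝ := ⋃ p ∈ hfin.toFinset, Ioo (p.1 + ε) (p.2 - ε) with hU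
  have hUmeas : MeasurableSet U :=
    Finset.measurableSet_biUnion _ (fun p _ => measurableSet_Ioo)
  have hUsub : U ⊆ Icc (sInf K - ε) (sSup K + ε) := by
    intro x hx
    simp only [hU, mem_iUnion, mem_Ioo, Finite.mem_toFinset] at hx
    obtain ⟨p, hp, h1, h2⟩ := hx
    constructor <;> linarith [hle _ hp.1.1, hle _ hp.1.2.1]
  have hC : Metric.cthickening ε K = Icc (sInf K - ε) (sSup K + ε) \ U := by
    rw [← compl_inj_iff, compl_cthickening_eq hK hne hε]
    ext x
    simp only [hU, mem_union, mem_Iio, mem_Ioi, mem_iUnion, mem_compl_iff, Set.mem_sdiff, mem_Icc,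
      Finite.mem_toFinset, not_and_or, not_not, not_le]
    tauto
  have hUvol : volume U = ∑ p ∈ hfin.toFinset, volume (Ioo (p.1 + ε) (p.2 - ε)) := by
    refine measure_biUnion_finset ?_ (fun p _ => measurableSet_Ioo)
    intro p hp q hq hpq
    rw [Finset.mem_coe, Finite.mem_toFinset] at hp hq
    change Disjoint _ _
    rw [Set.disjoint_left]
    rintro x ⟨h1, h2⟩ ⟨h3, h4⟩
    rcases lt_trichotomy p.1 q.1 with h | h | h
    · rcases hp.1.2.2.2 _ hq.1.1 with h' | h' <;> linarith
    · exact hpq (gaps_eq_of_fst_eq hp.1 hq.1 h)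
    · rcases hq.1.2.2.2 _ hp.1.1 with h' | h' <;> linarith
  have hUreal : (volume U).toReal = ∑ p ∈ hfin.toFinset, (p.2 - p.1 - 2 * ε) := by
    rw [hUvol, ENNReal.toReal_sum (by simp)]
    refine Finset.sum_congr rfl fun p hp => ?_
    rw [Finite.mem_toFinset] at hp
    rw [Real.volume_Ioo, ENNReal.toReal_ofReal (by linarith [hp.2])]
    ring
  have hUfin : volume U ≠ ⊤ := by
    rw [hUvol]; exact (ENNReal.sum_lt_top.2 (by simp)).ne
  rw [hC, measure_sdiff hUsub hUmeas.nullMeasurableSet hUfin,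
    ENNReal.toReal_sub_of_le (measure_mono hUsub) (by simp), hUreal, Real.volume_Icc,
    ENNReal.toReal_ofReal (by linarith)]
  ring

/-- The intervals of length ε that start at the left ends of the long gaps are disjoint and lie in
the neighbourhood. -/
theorem volume_cthickening_ge {K : Set ℝ} (hK : IsCompact K) {ε : ℝ} (hε : 0 < ε) :
    ENNReal.ofReal (ε * (bigGaps K ε).ncard) ≤ volume (Metric.cthickening ε K) := by
  have hfin := finite_bigGaps hK hε
  have hsub : (⋃ p ∈ hfin.toFinset, Ioo p.1 (p.1 + ε)) ⊆ Metric.cthickening ε K := by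
    intro x hx
    simp only [mem_iUnion, mem_Ioo, Finite.mem_toFinset] at hx
    obtain ⟨p, hp, h1, h2⟩ := hx
    rw [mem_cthickening_iff_of_isCompact hK hε.le]
    exact ⟨p.1, hp.1.1, by rw [abs_of_pos] <;> linarith⟩
  refine le_trans ?_ (measure_mono hsub)
  rw [measure_biUnion_finset _ (fun p _ => measurableSet_Ioo)]
  · simp only [Real.volume_Ioo, add_sub_cancel_left, Finset.sum_const, nsmul_eq_mul]
    rw [mul_comm, ENNReal.ofReal_mul (by positivity), ncard_eq_toFinset_card _ hfin,
      ENNReal.ofReal_natCast]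
  · intro p hp q hq hpq
    rw [Finset.mem_coe, Finite.mem_toFinset] at hp hq
    change Disjoint _ _
    rw [Set.disjoint_left]
    rintro x ⟨h1, h2⟩ ⟨h3, h4⟩
    rcases lt_trichotomy p.1 q.1 with h | h | h
    · rcases hp.1.2.2.2 _ hq.1.1 with h' | h'
      · linarith
      · linarith [hp.2]
    · exact hpq (gaps_eq_of_fst_eq hp.1 hq.1 h)
    · rcases hq.1.2.2.2 _ hp.1.1 with h' | h'
      · linarith
      · linarith [hq.2]

/-! ### Gaps and neighbourhoods under affine maps -/

/-- A negative slope exchanges the two ends of a gap, hence the minimum and maximum. -/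
theorem gaps_image_affine {K : Set ℝ} {s b : ℝ} (hs : s ≠ 0) :
    gaps ((fun x => s * x + b) '' K) =
      (fun p : ℝ × ℝ => (min (s * p.1 + b) (s * p.2 + b), max (s * p.1 + b) (s * p.2 + b))) ''
        gaps K := by
  ext ⟨x, y⟩
  rcases hs.lt_or_gt with h | h
  · constructor
    · rintro ⟨⟨u, hu, rfl⟩, ⟨v, hv, rfl⟩, hlt, hall⟩
      simp only at hlt hall
      have hvu : v < u := by nlinarith
      refine ⟨(v, u), ⟨hv, hu, hvu, fun z hz => ?_⟩, ?_⟩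
      · rcases hall _ ⟨z, hz, rfl⟩ with h' | h'
        · right; simp only at h' ⊢; nlinarith
        · left; simp only at h' ⊢; nlinarith
      · simp [hlt.le]
    · rintro ⟨⟨u, v⟩, ⟨hu, hv, hlt, hall⟩, heq⟩
      simp only [Prod.mk.injEq] at hu hv hlt hall heq
      have h1 : s * v + b < s * u + b := by nlinarith
      rw [min_eq_right h1.le, max_eq_left h1.le] at heq
      obtain ⟨rfl, rfl⟩ := heq
      refine ⟨⟨v, hv, rfl⟩, ⟨u, hu, rfl⟩, h1, ?_⟩
      rintro _ ⟨z, hz, rfl⟩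
      rcases hall z hz with h' | h'
      · right; simp only; nlinarith
      · left; simp only; nlinarith
  · constructor
    · rintro ⟨⟨u, hu, rfl⟩, ⟨v, hv, rfl⟩, hlt, hall⟩
      simp only at hlt hall
      have hvu : u < v := by nlinarith
      refine ⟨(u, v), ⟨hu, hv, hvu, fun z hz => ?_⟩, ?_⟩
      · rcases hall _ ⟨z, hz, rfl⟩ with h' | h'
        · left; simp only at h' ⊢; nlinarith
        · right; simp only at h' ⊢; nlinarith
      · simp [hlt.le]
    · rintro ⟨⟨u, v⟩, ⟨hu, hv, hlt, hall⟩, heq⟩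
      simp only [Prod.mk.injEq] at hu hv hlt hall heq
      have h1 : s * u + b < s * v + b := by nlinarith
      rw [min_eq_left h1.le, max_eq_right h1.le] at heq
      obtain ⟨rfl, rfl⟩ := heq
      refine ⟨⟨u, hu, rfl⟩, ⟨v, hv, rfl⟩, h1, ?_⟩
      rintro _ ⟨z, hz, rfl⟩
      rcases hall z hz with h' | h'
      · left; simp only; nlinarith
      · right; simp only; nlinarith

theorem max_sub_min_affine {s b x y : ℝ} (hxy : x < y) :
    max (s * x + b) (s * y + b) - min (s * x + b) (s * y + b) = |s| * (y - x) := by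
  rw [max_sub_min_eq_abs, ← abs_of_pos (sub_pos.2 hxy), ← abs_mul]
  congr 1
  ring

theorem exists_gap_of_mem_gaps_image_affine {K : Set ℝ} {s b : ℝ} (hs : s ≠ 0) {p : ℝ × ℝ}
    (hp : p ∈ gaps ((fun x => s * x + b) '' K)) :
    ∃ q ∈ gaps K, p.2 - p.1 = |s| * (q.2 - q.1) := by
  rw [gaps_image_affine hs] at hp
  obtain ⟨q, hq, rfl⟩ := hp
  exact ⟨q, hq, max_sub_min_affine hq.2.2.1⟩

theorem ncard_bigGaps_image_affine (K : Set ℝ) {s : ℝ} (b : ℝ) (hs : s ≠ 0) (ε : ℝ) :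
    (bigGaps ((fun x => s * x + b) '' K) ε).ncard = (bigGaps K (ε / |s|)).ncard := by
  have hs' : 0 < |s| := abs_pos.2 hs
  have h1 : bigGaps ((fun x => s * x + b) '' K) ε =
      (fun p : ℝ × ℝ => (min (s * p.1 + b) (s * p.2 + b), max (s * p.1 + b) (s * p.2 + b))) ''
        bigGaps K (ε / |s|) := by
    have hl : ∀ q ∈ gaps K, (2 * (ε / |s|) < q.2 - q.1 ↔ 2 * ε <
        max (s * q.1 + b) (s * q.2 + b) - min (s * q.1 + b) (s * q.2 + b)) := by
      intro q hq
      rw [max_sub_min_affine hq.2.2.1, ← mul_div_assoc, div_lt_iff₀ hs', mul_comm |s|]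
    ext p
    constructor
    · rintro ⟨hp, hlen⟩
      rw [gaps_image_affine hs] at hp
      obtain ⟨q, hq, rfl⟩ := hp
      exact ⟨q, ⟨hq, (hl q hq).2 hlen⟩, rfl⟩
    · rintro ⟨q, ⟨hq, hlen⟩, rfl⟩
      refine ⟨?_, (hl q hq).1 hlen⟩
      rw [gaps_image_affine hs]
      exact ⟨q, hq, rfl⟩
  rw [h1, InjOn.ncard_image]
  rintro ⟨x, y⟩ ⟨hp, -⟩ ⟨z, w⟩ ⟨hq, -⟩ h
  simp only [Prod.mk.injEq] at h
  have hxy : x < y := hp.2.2.1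
  have hzw : z < w := hq.2.2.1
  rcases hs.lt_or_gt with hs | hs
  · rw [min_eq_right (by nlinarith), min_eq_right (by nlinarith), max_eq_left (by nlinarith),
      max_eq_left (by nlinarith)] at h
    exact Prod.ext (mul_left_cancel₀ hs.ne (by linarith [h.2]))
      (mul_left_cancel₀ hs.ne (by linarith [h.1]))
  · rw [min_eq_left (by nlinarith), min_eq_left (by nlinarith), max_eq_right (by nlinarith),
      max_eq_right (by nlinarith)] at h
    exact Prod.ext (mul_left_cancel₀ hs.ne' (by linarith [h.1]))
      (mul_left_cancel₀ hs.ne' (by linarith [h.2]))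

open scoped Pointwise in
theorem volume_image_affine (S : Set ℝ) (s b : ℝ) :
    volume ((fun x => s * x + b) '' S) = ENNReal.ofReal |s| * volume S := by
  have : (fun x => s * x + b) '' S = (fun x => x + b) '' (s • S) := by
    rw [← image_smul, image_image]; rfl
  rw [this, image_add_right, measure_preimage_add_right, Measure.addHaar_smul]
  simp

theorem cthickening_image_affine {K : Set ℝ} (hK : IsCompact K) {s : ℝ} (b : ℝ) (hs : s ≠ 0)
    {ε : ℝ} (hε : 0 ≤ ε) : Metric.cthickening ε ((fun x => s * x + b) '' K) =
      (fun x => s * x + b) '' Metric.cthickening (ε / |s|) K := by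
  have hs' : 0 < |s| := abs_pos.2 hs
  have hK' : IsCompact ((fun x => s * x + b) '' K) := hK.image (by fun_prop)
  ext x
  rw [mem_cthickening_iff_of_isCompact hK' hε]
  simp only [mem_image, exists_exists_and_eq_and]
  have key : ∀ z y : ℝ, |s * z + b - (s * y + b)| = |s| * |z - y| := fun z y => by
    rw [← abs_mul]; congr 1; ring
  constructor
  · rintro ⟨y, hy, h⟩
    have hx : s * ((x - b) / s) + b = x := by field_simp; ring
    refine ⟨(x - b) / s, ?_, hx⟩
    rw [mem_cthickening_iff_of_isCompact hK (by positivity)]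
    rw [← hx, key] at h
    exact ⟨y, hy, by rwa [le_div_iff₀ hs', mul_comm]⟩
  · rintro ⟨z, hz, rfl⟩
    rw [mem_cthickening_iff_of_isCompact hK (by positivity)] at hz
    obtain ⟨y, hy, h⟩ := hz
    refine ⟨y, hy, ?_⟩
    rw [key]
    rwa [le_div_iff₀ hs', mul_comm] at h

theorem volume_cthickening_image_affine {K : Set ℝ} (hK : IsCompact K) {s : ℝ} (b : ℝ)
    (hs : s ≠ 0) {ε : ℝ} (hε : 0 ≤ ε) :
    volume (Metric.cthickening ε ((fun x => s * x + b) '' K)) =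
      ENNReal.ofReal |s| * volume (Metric.cthickening (ε / |s|) K) := by
  rw [cthickening_image_affine hK b hs hε, volume_image_affine]

/-! ### Finite unions -/

theorem cthickening_biUnion_finset {ι : Type*} (s : Finset ι) {K : ι → Set ℝ}
    (hK : ∀ i ∈ s, IsCompact (K i)) {ε : ℝ} (hε : 0 ≤ ε) :
    Metric.cthickening ε (⋃ i ∈ s, K i) = ⋃ i ∈ s, Metric.cthickening ε (K i) := by
  ext x
  rw [mem_cthickening_iff_of_isCompact (s.isCompact_biUnion hK) hε]
  simp only [mem_iUnion, exists_prop]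
  constructor
  · rintro ⟨y, ⟨i, hi, hy⟩, h⟩
    exact ⟨i, hi, (mem_cthickening_iff_of_isCompact (hK i hi) hε).2 ⟨y, hy, h⟩⟩
  · rintro ⟨i, hi, hx⟩
    obtain ⟨y, hy, h⟩ := (mem_cthickening_iff_of_isCompact (hK i hi) hε).1 hx
    exact ⟨y, ⟨i, hi, hy⟩, h⟩

theorem frontier_cthickening_biUnion_subset {ι : Type*} (s : Finset ι) {K : ι → Set ℝ}
    (hK : ∀ i ∈ s, IsCompact (K i)) {ε : ℝ} (hε : 0 ≤ ε) :
    frontier (Metric.cthickening ε (⋃ i ∈ s, K i)) ⊆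
      ⋃ i ∈ s, frontier (Metric.cthickening ε (K i)) := by
  intro x hx
  rw [frontier_eq_closure_inter_closure, Metric.isClosed_cthickening.closure_eq] at hx
  obtain ⟨h1, h2⟩ := hx
  have h1' := h1
  rw [cthickening_biUnion_finset s hK hε] at h1'
  simp only [mem_iUnion, exists_prop] at h1' ⊢
  obtain ⟨i, hi, hxi⟩ := h1'
  refine ⟨i, hi, ?_⟩
  rw [frontier_eq_closure_inter_closure, Metric.isClosed_cthickening.closure_eq]
  refine ⟨hxi, closure_mono (compl_subset_compl.2 ?_) h2⟩
  exact Metric.cthickening_subset_of_subset _ (subset_biUnion_of_mem (u := K) hi)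

/-- The boundary of a union lies in the union of the boundaries, and a boundary has 2(1 + N) points.
The summand 1 pays for the new gaps between different sets, so 1 + N is subadditive although N is
not. -/
theorem one_add_ncard_bigGaps_biUnion_le {ι : Type*} (s : Finset ι) (hs : s.Nonempty)
    {K : ι → Set ℝ} (hK : ∀ i ∈ s, IsCompact (K i)) (hne : ∀ i ∈ s, (K i).Nonempty) {ε : ℝ}
    (hε : 0 < ε) : 1 + (bigGaps (⋃ i ∈ s, K i) ε).ncard ≤
      ∑ i ∈ s, (1 + (bigGaps (K i) ε).ncard) := by
  have hne' : (⋃ i ∈ s, K i).Nonempty := by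
    obtain ⟨i, hi⟩ := hs
    exact (hne i hi).mono (subset_biUnion_of_mem (u := K) hi)
  have h := (measure_mono (frontier_cthickening_biUnion_subset s hK hε.le)).trans
    (measure_biUnion_finset_le (μ := Measure.count) s _)
  rw [count_frontier_cthickening (s.isCompact_biUnion hK) hne' hε, Finset.sum_congr rfl
    (fun i hi => count_frontier_cthickening (hK i hi) (hne i hi) hε), ← Nat.cast_sum,
    Nat.cast_le] at h
  have h2 : ∑ i ∈ s, (2 + 2 * (bigGaps (K i) ε).ncard) =
      2 * ∑ i ∈ s, (1 + (bigGaps (K i) ε).ncard) := by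
    rw [Finset.mul_sum]
    exact Finset.sum_congr rfl fun i _ => by ring
  omega

theorem volume_cthickening_biUnion_le {ι : Type*} (s : Finset ι) {K : ι → Set ℝ}
    (hK : ∀ i ∈ s, IsCompact (K i)) {ε : ℝ} (hε : 0 ≤ ε) :
    volume (Metric.cthickening ε (⋃ i ∈ s, K i)) ≤
      ∑ i ∈ s, volume (Metric.cthickening ε (K i)) := by
  rw [cthickening_biUnion_finset s hK hε]
  exact measure_biUnion_finset_le _ _

/-- The sets `K i`, `i ∈ s`, are compact and contained in convex sets that do not overlap. -/
structure NonOverlapping {ι : Type*} (s : Finset ι) (K J : ι → Set ℝ) : Prop where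
  isCompact : ∀ i ∈ s, IsCompact (K i)
  subset : ∀ i ∈ s, K i ⊆ J i
  convex : ∀ i ∈ s, Convex ℝ (J i)
  disjoint : ∀ i ∈ s, ∀ j ∈ s, i ≠ j → Disjoint (interior (J i)) (J j)

namespace NonOverlapping

variable {ι : Type*} {s : Finset ι} {K J : ι → Set ℝ}

theorem Ioo_subset_interior (h : NonOverlapping s K J) {i : ι} (hi : i ∈ s) {x y : ℝ}
    (hx : x ∈ K i) (hy : y ∈ K i) : Ioo x y ⊆ interior (J i) :=
  interior_maximal (Ioo_subset_Icc_self.trans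
    ((h.convex i hi).ordConnected.out (h.subset i hi hx) (h.subset i hi hy))) isOpen_Ioo

/-- A gap of `K i` lies in the interior of `J i`, where no other `K j` can enter. -/
theorem gaps_subset (h : NonOverlapping s K J) {i : ι} (hi : i ∈ s) :
    gaps (K i) ⊆ gaps (⋃ j ∈ s, K j) := by
  intro p hp
  have hmem : K i ⊆ ⋃ j ∈ s, K j := subset_biUnion_of_mem (u := K) hi
  refine ⟨hmem hp.1, hmem hp.2.1, hp.2.2.1, fun x hx => ?_⟩
  simp only [mem_iUnion, exists_prop] at hx
  obtain ⟨j, hj, hx⟩ := hx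
  by_cases hij : i = j
  · subst hij; exact hp.2.2.2 x hx
  · by_contra! hlt
    exact Set.disjoint_left.1 (h.disjoint i hi j hj hij)
      (h.Ioo_subset_interior hi hp.1 hp.2.1 hlt) (h.subset j hj hx)

theorem disjoint_gaps (h : NonOverlapping s K J) {i j : ι} (hi : i ∈ s) (hj : j ∈ s)
    (hij : i ≠ j) : Disjoint (gaps (K i)) (gaps (K j)) := by
  rw [Set.disjoint_left]
  intro p hp hq
  obtain ⟨x, hx⟩ := exists_between hp.2.2.1
  exact Set.disjoint_left.1 (h.disjoint i hi j hj hij)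
    (h.Ioo_subset_interior hi hp.1 hp.2.1 hx)
    (interior_subset (h.Ioo_subset_interior hj hq.1 hq.2.1 hx))

/-- If the ends of a gap belong to no common set, neither set can reach beyond the gap without
overlapping the other. So only finitely many gaps of the union are new. -/
theorem mem_gaps_or_eq (h : NonOverlapping s K J) {p : ℝ × ℝ} (hp : p ∈ gaps (⋃ j ∈ s, K j)) :
    (∃ i ∈ s, p ∈ gaps (K i)) ∨ ∃ i ∈ s, ∃ j ∈ s, p = (sSup (K i), sInf (K j)) := by
  obtain ⟨p1, p2⟩ := p
  obtain ⟨h1, h2, hlt, hall⟩ := hp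
  simp only [mem_iUnion, exists_prop] at h1 h2 hlt hall
  obtain ⟨i, hi, h1⟩ := h1
  obtain ⟨j, hj, h2⟩ := h2
  have hall' : ∀ k ∈ s, ∀ x ∈ K k, x ≤ p1 ∨ p2 ≤ x := fun k hk x hx => hall x ⟨k, hk, hx⟩
  by_cases h2' : p2 ∈ K i
  · exact Or.inl ⟨i, hi, h1, h2', hlt, hall' i hi⟩
  by_cases h1' : p1 ∈ K j
  · exact Or.inl ⟨j, hj, h1', h2, hlt, hall' j hj⟩
  have hij : i ≠ j := fun hij => h2' (hij ▸ h2)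
  refine Or.inr ⟨i, hi, j, hj, Prod.ext ?_ ?_⟩
  · refine (IsGreatest.csSup_eq ⟨h1, fun x hx => ?_⟩).symm
    by_contra! hx1
    have hx2 : p2 < x := ((hall' i hi x hx).resolve_left hx1.not_ge).lt_of_ne
      (fun he => h2' (he ▸ hx))
    exact Set.disjoint_left.1 (h.disjoint i hi j hj hij)
      (h.Ioo_subset_interior hi h1 hx ⟨hlt, hx2⟩) (h.subset j hj h2)
  · refine (IsLeast.csInf_eq ⟨h2, fun x hx => ?_⟩).symm
    by_contra! hx1
    have hx2 : x < p1 := ((hall' j hj x hx).resolve_right hx1.not_ge).lt_of_ne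
      (fun he => h1' (he ▸ hx))
    exact Set.disjoint_left.1 (h.disjoint j hj i hi hij.symm)
      (h.Ioo_subset_interior hj hx h2 ⟨hx2, hlt⟩) (h.subset i hi h1)

theorem sum_ncard_bigGaps_le (h : NonOverlapping s K J) {ε : ℝ} (hε : 0 < ε) :
    ∑ i ∈ s, (bigGaps (K i) ε).ncard ≤ (bigGaps (⋃ j ∈ s, K j) ε).ncard := by
  classical
  have hsub : ∀ t ⊆ s, (⋃ i ∈ t, bigGaps (K i) ε).ncard = ∑ i ∈ t, (bigGaps (K i) ε).ncard := by
    intro t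
    induction t using Finset.induction_on with
    | empty => simp
    | insert i t hit ih =>
      intro ht
      have hi : i ∈ s := ht (Finset.mem_insert_self i t)
      have ht' : t ⊆ s := (Finset.subset_insert i t).trans ht
      have hfin : (⋃ j ∈ t, bigGaps (K j) ε).Finite :=
        t.finite_toSet.biUnion fun j hj => finite_bigGaps (h.isCompact j (ht' hj)) hε
      rw [Finset.sum_insert hit, Finset.set_biUnion_insert,
        ncard_union_eq ?_ (finite_bigGaps (h.isCompact i hi) hε) hfin, ih ht']
      rw [Set.disjoint_left]
      intro p hp hq
      simp only [mem_iUnion, exists_prop] at hq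
      obtain ⟨j, hj, hq⟩ := hq
      exact Set.disjoint_left.1 (h.disjoint_gaps hi (ht' hj) fun he => hit (he ▸ hj)) hp.1 hq.1
  rw [← hsub s subset_rfl]
  refine ncard_le_ncard ?_ (finite_bigGaps (s.isCompact_biUnion h.isCompact) hε)
  refine iUnion₂_subset fun i hi p hp => ⟨h.gaps_subset hi hp.1, hp.2⟩

end NonOverlapping

/-! ### Perron-Frobenius theory of primitive matrices -/

section PerronFrobenius

open Matrix

variable {E : Type*} [Fintype E]

theorem mulVec_pos_of_pos {C : Matrix E E ℝ} (hC : ∀ i j, 0 < C i j) {z : E → ℝ}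
    (hz : ∀ e, 0 ≤ z e) (hz0 : z ≠ 0) (e : E) : 0 < (C *ᵥ z) e := by
  obtain ⟨k, hk⟩ := Function.ne_iff.1 hz0
  exact Finset.sum_pos' (fun j _ => mul_nonneg (hC e j).le (hz j))
    ⟨k, Finset.mem_univ k, mul_pos (hC e k) ((hz k).lt_of_ne (Ne.symm hk))⟩

theorem vecMul_pos_of_pos {C : Matrix E E ℝ} (hC : ∀ i j, 0 < C i j) {z : E → ℝ}
    (hz : ∀ e, 0 ≤ z e) (hz0 : z ≠ 0) (e : E) : 0 < (z ᵥ* C) e := by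
  rw [← mulVec_transpose]
  exact mulVec_pos_of_pos (fun i j => hC j i) hz hz0 e

variable [DecidableEq E]

theorem pow_pos_of_pos_imp_pos {A : Matrix E E ℕ} {B : Matrix E E ℝ} (hB : ∀ i j, 0 ≤ B i j)
    (hAB : ∀ i j, 0 < A i j → 0 < B i j) (n : ℕ) :
    ∀ i j, 0 ≤ (B ^ n) i j ∧ (0 < (A ^ n) i j → 0 < (B ^ n) i j) := by
  induction n with
  | zero =>
    intro i j
    by_cases h : i = j <;> simp [h]
  | succ n ih =>
    intro i j
    rw [pow_succ, pow_succ, Matrix.mul_apply, Matrix.mul_apply]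
    have hnn : ∀ k ∈ Finset.univ, 0 ≤ (B ^ n) i k * B k j :=
      fun k _ => mul_nonneg (ih i k).1 (hB k j)
    refine ⟨Finset.sum_nonneg hnn, fun h => ?_⟩
    obtain ⟨k, hk, hpos⟩ := Finset.exists_ne_zero_of_sum_ne_zero h.ne'
    refine Finset.sum_pos' hnn ⟨k, hk, mul_pos ((ih i k).2 ?_) (hAB k j ?_)⟩
    · exact Nat.pos_of_ne_zero (left_ne_zero_of_mul hpos)
    · exact Nat.pos_of_ne_zero (right_ne_zero_of_mul hpos)

theorem pow_mulVec_eq_self {B : Matrix E E ℝ} {q : E → ℝ} (h : B *ᵥ q = q) (n : ℕ) :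
    (B ^ n) *ᵥ q = q := by
  induction n with
  | zero => simp
  | succ n ih => rw [pow_succ, ← mulVec_mulVec, h, ih]

theorem vecMul_pow_eq_self {B : Matrix E E ℝ} {q : E → ℝ} (h : q ᵥ* B = q) (n : ℕ) :
    q ᵥ* (B ^ n) = q := by
  rw [← mulVec_transpose, transpose_pow]
  exact pow_mulVec_eq_self (by rw [mulVec_transpose, h]) n

/-- A fixed vector of a primitive matrix is a multiple of a given positive fixed vector. -/
theorem eq_smul_of_mulVec_eq_self [Nonempty E] {B : Matrix E E ℝ} {n : ℕ}
    (hn : ∀ i j, 0 < (B ^ n) i j)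
    {q x : E → ℝ} (hq : ∀ e, 0 < q e) (hBq : B *ᵥ q = q) (hBx : B *ᵥ x = x) :
    ∃ t : ℝ, x = t • q := by
  -- With the largest quotient t, the vector t q - x is nonnegative, fixed, and zero at `e`. A
  -- positive power of `B` would make it strictly positive there unless it vanishes.
  obtain ⟨e, he⟩ := Finite.exists_max (fun e => x e / q e)
  refine ⟨x e / q e, ?_⟩
  by_contra hne
  have hz0 : (x e / q e) • q - x ≠ 0 := fun h => hne (sub_eq_zero.1 h).symm
  have hz : ∀ i, 0 ≤ ((x e / q e) • q - x) i := fun i => by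
    have := (div_le_iff₀ (hq i)).1 (he i)
    simpa using this
  have h := mulVec_pos_of_pos hn hz hz0 e
  rw [mulVec_sub, mulVec_smul, pow_mulVec_eq_self hBq, pow_mulVec_eq_self hBx] at h
  simp [(hq e).ne'] at h

/-- A primitive matrix with a positive fixed column vector has a positive fixed row vector. -/
theorem exists_pos_vecMul_eq_self [Nonempty E] {B : Matrix E E ℝ} (hB : ∀ i j, 0 ≤ B i j) {n : ℕ}
    (hn : ∀ i j, 0 < (B ^ n) i j) {q : E → ℝ} (hq : ∀ e, 0 < q e) (hBq : B *ᵥ q = q) :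
    ∃ H : E → ℝ, (∀ e, 0 < H e) ∧ H ᵥ* B = H := by
  -- Singularity gives some real fixed row vector y, of unknown signs. By the triangle inequality
  -- |y| ≤ |y| B, and pairing with q turns this into an equality.
  have hdet : (B - 1).det = 0 := by
    refine exists_mulVec_eq_zero_iff.1 ⟨q, fun h => ?_, ?_⟩
    · obtain ⟨e⟩ := ‹Nonempty E›
      exact (hq e).ne' (congrFun h e)
    · rw [sub_mulVec, hBq, one_mulVec, sub_self]
  obtain ⟨y, hy0, hy⟩ := exists_vecMul_eq_zero_iff.2 hdet
  have hyB : y ᵥ* B = y := by rwa [vecMul_sub, vecMul_one, sub_eq_zero] at hy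
  have hle : ∀ e, |y e| ≤ ((fun e => |y e|) ᵥ* B) e := fun e => by
    conv_lhs => rw [← hyB]
    refine (Finset.abs_sum_le_sum_abs _ _).trans (Finset.sum_le_sum fun i _ => ?_)
    rw [abs_mul, abs_of_nonneg (hB i e)]
  have hsum : ∑ e, (((fun e => |y e|) ᵥ* B) e - |y e|) * q e = 0 := by
    have : ((fun e => |y e|) ᵥ* B) ⬝ᵥ q = (fun e => |y e|) ⬝ᵥ q := by
      rw [← dotProduct_mulVec, hBq]
    simp only [sub_mul, Finset.sum_sub_distrib]
    exact sub_eq_zero.2 this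
  have heq : (fun e => |y e|) ᵥ* B = fun e => |y e| := by
    funext e
    have := (Finset.sum_eq_zero_iff_of_nonneg
      (fun e _ => mul_nonneg (sub_nonneg.2 (hle e)) (hq e).le)).1 hsum e (Finset.mem_univ e)
    exact sub_eq_zero.1 ((mul_eq_zero.1 this).resolve_right (hq e).ne')
  refine ⟨fun e => |y e|, fun e => ?_, heq⟩
  have h := vecMul_pos_of_pos hn (z := fun e => |y e|) (fun e => abs_nonneg _)
    (fun h => hy0 (funext fun e => abs_eq_zero.1 (congrFun h e))) e
  rwa [vecMul_pow_eq_self heq] at h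

theorem tendsto_zero_of_antitone_of_le {a : ℕ → ℝ} (ha : Antitone a) (h0 : ∀ m, 0 ≤ a m) {n : ℕ}
    {θ : ℝ} (hθ : θ < 1) (h : ∀ m, a (m + n) ≤ θ * a m) : Tendsto a atTop (𝓝 0) := by
  have ht := tendsto_atTop_ciInf ha ⟨0, by rintro _ ⟨m, rfl⟩; exact h0 m⟩
  have hl : (⨅ m, a m) ≤ θ * ⨅ m, a m :=
    le_of_tendsto_of_tendsto' ((tendsto_add_atTop_iff_nat n).2 ht) (ht.const_mul θ) h
  have hl0 : 0 ≤ ⨅ m, a m := le_ciInf h0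
  have : (⨅ m, a m) = 0 := by nlinarith
  rwa [this] at ht

/-- The row vectors `y * B ^ m` converge to a multiple of the positive fixed row vector. -/
theorem tendsto_vecMul_pow [Nonempty E] {B : Matrix E E ℝ} (hB : ∀ i j, 0 ≤ B i j) {n : ℕ}
    (hn : ∀ i j, 0 < (B ^ n) i j) {q H : E → ℝ} (hq : ∀ e, 0 < q e) (hBq : B *ᵥ q = q)
    (hH : ∀ e, 0 < H e) (hHB : H ᵥ* B = H) (y : E → ℝ) (e : E) :
    Tendsto (fun m : ℕ => (y ᵥ* B ^ m) e) atTop (𝓝 ((y ⬝ᵥ q) / (H ⬝ᵥ q) * H e)) := by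
  have hHq : 0 < H ⬝ᵥ q :=
    Finset.sum_pos (fun e _ => mul_pos (hH e) (hq e)) Finset.univ_nonempty
  -- In the weighted norm Σ |z_e| q_e, a nonnegative matrix with C q = θ q acts on row vectors with
  -- norm at most θ.
  have hstep : ∀ (C : Matrix E E ℝ) (_ : ∀ i j, 0 ≤ C i j) (θ : ℝ) (_ : C *ᵥ q = θ • q)
      (z : E → ℝ), ∑ e, |(z ᵥ* C) e| * q e ≤ θ * ∑ e, |z e| * q e := by
    intro C hC θ hCq z
    calc ∑ e, |(z ᵥ* C) e| * q e ≤ ∑ e, ((fun e => |z e|) ᵥ* C) e * q e := by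
          refine Finset.sum_le_sum fun e _ => mul_le_mul_of_nonneg_right ?_ (hq e).le
          refine (Finset.abs_sum_le_sum_abs _ _).trans (Finset.sum_le_sum fun i _ => ?_)
          rw [abs_mul, abs_of_nonneg (hC i e)]
      _ = (fun e => |z e|) ⬝ᵥ (C *ᵥ q) := by rw [dotProduct_mulVec]; rfl
      _ = θ * ∑ e, |z e| * q e := by rw [hCq, dotProduct_smul]; rfl
  set z : E → ℝ := y - ((y ⬝ᵥ q) / (H ⬝ᵥ q)) • H with hz
  have hzq : z ⬝ᵥ q = 0 := by
    rw [hz, sub_dotProduct, smul_dotProduct, smul_eq_mul, div_mul_cancel₀ _ hHq.ne', sub_self]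
  have hzm : ∀ m : ℕ, (z ᵥ* B ^ m) ⬝ᵥ q = 0 := fun m => by
    rw [← dotProduct_mulVec, pow_mulVec_eq_self hBq, hzq]
  -- Doeblin minorisation: `B ^ n` dominates c q ⊗ H. On row vectors orthogonal to q, subtracting
  -- this rank-one matrix changes nothing, but it lowers the factor on q from 1 to 1 - c H·q.
  obtain ⟨c, hc, hcle⟩ : ∃ c : ℝ, 0 < c ∧ ∀ i j, c * (q i * H j) ≤ (B ^ n) i j := by
    obtain ⟨p, hp⟩ := Finite.exists_min (fun p : E × E => (B ^ n) p.1 p.2 / (q p.1 * H p.2))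
    refine ⟨_, div_pos (hn p.1 p.2) (mul_pos (hq p.1) (hH p.2)), fun i j => ?_⟩
    exact (le_div_iff₀ (mul_pos (hq i) (hH j))).1 (hp (i, j))
  have ha := tendsto_zero_of_antitone_of_le (a := fun m => ∑ e, |(z ᵥ* B ^ m) e| * q e) (n := n)
    (θ := 1 - c * (H ⬝ᵥ q)) (antitone_nat_of_succ_le fun m => ?_)
    (fun m => Finset.sum_nonneg fun e _ => mul_nonneg (abs_nonneg _) (hq e).le)
    (by nlinarith) (fun m => ?_)
  · have hzt : Tendsto (fun m : ℕ => (z ᵥ* B ^ m) e) atTop (𝓝 0) := by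
      rw [tendsto_zero_iff_abs_tendsto_zero]
      have h1 : Tendsto (fun m => (∑ e, |(z ᵥ* B ^ m) e| * q e) / q e) atTop (𝓝 0) := by
        simpa using ha.div_const (q e)
      refine squeeze_zero (fun m => abs_nonneg _) (fun m => ?_) h1
      rw [Function.comp_apply, le_div_iff₀ (hq e)]
      exact Finset.single_le_sum (f := fun e => |(z ᵥ* B ^ m) e| * q e)
        (fun e _ => mul_nonneg (abs_nonneg _) (hq e).le) (Finset.mem_univ e)
    have heq : ∀ m : ℕ, (y ᵥ* B ^ m) e = (z ᵥ* B ^ m) e + (y ⬝ᵥ q) / (H ⬝ᵥ q) * H e := by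
      intro m
      rw [hz, sub_vecMul, smul_vecMul, vecMul_pow_eq_self hHB]
      simp
    simp only [heq]
    simpa using hzt.add_const ((y ⬝ᵥ q) / (H ⬝ᵥ q) * H e)
  · have := hstep B hB 1 (by rw [hBq, one_smul]) (z ᵥ* B ^ m)
    rwa [vecMul_vecMul, ← pow_succ, one_mul] at this
  · have hC : (z ᵥ* B ^ (m + n)) = (z ᵥ* B ^ m) ᵥ* (B ^ n - c • vecMulVec q H) := by
      rw [vecMul_sub, vecMul_vecMul, ← pow_add, vecMul_smul, vecMul_vecMulVec, hzm]
      simp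
    simp only [hC]
    refine hstep _ (fun i j => ?_) _ ?_ _
    · simpa [vecMulVec_apply] using hcle i j
    · rw [sub_mulVec, pow_mulVec_eq_self hBq, smul_mulVec, vecMulVec_mulVec, sub_smul, one_smul]
      simp [smul_smul]

/-- Existence of the exponent for which the weighted matrix has spectral radius one. -/
theorem exists_exponent_mulVec_eq_self [Nonempty E] {A : Matrix E E ℕ} {n : ℕ} (hn1 : 1 ≤ n)
    (hn : ∀ i j, 0 < (A ^ n) i j) {w : E → ℝ} (hw : ∀ e, 0 < w e) (B : ℝ → Matrix E E ℝ)
    (hBdef : ∀ s e e', B s e e' = w e ^ s * A e e')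
    (h1 : ∀ x : E → ℝ, (∀ e, 0 ≤ x e) → (∀ e, x e ≤ (B 1 *ᵥ x) e) → x = 0) :
    ∃ δ : ℝ, 0 ≤ δ ∧ δ < 1 ∧ ∃ q : E → ℝ, (∀ e, 0 < q e) ∧ B δ *ᵥ q = q := by
  have hB0 : ∀ s i j, 0 ≤ B s i j := fun s i j => by
    rw [hBdef]; exact mul_nonneg (Real.rpow_nonneg (hw i).le _) (Nat.cast_nonneg _)
  have hBn : ∀ s i j, 0 < (B s ^ n) i j := fun s i j =>
    (pow_pos_of_pos_imp_pos (hB0 s) (fun i j h => by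
      rw [hBdef]; exact mul_pos (Real.rpow_pos_of_pos (hw i) _) (Nat.cast_pos.2 h)) n i j).2
      (hn i j)
  have hcont : ∀ e, Continuous fun p : ℝ × (E → ℝ) => (B p.1 *ᵥ p.2) e := fun e => by
    simp only [mulVec, dotProduct, hBdef]
    refine continuous_finsetSum _ fun i _ => ?_
    have : Continuous fun p : ℝ × (E → ℝ) => w e ^ p.1 :=
      Continuous.rpow continuous_const continuous_fst (fun _ => Or.inl (hw e).ne')
    fun_prop
  -- The simplex makes this set of exponents and subinvariant vectors compact, so a largest exponent
  -- is attained.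
  set T : Set (ℝ × (E → ℝ)) :=
    (Icc 0 1 ×ˢ stdSimplex ℝ E) ∩ {p | ∀ e, p.2 e ≤ (B p.1 *ᵥ p.2) e} with hT
  have hTc : IsCompact T := by
    refine (isCompact_Icc.prod (isCompact_stdSimplex ℝ E)).inter_right ?_
    simp only [ofPred_forall]
    exact isClosed_iInter fun e => isClosed_le (by fun_prop) (hcont e)
  have hcard : (0 : ℝ) < Fintype.card E := Nat.cast_pos.2 Fintype.card_pos
  have hTne : T.Nonempty := by
    -- At exponent 0 a constant vector is subinvariant, because every row of `A` contains a positive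
    -- integer.
    refine ⟨(0, fun _ => 1 / Fintype.card E), ⟨⟨by simp, ⟨fun e => by positivity, ?_⟩⟩, ?_⟩⟩
    · simp [hcard.ne']
    · intro e
      obtain ⟨k, hk⟩ : ∃ k, 0 < A e k := by
        obtain ⟨m, rfl⟩ := Nat.exists_eq_add_of_le' hn1
        have := hn e e
        rw [pow_succ', Matrix.mul_apply] at this
        obtain ⟨k, -, hk⟩ := Finset.exists_ne_zero_of_sum_ne_zero this.ne'
        exact ⟨k, Nat.pos_of_ne_zero (left_ne_zero_of_mul hk)⟩
      have hk1 : (1 : ℝ) ≤ A e k := by exact_mod_cast hk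
      have := Finset.single_le_sum (f := fun i => B 0 e i * (1 / Fintype.card E : ℝ))
        (fun i _ => mul_nonneg (hB0 0 e i) (by positivity)) (Finset.mem_univ k)
      refine le_trans ?_ this
      rw [hBdef, Real.rpow_zero, one_mul]
      exact le_mul_of_one_le_left (by positivity) hk1
  obtain ⟨⟨δ, x⟩, hmem, hmax⟩ := hTc.exists_isMaxOn hTne continuous_fst.continuousOn
  obtain ⟨⟨hδ, hx0, hx1⟩, hxB⟩ := hmem
  simp only [mem_ofPred_eq] at hδ hx0 hx1 hxB
  have hxne : x ≠ 0 := fun h => by simp [h] at hx1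
  have hδ1 : δ < 1 := hδ.2.lt_of_ne fun h => hxne (h1 x hx0 (h ▸ hxB))
  have hfix : B δ *ᵥ x = x := by
    by_contra hne
    have hz0 : B δ *ᵥ x - x ≠ 0 := fun h => hne (sub_eq_zero.1 h)
    have hz : ∀ e, 0 ≤ (B δ *ᵥ x - x) e := fun e => sub_nonneg.2 (hxB e)
    -- Applying the positive power makes the inequality strict in every coordinate. By continuity it
    -- survives for slightly larger exponents, against the maximality of δ.
    set y := (B δ ^ n) *ᵥ x with hy
    have hy0 : ∀ e, 0 < y e := mulVec_pos_of_pos (hBn δ) hx0 hxne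
    have hyB : ∀ e, y e < (B δ *ᵥ y) e := fun e => by
      have := mulVec_pos_of_pos (hBn δ) hz hz0 e
      rw [mulVec_sub, mulVec_mulVec, ← pow_succ, pow_succ', ← mulVec_mulVec] at this
      simpa [hy] using this
    have hev : ∀ᶠ s in 𝓝[>] δ, ∀ e, y e < (B s *ᵥ y) e := by
      refine eventually_all.2 fun e => nhdsWithin_le_nhds ?_
      have hc : Continuous fun s : ℝ => (B s *ᵥ y) e :=
        (hcont e).comp (Continuous.prodMk_left y)
      exact (hc.tendsto δ).eventually (lt_mem_nhds (hyB e))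
    obtain ⟨s, hs, hsδ, hs1⟩ := (hev.and (Ioo_mem_nhdsGT hδ1)).exists
    have hS : 0 < ∑ e, y e := Finset.sum_pos (fun e _ => hy0 e) Finset.univ_nonempty
    have hin : (s, (∑ e, y e)⁻¹ • y) ∈ T := by
      refine ⟨⟨⟨by linarith [hδ.1], hs1.le⟩, fun e => ?_, ?_⟩, fun e => ?_⟩
      · exact mul_nonneg (inv_nonneg.2 hS.le) (hy0 e).le
      · simp only [Pi.smul_apply, smul_eq_mul, ← Finset.mul_sum]
        exact inv_mul_cancel₀ hS.ne'
      · simp only [mulVec_smul, Pi.smul_apply, smul_eq_mul]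
        exact mul_le_mul_of_nonneg_left (hs e).le (inv_nonneg.2 hS.le)
    have := hmax hin
    simp only [mem_ofPred_eq] at this
    linarith
  refine ⟨δ, hδ.1, hδ1, x, fun e => ?_, hfix⟩
  have := mulVec_pos_of_pos (hBn δ) hx0 hxne e
  rwa [pow_mulVec_eq_self hfix] at this

end PerronFrobenius

/-! ### Words and the code map -/

namespace ConformalGDS

variable {V E : Type*} [Fintype V] [Fintype E] (Φ : ConformalGDS V E)

/-- The edge `e'` may follow the edge `e`. -/
def Adj (e e' : E) : Prop := Φ.term e = Φ.init e'

theorem incidence_eq_one_iff {e e' : E} : Φ.incidence e e' = 1 ↔ Φ.Adj e e' := by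
  simp [incidence, Adj]

theorem incidence_pos_iff {e e' : E} : 0 < Φ.incidence e e' ↔ Φ.Adj e e' := by
  rw [← incidence_eq_one_iff]
  unfold incidence
  split_ifs <;> simp

theorem Words.adj {Φ : ConformalGDS V E} (ω : Φ.Words) (n : ℕ) :
    Φ.Adj (ω.1 n) (ω.1 (n + 1)) := Φ.incidence_eq_one_iff.1 (ω.2 n)

/-- The infinite word that begins with `e` and continues with `ω`. -/
def cons (e : E) (ω : Φ.Words) (h : Φ.Adj e (ω.1 0)) : Φ.Words :=
  ⟨fun n => Nat.casesOn n e ω.1, fun n => by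
    cases n with
    | zero => exact Φ.incidence_eq_one_iff.2 h
    | succ n => exact ω.2 n⟩

@[simp] theorem cons_zero {e : E} {ω : Φ.Words} (h : Φ.Adj e (ω.1 0)) :
    (Φ.cons e ω h).1 0 = e := rfl

@[simp] theorem cons_succ {e : E} {ω : Φ.Words} (h : Φ.Adj e (ω.1 0)) (n : ℕ) :
    (Φ.cons e ω h).1 (n + 1) = ω.1 n := rfl

@[simp] theorem shift_cons {e : E} {ω : Φ.Words} (h : Φ.Adj e (ω.1 0)) :
    Φ.shift (Φ.cons e ω h) = ω := rfl

theorem words_ext {ω ω' : Φ.Words} (h0 : ω.1 0 = ω'.1 0) (h : Φ.shift ω = Φ.shift ω') :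
    ω = ω' := by
  refine Subtype.ext (funext fun n => ?_)
  cases n with
  | zero => exact h0
  | succ n => exact congrFun (congrArg Subtype.val h) n

theorem shift_iterate_apply (k : ℕ) (ω : Φ.Words) (n : ℕ) :
    (Φ.shift^[k] ω).1 n = ω.1 (n + k) := by
  induction k generalizing ω with
  | zero => rfl
  | succ k ih => rw [Function.iterate_succ_apply, ih]; rfl

open Classical in
theorem exists_word_of_pow_incidence_pos {k : ℕ} {e : E} {ω : Φ.Words}
    (h : 0 < (Φ.incidence ^ k) e (ω.1 0)) :
    ∃ ω' : Φ.Words, ω'.1 0 = e ∧ Φ.shift^[k] ω' = ω := by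
  induction k generalizing e with
  | zero =>
    refine ⟨ω, ?_, rfl⟩
    by_contra hne
    simp [Ne.symm hne] at h
  | succ k ih =>
    rw [pow_succ', Matrix.mul_apply] at h
    obtain ⟨g, -, hg⟩ := Finset.exists_ne_zero_of_sum_ne_zero h.ne'
    obtain ⟨ω', h0, h1⟩ := ih (Nat.pos_of_ne_zero (right_ne_zero_of_mul hg))
    have ha : Φ.Adj e (ω'.1 0) := by
      rw [h0]
      exact Φ.incidence_pos_iff.1 (Nat.pos_of_ne_zero (left_ne_zero_of_mul hg))
    exact ⟨Φ.cons e ω' ha, rfl, by rw [Function.iterate_succ_apply, shift_cons, h1]⟩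

variable {Φ}

theorem AperiodicIrreducible.exists_adj (hA : Φ.AperiodicIrreducible) (e : E) :
    ∃ e', Φ.Adj e e' := by
  classical
  obtain ⟨n, hn1, hn⟩ := hA
  obtain ⟨m, rfl⟩ := Nat.exists_eq_add_of_le' hn1
  have := hn e e
  rw [pow_succ', Matrix.mul_apply] at this
  obtain ⟨k, -, hk⟩ := Finset.exists_ne_zero_of_sum_ne_zero this.ne'
  exact ⟨k, Φ.incidence_pos_iff.1 (Nat.pos_of_ne_zero (left_ne_zero_of_mul hk))⟩

theorem AperiodicIrreducible.exists_word (hA : Φ.AperiodicIrreducible) (e : E) :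
    ∃ ω : Φ.Words, ω.1 0 = e := by
  choose next hnext using hA.exists_adj
  refine ⟨⟨fun n => next^[n] e, fun n => Φ.incidence_eq_one_iff.2 ?_⟩, rfl⟩
  simp only [Function.iterate_succ_apply']
  exact hnext _

/-- Preimages of a given word under iterates of the shift are dense. -/
theorem AperiodicIrreducible.exists_shift_iterate_eq (hA : Φ.AperiodicIrreducible)
    (ω₀ : Φ.Words) (N : ℕ) (ω : Φ.Words) :
    ∃ (u : Φ.Words) (k : ℕ), (∀ i ≤ N, u.1 i = ω.1 i) ∧ Φ.shift^[k] u = ω₀ := by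
  induction N generalizing ω with
  | zero =>
    obtain ⟨n, -, hn⟩ := hA
    obtain ⟨u, h0, h1⟩ := Φ.exists_word_of_pow_incidence_pos (hn (ω.1 0) (ω₀.1 0))
    exact ⟨u, n, fun i hi => by rw [Nat.le_zero.1 hi, h0], h1⟩
  | succ N ih =>
    obtain ⟨u, k, hu, hk⟩ := ih (Φ.shift ω)
    have ha : Φ.Adj (ω.1 0) (u.1 0) := by rw [hu 0 (Nat.zero_le _)]; exact ω.adj 0
    refine ⟨Φ.cons _ u ha, k + 1, fun i hi => ?_, by
      rw [Function.iterate_succ_apply, shift_cons, hk]⟩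
    cases i with
    | zero => rfl
    | succ i => exact hu i (by omega)

variable (Φ)

theorem mem_cylinder_cons {e : E} {u : List E} {ω : Φ.Words} :
    ω ∈ Φ.cylinder (e :: u) ↔ ω.1 0 = e ∧ Φ.shift ω ∈ Φ.cylinder u := by
  constructor
  · intro h
    refine ⟨h ⟨0, by simp⟩, fun k => ?_⟩
    exact h k.succ
  · rintro ⟨h0, h1⟩ ⟨k, hk⟩
    cases k with
    | zero => exact h0
    | succ k => exact h1 ⟨k, by simpa using hk⟩

@[simp] theorem cylinder_nil : Φ.cylinder [] = univ := by
  ext ω; simp [cylinder]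

theorem mem_cylinder_singleton {e : E} {ω : Φ.Words} : ω ∈ Φ.cylinder [e] ↔ ω.1 0 = e := by
  simp [mem_cylinder_cons]

theorem initialWord_succ (ω : Φ.Words) (n : ℕ) :
    Φ.initialWord ω (n + 1) = ω.1 0 :: Φ.initialWord (Φ.shift ω) n := by
  simp [initialWord, List.range_succ_eq_map, shift, Function.comp_def]

theorem mem_cylinder_initialWord (ω : Φ.Words) (n : ℕ) : ω ∈ Φ.cylinder (Φ.initialWord ω n) := by
  induction n generalizing ω with
  | zero => simp [initialWord]
  | succ n ih => rw [initialWord_succ, mem_cylinder_cons]; exact ⟨rfl, ih _⟩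

theorem isAdmissible_initialWord (ω : Φ.Words) (n : ℕ) : Φ.IsAdmissible (Φ.initialWord ω n) := by
  induction n generalizing ω with
  | zero => simp [initialWord, IsAdmissible]
  | succ n ih =>
    rw [initialWord_succ]
    cases n with
    | zero => simp [initialWord, IsAdmissible]
    | succ n =>
      have := ih (Φ.shift ω)
      rw [initialWord_succ] at this ⊢
      exact List.isChain_cons_cons.2 ⟨ω.2 0, this⟩

/-! ### Topology of the space of words -/

theorem isOpen_coord (k : ℕ) (P : E → Prop) : IsOpen {ω : Φ.Words | P (ω.1 k)} := by
  let : TopologicalSpace E := ⊥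
  have : DiscreteTopology E := ⟨rfl⟩
  have hc : Continuous fun ω : Φ.Words => ω.1 := continuous_induced_dom
  have hc' : Continuous fun ω : Φ.Words => ω.1 k := (continuous_apply k).comp hc
  exact (isOpen_discrete {e | P e}).preimage hc'

theorem isClopen_coord (k : ℕ) (P : E → Prop) : IsClopen {ω : Φ.Words | P (ω.1 k)} :=
  ⟨⟨Φ.isOpen_coord k fun e => ¬ P e⟩, Φ.isOpen_coord k P⟩

theorem continuous_of_coord {Y : Type*} [TopologicalSpace Y] (k : ℕ) (f : E → Y) :
    Continuous fun ω : Φ.Words => f (ω.1 k) :=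
  continuous_def.2 fun s _ => Φ.isOpen_coord k fun e => f e ∈ s

theorem continuous_words_iff {Y : Type*} [TopologicalSpace Y] {f : Y → Φ.Words} :
    Continuous f ↔ ∀ k e, IsOpen {y | (f y).1 k = e} := by
  let : TopologicalSpace E := ⊥
  have : DiscreteTopology E := ⟨rfl⟩
  rw [continuous_induced_rng, continuous_pi_iff]
  exact forall_congr' fun k => continuous_discrete_rng

theorem isClosedEmbedding_val : letI : TopologicalSpace E := ⊥
    IsClosedEmbedding (fun ω : Φ.Words => ω.1) := by
  let : TopologicalSpace E := ⊥
  have : DiscreteTopology E := ⟨rfl⟩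
  refine ⟨⟨⟨rfl⟩, Subtype.val_injective⟩, ?_⟩
  have : range (fun ω : Φ.Words => ω.1) =
      ⋂ n, {p : ℕ → E | Φ.incidence (p n) (p (n + 1)) = 1} := by
    ext p
    simp only [mem_range, mem_iInter]
    exact ⟨fun ⟨ω, h⟩ n => h ▸ ω.2 n, fun h => ⟨⟨p, h⟩, rfl⟩⟩
  rw [this]
  refine isClosed_iInter fun n => ?_
  have hc : Continuous fun p : ℕ → E => (p n, p (n + 1)) := by fun_prop
  exact (isClosed_discrete {q : E × E | Φ.incidence q.1 q.2 = 1}).preimage hc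

instance : CompactSpace Φ.Words := by
  let : TopologicalSpace E := ⊥
  exact (isClosedEmbedding_val Φ).compactSpace

instance : T2Space Φ.Words := by
  let : TopologicalSpace E := ⊥
  have : DiscreteTopology E := ⟨rfl⟩
  exact (isClosedEmbedding_val Φ).isEmbedding.t2Space

theorem mem_nhds_initialWord (ω : Φ.Words) (n : ℕ) :
    {ω' : Φ.Words | ∀ k < n, ω'.1 k = ω.1 k} ∈ 𝓝 ω := by
  have : {ω' : Φ.Words | ∀ k < n, ω'.1 k = ω.1 k} =
      ⋂ k ∈ Finset.range n, {ω' | ω'.1 k = ω.1 k} := by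
    ext; simp
  rw [this]
  exact (isOpen_biInter_finset fun k _ => Φ.isOpen_coord k fun e => e = ω.1 k).mem_nhds (by simp)

theorem exists_agree_subset_of_mem_nhds {ω : Φ.Words} {U : Set Φ.Words} (hU : U ∈ 𝓝 ω) :
    ∃ N : ℕ, ∀ ω' : Φ.Words, (∀ i ≤ N, ω'.1 i = ω.1 i) → ω' ∈ U := by
  let : TopologicalSpace E := ⊥
  have : DiscreteTopology E := ⟨rfl⟩
  rw [(isClosedEmbedding_val Φ).isInducing.nhds_eq_comap, mem_comap] at hU
  obtain ⟨W, hW, hWU⟩ := hU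
  rw [nhds_pi, Filter.mem_pi] at hW
  obtain ⟨I, hI, t, ht, htW⟩ := hW
  obtain ⟨N, hN⟩ := hI.bddAbove
  refine ⟨N, fun ω' h => hWU (htW fun i hi => ?_)⟩
  have hi' : ω'.1 i ∈ t i := by
    rw [h i (hN hi)]
    exact mem_of_mem_nhds (ht i)
  exact hi'

theorem isClosed_cylinder (u : List E) : IsClosed (Φ.cylinder u) := by
  have : Φ.cylinder u = ⋂ k : Fin u.length, {ω | ω.1 k = u.get k} := by
    ext; simp [cylinder]
  rw [this]
  exact isClosed_iInter fun k => (Φ.isClopen_coord k fun e => e = u.get k).1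

/-! ### The code map -/

theorem code_mem_piece (ω : Φ.Words) (n : ℕ) : Φ.code ω ∈ Φ.piece ω n :=
  mem_iInter.1 (Φ.existsUnique_code ω).choose_spec.1 n

theorem code_eq_of_forall_mem {ω : Φ.Words} {x : ℝ} (h : ∀ n, x ∈ Φ.piece ω n) :
    Φ.code ω = x :=
  ((Φ.existsUnique_code ω).choose_spec.2 x (mem_iInter.2 h)).symm

theorem code_mem_X (ω : Φ.Words) : Φ.code ω ∈ Φ.X (Φ.init (ω.1 0)) := by
  have := Φ.code_mem_piece ω 0
  exact (Φ.mapsTo _).image_subset (by simpa [piece, initialWord, wordMap] using this)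

theorem piece_succ (ω : Φ.Words) (n : ℕ) :
    Φ.piece ω (n + 1) = Φ.φ (ω.1 0) '' Φ.piece (Φ.shift ω) n := by
  unfold piece
  rw [initialWord_succ, wordMap, image_comp]
  rfl

theorem code_eq (ω : Φ.Words) : Φ.code ω = Φ.φ (ω.1 0) (Φ.code (Φ.shift ω)) := by
  have h : ∀ n, Φ.φ (ω.1 0) (Φ.code (Φ.shift ω)) ∈ Φ.piece ω (n + 1) := fun n => by
    rw [piece_succ]
    exact mem_image_of_mem _ (Φ.code_mem_piece _ n)
  refine Φ.code_eq_of_forall_mem fun n => ?_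
  cases n with
  | zero => exact Φ.piece_succ_subset ω 0 (h 0)
  | succ n => exact h n

theorem code_shift_mem_X (ω : Φ.Words) : Φ.code (Φ.shift ω) ∈ Φ.X (Φ.term (ω.1 0)) := by
  rw [Φ.term_eq_init ω 0]
  exact Φ.code_mem_X (Φ.shift ω)

theorem exists_diam_X_le : ∃ D : ℝ, 0 < D ∧ ∀ v, ∀ x ∈ Φ.X v, ∀ y ∈ Φ.X v, |x - y| ≤ D := by
  refine ⟨1 + ∑ v, Metric.diam (Φ.X v), by positivity, fun v x hx y hy => ?_⟩
  have h1 := Metric.dist_le_diam_of_mem (Φ.isCompact_X v).isBounded hx hy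
  have h2 := Finset.single_le_sum (f := fun v => Metric.diam (Φ.X v))
    (fun _ _ => Metric.diam_nonneg) (Finset.mem_univ v)
  rw [Real.dist_eq] at h1
  linarith

theorem continuous_code : Continuous Φ.code := by
  obtain ⟨D, hD, hX⟩ := Φ.exists_diam_X_le
  obtain ⟨r, -, hr1, hr⟩ := Φ.contracting
  have key : ∀ (n : ℕ) (ω ω' : Φ.Words), (∀ k < n + 1, ω'.1 k = ω.1 k) →
      |Φ.code ω' - Φ.code ω| ≤ (r : ℝ) ^ n * D := by
    intro n
    induction n with
    | zero =>
      intro ω ω' h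
      have h' := Φ.code_mem_X ω'
      rw [h 0 (by omega)] at h'
      simpa using hX _ _ h' _ (Φ.code_mem_X ω)
    | succ n ih =>
      intro ω ω' h
      have h0 := h 0 (by omega)
      have hs := Φ.code_shift_mem_X ω'
      rw [h0] at hs
      have h1 := (hr (ω.1 0)).dist_le_mul _ hs _ (Φ.code_shift_mem_X ω)
      have h2 := ih (Φ.shift ω) (Φ.shift ω') (fun k hk => h (k + 1) (by omega))
      rw [Φ.code_eq ω', Φ.code_eq ω, h0]
      rw [Real.dist_eq, Real.dist_eq] at h1
      refine h1.trans ?_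
      rw [pow_succ', mul_assoc]
      exact mul_le_mul_of_nonneg_left h2 r.2
  have hlim : Tendsto (fun n : ℕ => (r : ℝ) ^ n * D) atTop (𝓝 0) := by
    simpa using (tendsto_pow_atTop_nhds_zero_of_lt_one r.2 (by exact_mod_cast hr1)).mul_const D
  rw [continuous_iff_continuousAt]
  intro ω
  rw [ContinuousAt, Metric.tendsto_nhds]
  intro ε hε
  obtain ⟨n, hn⟩ := (hlim.eventually (gt_mem_nhds hε)).exists
  filter_upwards [Φ.mem_nhds_initialWord ω (n + 1)] with ω' hω'
  rw [Real.dist_eq]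
  exact (key n ω ω' hω').trans_lt hn

theorem isCompact_code_image_cylinder (u : List E) : IsCompact (Φ.code '' Φ.cylinder u) :=
  (Φ.isClosed_cylinder u).isCompact.image Φ.continuous_code

theorem isCompact_limitSet : IsCompact Φ.limitSet := by
  rw [limitSet, ← image_univ, ← cylinder_nil]
  exact Φ.isCompact_code_image_cylinder []

theorem convex_X (v : V) : Convex ℝ (Φ.X v) :=
  (Φ.isConnected_X v).isPreconnected.ordConnected.convex

theorem interior_X_nonempty (v : V) : (interior (Φ.X v)).Nonempty := by
  rw [← closure_nonempty_iff, Φ.closure_interior_X]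
  exact Φ.nonempty_X v

theorem exists_lt_X (v : V) : ∃ a ∈ Φ.X v, ∃ b ∈ Φ.X v, a < b := by
  obtain ⟨x, hx⟩ := Φ.interior_X_nonempty v
  obtain ⟨ε, hε, hsub⟩ := Metric.isOpen_iff.1 isOpen_interior x hx
  refine ⟨x, interior_subset hx, x + ε / 2, interior_subset (hsub ?_), by linarith⟩
  rw [Metric.mem_ball, Real.dist_eq, add_sub_cancel_left, abs_of_pos (by linarith)]
  linarith

end ConformalGDS

namespace ConformalGDS

variable {V E : Type*} [Fintype V] [Fintype E] (Φ : ConformalGDS V E)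

/-! ### Affine extensions of the similarities -/

/-- Affine maps of the line that extend the maps of the system. -/
structure AffineModel where
  slope : E → ℝ
  offset : E → ℝ
  slope_ne_zero : ∀ e, slope e ≠ 0
  abs_slope_lt_one : ∀ e, |slope e| < 1
  eq_affine : ∀ e, ∀ x ∈ Φ.X (Φ.term e), Φ.φ e x = slope e * x + offset e

variable {Φ}

theorem IsSGDS.nonempty_affineModel (hΦ : Φ.IsSGDS) : Nonempty Φ.AffineModel := by
  have key : ∀ e, ∃ s b : ℝ, s ≠ 0 ∧ |s| < 1 ∧ ∀ x ∈ Φ.X (Φ.term e), Φ.φ e x = s * x + b := by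
    intro e
    obtain ⟨ρ, hρ, hdist⟩ := hΦ e
    obtain ⟨r, -, hr1, hr⟩ := Φ.contracting
    obtain ⟨a, ha, b, hb, hab⟩ := Φ.exists_lt_X (Φ.term e)
    have hba : 0 < b - a := sub_pos.2 hab
    have hρ1 : ρ < 1 := by
      have h1 := (hr e).dist_le_mul _ hb _ ha
      rw [Real.dist_eq, Real.dist_eq, hdist b hb a ha, abs_of_pos hba] at h1
      have : (r : ℝ) < 1 := by exact_mod_cast hr1
      exact (le_of_mul_le_mul_right h1 hba).trans_lt this
    have hab' := hdist b hb a ha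
    rw [abs_of_pos hba] at hab'
    obtain ⟨s, hs, hs'⟩ : ∃ s : ℝ, |s| = ρ ∧ Φ.φ e b - Φ.φ e a = s * (b - a) := by
      rcases abs_choice (Φ.φ e b - Φ.φ e a) with h | h
      · exact ⟨ρ, abs_of_pos hρ, by rw [← hab', h]⟩
      · exact ⟨-ρ, by rw [abs_neg, abs_of_pos hρ], by rw [neg_mul, ← hab', h, neg_neg]⟩
    have hs0 : s ≠ 0 := by rintro rfl; rw [abs_zero] at hs; exact hρ.ne hs
    refine ⟨s, Φ.φ e a - s * a, hs0, hs ▸ hρ1, fun x hx => ?_⟩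
    have h1 := hdist x hx a ha
    have h2 := hdist x hx b hb
    -- The squared distances to the images of both a and b are known; subtracting them removes the
    -- quadratic term and determines the image of x by a linear equation.
    rw [← sq_eq_sq₀ (abs_nonneg _) (by positivity), sq_abs, mul_pow, sq_abs, ← hs, sq_abs] at h1 h2
    have h3 : Φ.φ e b = Φ.φ e a + s * (b - a) := by linarith
    rw [h3] at h2
    have h4 : 2 * (s * (b - a)) * (Φ.φ e x - (s * x + (Φ.φ e a - s * a))) = 0 := by nlinarith
    have h5 : 2 * (s * (b - a)) ≠ 0 := by
      have := hba.ne'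
      positivity
    exact sub_eq_zero.1 ((mul_eq_zero.1 h4).resolve_left h5)
  choose s b h1 h2 h3 using key
  exact ⟨⟨s, b, h1, h2, h3⟩⟩

namespace AffineModel

variable (M : Φ.AffineModel)

/-- The affine extension of the map that belongs to `e`. -/
def map (e : E) (x : ℝ) : ℝ := M.slope e * x + M.offset e

/-- The contraction ratio. -/
def ratio (e : E) : ℝ := |M.slope e|

theorem ratio_pos (e : E) : 0 < M.ratio e := abs_pos.2 (M.slope_ne_zero e)

theorem ratio_lt_one (e : E) : M.ratio e < 1 := M.abs_slope_lt_one e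

theorem abs_map_sub (e : E) (x y : ℝ) : |M.map e x - M.map e y| = M.ratio e * |x - y| := by
  rw [ratio, ← abs_mul, map, map]
  congr 1
  ring

theorem code_eq_map (ω : Φ.Words) : Φ.code ω = M.map (ω.1 0) (Φ.code (Φ.shift ω)) := by
  rw [Φ.code_eq ω, M.eq_affine _ _ (Φ.code_shift_mem_X ω)]
  rfl

/-- The affine extension as a homeomorphism. -/
noncomputable def homeo (e : E) : ℝ ≃ₜ ℝ :=
  (Homeomorph.mulLeft₀ (M.slope e) (M.slope_ne_zero e)).trans (Homeomorph.addRight (M.offset e))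

theorem image_interior_map (e : E) (S : Set ℝ) : M.map e '' interior S = interior (M.map e '' S) :=
  (M.homeo e).image_interior S

theorem image_closure_map (e : E) (S : Set ℝ) : M.map e '' closure S = closure (M.map e '' S) :=
  (M.homeo e).image_closure S

theorem map_injective (e : E) : Function.Injective (M.map e) := (M.homeo e).injective

theorem continuous_map (e : E) : Continuous (M.map e) := (M.homeo e).continuous

theorem convex_image_map (e : E) {S : Set ℝ} (hS : Convex ℝ S) : Convex ℝ (M.map e '' S) :=
  (hS.isPreconnected.image _ (M.continuous_map e).continuousOn).ordConnected.convex

theorem image_map_X (e : E) : M.map e '' Φ.X (Φ.term e) = Φ.φ e '' Φ.X (Φ.term e) :=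
  image_congr fun x hx => (M.eq_affine e x hx).symm

theorem image_map_X_subset (e : E) : M.map e '' Φ.X (Φ.term e) ⊆ Φ.X (Φ.init e) := by
  rw [image_map_X]
  exact (Φ.mapsTo e).image_subset

/-- The open set condition concerns two interiors. Since each `X v` is the closure of its interior,
an open set disjoint from the one image is also disjoint from its closure. -/
theorem disjoint_interior_image_map {e e' : E} (h : e ≠ e') :
    Disjoint (interior (M.map e '' Φ.X (Φ.term e))) (M.map e' '' Φ.X (Φ.term e')) := by
  have h1 : ∀ e, M.map e '' interior (Φ.X (Φ.term e)) = Φ.φ e '' interior (Φ.X (Φ.term e)) :=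
    fun e => image_congr fun x hx => (M.eq_affine e x (interior_subset hx)).symm
  have h2 := Φ.openSet e e' h
  rw [← h1, ← h1, M.image_interior_map] at h2
  have h3 := h2.closure_right isOpen_interior
  rwa [← M.image_closure_map, Φ.closure_interior_X] at h3

/-- The set `φ_u(X_{t(u)})` for admissible non-empty words `u`. -/
def wordInterval : List E → Set ℝ
  | [] => univ
  | e :: u => M.map e '' (Φ.X (Φ.term e) ∩ wordInterval u)

theorem wordInterval_cons_subset (e : E) (u : List E) :
    M.wordInterval (e :: u) ⊆ M.map e '' Φ.X (Φ.term e) := image_mono inter_subset_left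

theorem wordInterval_cons_subset_X (e : E) (u : List E) :
    M.wordInterval (e :: u) ⊆ Φ.X (Φ.init e) :=
  (M.wordInterval_cons_subset e u).trans (M.image_map_X_subset e)

theorem convex_wordInterval (u : List E) : Convex ℝ (M.wordInterval u) := by
  induction u with
  | nil => exact convex_univ
  | cons e u ih => exact M.convex_image_map e ((Φ.convex_X _).inter ih)

theorem code_image_cylinder_subset (u : List E) :
    Φ.code '' Φ.cylinder u ⊆ M.wordInterval u := by
  induction u with
  | nil => exact subset_univ _
  | cons e u ih =>
    rintro _ ⟨ω, hω, rfl⟩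
    rw [mem_cylinder_cons] at hω
    obtain ⟨rfl, hω⟩ := hω
    rw [M.code_eq_map]
    exact mem_image_of_mem _ ⟨Φ.code_shift_mem_X ω, ih (mem_image_of_mem _ hω)⟩

/-- Common initial letters are removed by injectivity of the maps; the first different letters give
disjointness. -/
theorem disjoint_wordInterval {u u' : List E} (hlen : u.length = u'.length) (hne : u ≠ u') :
    Disjoint (interior (M.wordInterval u)) (M.wordInterval u') := by
  induction u generalizing u' with
  | nil => exact absurd (List.length_eq_zero_iff.1 hlen.symm).symm hne
  | cons e u ih =>
    cases u' with
    | nil => simp at hlen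
    | cons e' u' =>
      by_cases he : e = e'
      · subst he
        have hu : u ≠ u' := fun h => hne (by rw [h])
        rw [wordInterval, wordInterval, ← M.image_interior_map,
          disjoint_image_iff (M.map_injective e)]
        exact (ih (by simpa using hlen) hu).mono (interior_mono inter_subset_right)
          inter_subset_right
      · exact (M.disjoint_interior_image_map he).mono
          (interior_mono (M.wordInterval_cons_subset e u)) (M.wordInterval_cons_subset e' u')

theorem nonOverlapping_words {S : Finset (List E)} {m : ℕ} (hS : ∀ u ∈ S, u.length = m) :
    NonOverlapping S (fun u => Φ.code '' Φ.cylinder u) M.wordInterval where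
  isCompact u _ := Φ.isCompact_code_image_cylinder u
  subset u _ := M.code_image_cylinder_subset u
  convex u _ := M.convex_wordInterval u
  disjoint u hu u' hu' hne := M.disjoint_wordInterval ((hS u hu).trans (hS u' hu').symm) hne

theorem interior_wordInterval_nonempty {u : List E} (hu : Φ.IsAdmissible u) :
    (interior (M.wordInterval u)).Nonempty := by
  induction u with
  | nil => simp [wordInterval]
  | cons e u ih =>
    rw [wordInterval, ← M.image_interior_map]
    refine Nonempty.image _ ?_
    cases u with
    | nil => simpa [wordInterval] using Φ.interior_X_nonempty _
    | cons e' u =>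
      have hadj := Φ.incidence_eq_one_iff.1 (List.isChain_cons_cons.1 hu).1
      rw [inter_eq_right.2]
      · exact ih (List.isChain_cons_cons.1 hu).2
      · rw [hadj]
        exact M.wordInterval_cons_subset_X e' u

end AffineModel

/-! ### The first level sets `π[e]` -/

/-- The set `π[e]`. -/
def branch (Φ : ConformalGDS V E) (e : E) : Set ℝ := Φ.code '' Φ.cylinder [e]

theorem isCompact_branch (e : E) : IsCompact (Φ.branch e) := Φ.isCompact_code_image_cylinder [e]

theorem AperiodicIrreducible.branch_nonempty (hA : Φ.AperiodicIrreducible) (e : E) :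
    (Φ.branch e).Nonempty := by
  obtain ⟨ω, hω⟩ := hA.exists_word e
  exact ⟨_, ω, Φ.mem_cylinder_singleton.2 hω, rfl⟩

theorem branch_subset_X (e : E) : Φ.branch e ⊆ Φ.X (Φ.init e) := by
  rintro _ ⟨ω, hω, rfl⟩
  rw [mem_cylinder_singleton] at hω
  exact hω ▸ Φ.code_mem_X ω

theorem limitSet_eq_iUnion_branch : Φ.limitSet = ⋃ e, Φ.branch e := by
  ext x
  simp only [limitSet, mem_range, branch, mem_iUnion, mem_image, mem_cylinder_singleton]
  exact ⟨fun ⟨ω, h⟩ => ⟨_, ω, rfl, h⟩, fun ⟨e, ω, _, h⟩ => ⟨ω, h⟩⟩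

theorem branch_subset_limitSet (e : E) : Φ.branch e ⊆ Φ.limitSet := by
  rw [limitSet_eq_iUnion_branch]; exact subset_iUnion _ e

open Classical in
/-- The edges that may follow `e`. -/
noncomputable def succs (Φ : ConformalGDS V E) (e : E) : Finset E := Finset.univ.filter (Φ.Adj e)

@[simp] theorem mem_succs {e e' : E} : e' ∈ Φ.succs e ↔ Φ.Adj e e' := by simp [succs]

theorem AffineModel.branch_eq (M : Φ.AffineModel) (e : E) :
    Φ.branch e = M.map e '' ⋃ e' ∈ Φ.succs e, Φ.branch e' := by
  ext x
  constructor
  · rintro ⟨ω, hω, rfl⟩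
    rw [mem_cylinder_singleton] at hω
    subst hω
    rw [M.code_eq_map]
    refine mem_image_of_mem _ (mem_iUnion₂.2 ⟨ω.1 1, mem_succs.2 (ω.adj 0), _, ?_, rfl⟩)
    rw [mem_cylinder_singleton]; rfl
  · rintro ⟨y, hy, rfl⟩
    obtain ⟨e', he', ω, hω, rfl⟩ := mem_iUnion₂.1 hy
    rw [mem_cylinder_singleton] at hω
    rw [mem_succs] at he'
    have ha : Φ.Adj e (ω.1 0) := hω ▸ he'
    refine ⟨Φ.cons e ω ha, Φ.mem_cylinder_singleton.2 rfl, ?_⟩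
    rw [M.code_eq_map]; rfl

theorem AffineModel.nonOverlapping_branch (M : Φ.AffineModel) (S : Finset E) :
    NonOverlapping S Φ.branch (fun e => M.wordInterval [e]) where
  isCompact e _ := isCompact_branch e
  subset e _ := M.code_image_cylinder_subset [e]
  convex e _ := M.convex_wordInterval [e]
  disjoint e _ e' _ hne := M.disjoint_wordInterval rfl (by simpa using hne)

/-- The images `π[u]` are affine copies of the first level sets. -/
theorem AffineModel.code_image_cylinder_eq (M : Φ.AffineModel) {u : List E} (hu : Φ.IsAdmissible u)
    (hne : u ≠ []) : ∃ s b : ℝ, s ≠ 0 ∧ ∃ e : E,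
      Φ.code '' Φ.cylinder u = (fun x => s * x + b) '' Φ.branch e := by
  induction u with
  | nil => exact absurd rfl hne
  | cons e u ih =>
    cases u with
    | nil => exact ⟨1, 0, one_ne_zero, e, by simp [branch]⟩
    | cons e' u =>
      have hadj := Φ.incidence_eq_one_iff.1 (List.isChain_cons_cons.1 hu).1
      obtain ⟨s, b, hs, f, hf⟩ := ih (List.isChain_cons_cons.1 hu).2 (by simp)
      refine ⟨M.slope e * s, M.slope e * b + M.offset e, mul_ne_zero (M.slope_ne_zero e) hs, f, ?_⟩
      have : Φ.code '' Φ.cylinder (e :: e' :: u) = M.map e '' (Φ.code '' Φ.cylinder (e' :: u)) := by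
        ext x
        constructor
        · rintro ⟨ω, hω, rfl⟩
          rw [mem_cylinder_cons] at hω
          obtain ⟨rfl, hω⟩ := hω
          rw [M.code_eq_map]
          exact mem_image_of_mem _ (mem_image_of_mem _ hω)
        · rintro ⟨_, ⟨ω, hω, rfl⟩, rfl⟩
          have ha : Φ.Adj e (ω.1 0) := by
            rw [(Φ.mem_cylinder_cons.1 hω).1]; exact hadj
          refine ⟨Φ.cons e ω ha, Φ.mem_cylinder_cons.2 ⟨rfl, hω⟩, ?_⟩
          rw [M.code_eq_map]; rfl
      rw [this, hf, image_image]
      refine image_congr fun x _ => ?_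
      simp only [map]
      ring

/-- Three non-overlapping intervals have no common point. -/
theorem not_forall_mem_of_three {J : Fin 3 → Set ℝ} (hJ : ∀ i, Convex ℝ (J i))
    (hint : ∀ i, (interior (J i)).Nonempty)
    (hdis : ∀ i j, i ≠ j → Disjoint (interior (J i)) (J j)) (x : ℝ) : ¬ ∀ i, x ∈ J i := by
  intro hx
  choose y hy using hint
  have hne : ∀ i, y i ≠ x := fun i h => by
    obtain ⟨j, hj⟩ := exists_ne i
    exact Set.disjoint_left.1 (hdis i j hj.symm) (hy i) (h ▸ hx j)
  -- An interval containing x has an interior point on one side of x. Two intervals reaching to the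
  -- same side would overlap, and there are only two sides.
  have key : ∀ i j, i ≠ j → (x < y i → ¬ x < y j) ∧ (y i < x → ¬ y j < x) := by
    intro i j hij
    constructor
    · intro h1 h2
      rcases le_total (y i) (y j) with h | h
      · exact Set.disjoint_left.1 (hdis i j hij) (hy i)
          ((hJ j).ordConnected.out (hx j) (interior_subset (hy j)) ⟨h1.le, h⟩)
      · exact Set.disjoint_left.1 (hdis j i hij.symm) (hy j)
          ((hJ i).ordConnected.out (hx i) (interior_subset (hy i)) ⟨h2.le, h⟩)
    · intro h1 h2
      rcases le_total (y i) (y j) with h | h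
      · exact Set.disjoint_left.1 (hdis j i hij.symm) (hy j)
          ((hJ i).ordConnected.out (interior_subset (hy i)) (hx i) ⟨h, h2.le⟩)
      · exact Set.disjoint_left.1 (hdis i j hij) (hy i)
          ((hJ j).ordConnected.out (interior_subset (hy j)) (hx j) ⟨h, h1.le⟩)
  have h01 := key 0 1 (by decide)
  have h02 := key 0 2 (by decide)
  have h12 := key 1 2 (by decide)
  rcases lt_or_gt_of_ne (hne 0) with h0 | h0 <;> rcases lt_or_gt_of_ne (hne 1) with h1 | h1 <;>
    rcases lt_or_gt_of_ne (hne 2) with h2 | h2 <;> tauto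

/-- If π[e] were a point, the intervals of all words of one length beginning with e that are initial
words of infinite words would share it. Two such intervals may meet in a common end, so three words
are needed; they are told apart by their letters at the positions `n` and `n + n`. -/
theorem AffineModel.branch_nontrivial (M : Φ.AffineModel) (hE : 2 ≤ Fintype.card E)
    (hA : Φ.AperiodicIrreducible) (e : E) : (Φ.branch e).Nontrivial := by
  classical
  have hA' := hA
  obtain ⟨n, hn1, hn⟩ := hA
  obtain ⟨a, b, hab⟩ := Fintype.one_lt_card_iff.1 (show 1 < Fintype.card E by omega)
  have hw : ∀ f g : E, ∃ ω : Φ.Words, ω.1 0 = e ∧ ω.1 n = f ∧ ω.1 (n + n) = g := by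
    intro f g
    obtain ⟨ω, hω⟩ := hA'.exists_word g
    obtain ⟨ω₁, h1, h1'⟩ := Φ.exists_word_of_pow_incidence_pos (hn f (ω.1 0))
    obtain ⟨ω₂, h2, h2'⟩ := Φ.exists_word_of_pow_incidence_pos (hn e (ω₁.1 0))
    refine ⟨ω₂, h2, ?_, ?_⟩
    · rw [← h1, ← h2', Φ.shift_iterate_apply, zero_add]
    · rw [← hω, ← h1', ← h2', Φ.shift_iterate_apply, Φ.shift_iterate_apply, zero_add]
  choose w hw0 hwn hwnn using hw
  let p : Fin 3 → E × E := ![(a, a), (a, b), (b, a)]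
  have hp : Function.Injective p := by
    intro i j h
    fin_cases i <;> fin_cases j <;> simp_all [p, Ne.symm]
  let W : Fin 3 → Φ.Words := fun i => w (p i).1 (p i).2
  have hWinj : ∀ i j, i ≠ j →
      Φ.initialWord (W i) (n + n + 1) ≠ Φ.initialWord (W j) (n + n + 1) := by
    intro i j hij h
    have hco : ∀ k < n + n + 1, (W i).1 k = (W j).1 k := by
      intro k hk
      have := congrArg (fun l => l[k]?) h
      simpa [initialWord, hk] using this
    refine hij (hp (Prod.ext ?_ ?_))
    · have := hco n (by omega)
      simpa only [W, hwn] using this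
    · have := hco (n + n) (by omega)
      simpa only [W, hwnn] using this
  by_contra hsub
  rw [Set.not_nontrivial_iff] at hsub
  refine not_forall_mem_of_three
    (J := fun i => M.wordInterval (Φ.initialWord (W i) (n + n + 1)))
    (fun i => M.convex_wordInterval _)
    (fun i => M.interior_wordInterval_nonempty (Φ.isAdmissible_initialWord _ _))
    (fun i j hij => M.disjoint_wordInterval (by simp [initialWord]) (hWinj i j hij))
    (Φ.code (W 0)) fun i => ?_
  have hb : ∀ i, Φ.code (W i) ∈ Φ.branch e := fun i =>
    mem_image_of_mem _ (Φ.mem_cylinder_singleton.2 (hw0 _ _))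
  rw [hsub (hb 0) (hb i)]
  exact M.code_image_cylinder_subset _ (mem_image_of_mem _ (Φ.mem_cylinder_initialWord _ _))

end ConformalGDS

/-! ### Growth of the number of gaps -/

theorem bigGaps_anti (K : Set ℝ) {ε ε' : ℝ} (h : ε ≤ ε') : bigGaps K ε' ⊆ bigGaps K ε :=
  fun _ hp => ⟨hp.1, by linarith [hp.2]⟩

theorem volume_cthickening_lt_top {K : Set ℝ} (hK : IsCompact K) (ε : ℝ) :
    volume (Metric.cthickening ε K) < ⊤ := hK.cthickening.measure_lt_top

/-- The number of gaps of `Y` that are longer than `2 * ε` is of order `ε ^ (-δ)` and the volume of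
the neighbourhoods of `Y` is of order at most `ε ^ (1 - δ)`. -/
def GapGrowth (Y : Set ℝ) (δ : ℝ) : Prop :=
  ∃ c C : ℝ, 0 < c ∧ ∀ᶠ ε : ℝ in 𝓝[>] 0, c ≤ ε ^ δ * (bigGaps Y ε).ncard ∧
    ε ^ δ * (1 + (bigGaps Y ε).ncard) ≤ C ∧
    ε ^ (δ - 1) * (volume (Metric.cthickening ε Y)).toReal ≤ C

theorem tendsto_div_nhdsGT_zero {a : ℝ} (ha : 0 < a) :
    Tendsto (fun ε : ℝ => ε / a) (𝓝[>] 0) (𝓝[>] 0) := by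
  refine tendsto_nhdsWithin_iff.2 ⟨?_, ?_⟩
  · have : Tendsto (fun ε : ℝ => ε / a) (𝓝 0) (𝓝 (0 / a)) := tendsto_id.div_const a
    rw [zero_div] at this
    exact this.mono_left nhdsWithin_le_nhds
  · filter_upwards [self_mem_nhdsWithin] with ε hε
    exact div_pos hε ha

theorem GapGrowth.image_affine {Y : Set ℝ} {δ : ℝ} (h : GapGrowth Y δ) (hY : IsCompact Y)
    {s : ℝ} (b : ℝ) (hs : s ≠ 0) : GapGrowth ((fun x => s * x + b) '' Y) δ := by
  obtain ⟨c, C, hc, hev⟩ := h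
  have hs' : 0 < |s| := abs_pos.2 hs
  have hsδ : 0 < |s| ^ δ := Real.rpow_pos_of_pos hs' δ
  refine ⟨|s| ^ δ * c, |s| ^ δ * C, mul_pos hsδ hc, ?_⟩
  filter_upwards [(tendsto_div_nhdsGT_zero hs').eventually hev, self_mem_nhdsWithin] with ε h hε
  have hε : 0 < ε := hε
  obtain ⟨h1, h2, h3⟩ := h
  rw [ncard_bigGaps_image_affine Y b hs, volume_cthickening_image_affine hY b hs hε.le,
    ENNReal.toReal_mul, ENNReal.toReal_ofReal hs'.le]
  have e1 : ε ^ δ = |s| ^ δ * (ε / |s|) ^ δ := by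
    rw [Real.div_rpow hε.le hs'.le, mul_div_cancel₀ _ hsδ.ne']
  have e2 : ε ^ (δ - 1) * |s| = |s| ^ δ * (ε / |s|) ^ (δ - 1) := by
    rw [Real.div_rpow hε.le hs'.le, Real.rpow_sub_one hs'.ne']
    field_simp
  refine ⟨?_, ?_, ?_⟩
  · rw [e1, mul_assoc]; exact mul_le_mul_of_nonneg_left h1 hsδ.le
  · rw [e1, mul_assoc]; exact mul_le_mul_of_nonneg_left h2 hsδ.le
  · rw [← mul_assoc, e2, mul_assoc]; exact mul_le_mul_of_nonneg_left h3 hsδ.le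

theorem GapGrowth.biUnion {ι : Type*} {s : Finset ι} {K J : ι → Set ℝ} {δ : ℝ}
    (hs : s.Nonempty) (hKJ : NonOverlapping s K J) (hne : ∀ i ∈ s, (K i).Nonempty)
    (h : ∀ i ∈ s, GapGrowth (K i) δ) : GapGrowth (⋃ i ∈ s, K i) δ := by
  choose! c C hc hev using h
  obtain ⟨i₀, hi₀⟩ := hs
  refine ⟨c i₀, ∑ i ∈ s, C i, hc i₀ hi₀, ?_⟩
  filter_upwards [(Filter.eventually_all_finset s).2 hev, self_mem_nhdsWithin] with ε h hε
  have hε : 0 < ε := hε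
  have hεδ : 0 < ε ^ δ := Real.rpow_pos_of_pos hε δ
  refine ⟨(h i₀ hi₀).1.trans (mul_le_mul_of_nonneg_left ?_ hεδ.le), ?_, ?_⟩
  · have h1 := hKJ.sum_ncard_bigGaps_le hε
    have h2 := Finset.single_le_sum (f := fun i => (bigGaps (K i) ε).ncard)
      (fun _ _ => Nat.zero_le _) hi₀
    exact_mod_cast h2.trans h1
  · have h1 := one_add_ncard_bigGaps_biUnion_le s ⟨i₀, hi₀⟩ hKJ.isCompact hne hε
    have h2 : (1 + (bigGaps (⋃ i ∈ s, K i) ε).ncard : ℝ) ≤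
        ∑ i ∈ s, (1 + (bigGaps (K i) ε).ncard : ℝ) := by exact_mod_cast h1
    refine (mul_le_mul_of_nonneg_left h2 hεδ.le).trans ?_
    rw [Finset.mul_sum]
    exact Finset.sum_le_sum fun i hi => (h i hi).2.1
  · have h1 := volume_cthickening_biUnion_le s hKJ.isCompact hε.le
    have h2 := ENNReal.toReal_mono (ENNReal.sum_lt_top.2 fun i hi =>
      volume_cthickening_lt_top (hKJ.isCompact i hi) ε).ne h1
    rw [ENNReal.toReal_sum fun i hi => (volume_cthickening_lt_top (hKJ.isCompact i hi) ε).ne] at h2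
    refine (mul_le_mul_of_nonneg_left h2 (Real.rpow_pos_of_pos hε _).le).trans ?_
    rw [Finset.mul_sum]
    exact Finset.sum_le_sum fun i hi => (h i hi).2.2

namespace ConformalGDS

variable {V E : Type*} [Fintype V] [Fintype E] {Φ : ConformalGDS V E}

namespace AffineModel

variable (M : Φ.AffineModel)

/-- The incidence matrix weighted by the powers of the contraction ratios. -/
noncomputable def weight (s : ℝ) : Matrix E E ℝ := fun e e' => M.ratio e ^ s * Φ.incidence e e'

theorem weight_mulVec (s : ℝ) (x : E → ℝ) (e : E) :
    (M.weight s).mulVec x e = M.ratio e ^ s * ∑ e' ∈ Φ.succs e, x e' := by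
  classical
  simp only [Matrix.mulVec, dotProduct, weight, succs, Finset.sum_filter, Finset.mul_sum]
  refine Finset.sum_congr rfl fun e' _ => ?_
  by_cases h : Φ.Adj e e'
  · rw [if_pos h, Φ.incidence_eq_one_iff.2 h, Nat.cast_one, mul_one]
  · have h0 : Φ.incidence e e' = 0 := by simpa [incidence, Adj] using h
    rw [if_neg h, h0, Nat.cast_zero, mul_zero, zero_mul]

/-- Induction over scales. -/
theorem scale_induction {P : E → ℝ → Prop} {ε₀ c : ℝ} (h0 : 0 < ε₀) (hc : 0 < c)
    (base : ∀ e ε, c * ε₀ ≤ ε → ε ≤ ε₀ → P e ε)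
    (hcr : ∀ e, c ≤ M.ratio e)
    (step : ∀ e ε, 0 < ε → (∀ e', P e' (ε / M.ratio e)) → P e ε) :
    ∀ e ε, 0 < ε → ε ≤ ε₀ → P e ε := by
  rcases isEmpty_or_nonempty E with hE | hE
  · intro e; exact (hE.false e).elim
  obtain ⟨f, hf⟩ := Finite.exists_max M.ratio
  -- Below c ε₀, dividing by a ratio keeps the scale under ε₀ and enlarges it at least by the factor
  -- 1 / `M.ratio f`, so k steps reach all scales above `M.ratio f ^ k * (c * ε₀)`.
  have key : ∀ k : ℕ, ∀ e ε, M.ratio f ^ k * (c * ε₀) ≤ ε → ε ≤ ε₀ → P e ε := by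
    intro k
    induction k with
    | zero => intro e ε h; rw [pow_zero, one_mul] at h; exact base e ε h
    | succ k ih =>
      intro e ε h1 h2
      rcases le_or_gt (c * ε₀) ε with h | h
      · exact base e ε h h2
      have hfp : 0 < M.ratio f ^ (k + 1) := pow_pos (M.ratio_pos f) _
      have hε : 0 < ε := (mul_pos hfp (mul_pos hc h0)).trans_le h1
      refine step e ε hε fun e' => ih e' _ ?_ ?_
      · rw [le_div_iff₀ (M.ratio_pos e)]
        calc M.ratio f ^ k * (c * ε₀) * M.ratio e
            ≤ M.ratio f ^ k * (c * ε₀) * M.ratio f := mul_le_mul_of_nonneg_left (hf e)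
              (mul_nonneg (pow_pos (M.ratio_pos f) k).le (mul_pos hc h0).le)
          _ = M.ratio f ^ (k + 1) * (c * ε₀) := by ring
          _ ≤ ε := h1
      · rw [div_le_iff₀ (M.ratio_pos e)]
        exact h.le.trans (by rw [mul_comm]; exact mul_le_mul_of_nonneg_left (hcr e) h0.le)
  intro e ε hε hle
  have hlim : Tendsto (fun k : ℕ => M.ratio f ^ k * (c * ε₀)) atTop (𝓝 0) := by
    simpa using (tendsto_pow_atTop_nhds_zero_of_lt_one (M.ratio_pos f).le
      (M.ratio_lt_one f)).mul_const (c * ε₀)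
  obtain ⟨k, hk⟩ := (hlim.eventually (gt_mem_nhds hε)).exists
  exact key k e ε hk.le hle

theorem exists_le_ratio : ∃ c : ℝ, 0 < c ∧ c ≤ 1 ∧ ∀ e, c ≤ M.ratio e := by
  rcases isEmpty_or_nonempty E with hE | hE
  · exact ⟨1, one_pos, le_rfl, fun e => (hE.false e).elim⟩
  obtain ⟨f, hf⟩ := Finite.exists_min M.ratio
  exact ⟨_, M.ratio_pos f, (M.ratio_lt_one f).le, hf⟩

theorem ncard_bigGaps_branch (e : E) (ε : ℝ) : (bigGaps (Φ.branch e) ε).ncard =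
    (bigGaps (⋃ e' ∈ Φ.succs e, Φ.branch e') (ε / M.ratio e)).ncard := by
  conv_lhs => rw [M.branch_eq e]
  exact ncard_bigGaps_image_affine _ _ (M.slope_ne_zero e) ε

theorem sum_ncard_bigGaps_branch_le (e : E) {ε : ℝ} (hε : 0 < ε) :
    ∑ e' ∈ Φ.succs e, (bigGaps (Φ.branch e') (ε / M.ratio e)).ncard ≤
      (bigGaps (Φ.branch e) ε).ncard := by
  rw [M.ncard_bigGaps_branch e]
  exact (M.nonOverlapping_branch (Φ.succs e)).sum_ncard_bigGaps_le (div_pos hε (M.ratio_pos e))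

theorem one_add_ncard_bigGaps_branch_le (hA : Φ.AperiodicIrreducible) (e : E) {ε : ℝ}
    (hε : 0 < ε) : 1 + (bigGaps (Φ.branch e) ε).ncard ≤
      ∑ e' ∈ Φ.succs e, (1 + (bigGaps (Φ.branch e') (ε / M.ratio e)).ncard) := by
  rw [M.ncard_bigGaps_branch e]
  obtain ⟨f, hf⟩ := hA.exists_adj e
  exact one_add_ncard_bigGaps_biUnion_le _ ⟨f, mem_succs.2 hf⟩ (fun e _ => isCompact_branch e)
    (fun e _ => hA.branch_nonempty e) (div_pos hε (M.ratio_pos e))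

theorem volume_cthickening_branch_le (e : E) {ε : ℝ} (hε : 0 < ε) :
    (volume (Metric.cthickening ε (Φ.branch e))).toReal ≤ M.ratio e *
      ∑ e' ∈ Φ.succs e, (volume (Metric.cthickening (ε / M.ratio e) (Φ.branch e'))).toReal := by
  have h1 : volume (Metric.cthickening ε (Φ.branch e)) ≤ ENNReal.ofReal (M.ratio e) *
      ∑ e' ∈ Φ.succs e, volume (Metric.cthickening (ε / M.ratio e) (Φ.branch e')) := by
    conv_lhs => rw [M.branch_eq e]
    have hK : ∀ e' ∈ Φ.succs e, IsCompact (Φ.branch e') := fun e' _ => isCompact_branch e'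
    refine (volume_cthickening_image_affine ((Φ.succs e).isCompact_biUnion hK) (M.offset e)
      (M.slope_ne_zero e) hε.le).trans_le ?_
    exact mul_le_mul_right (volume_cthickening_biUnion_le _ hK
      (div_pos hε (M.ratio_pos e)).le) _
  have hfin : ∀ e' ∈ Φ.succs e,
      volume (Metric.cthickening (ε / M.ratio e) (Φ.branch e')) ≠ ⊤ :=
    fun e' _ => (volume_cthickening_lt_top (isCompact_branch e') _).ne
  have h2 := ENNReal.toReal_mono (ENNReal.mul_ne_top ENNReal.ofReal_ne_top
    (ENNReal.sum_ne_top.2 hfin)) h1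
  rwa [ENNReal.toReal_mul, ENNReal.toReal_ofReal (M.ratio_pos e).le,
    ENNReal.toReal_sum hfin] at h2

theorem exists_gap_branch (M : Φ.AffineModel) (hE : 2 ≤ Fintype.card E) (hA : Φ.AperiodicIrreducible)
    (hF : volume Φ.limitSet = 0) (e : E) : (gaps (Φ.branch e)).Nonempty := by
  obtain ⟨a, ha, b, hb, hab⟩ := M.branch_nontrivial hE hA e
  have h0 := measure_mono_null (branch_subset_limitSet e) hF
  rcases lt_or_gt_of_ne hab with h | h
  · exact exists_gap_of_volume_eq_zero (isCompact_branch e) h0 ha hb h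
  · exact exists_gap_of_volume_eq_zero (isCompact_branch e) h0 hb ha h

/-- A subinvariant vector bounds gap numbers from below: the recursion N_e(ε) ≥ Σ N_{e'}(ε/r_e)
carries the bound K x_e ε^(-s) to smaller scales. To start, one gap in each branch is enough. -/
theorem exists_le_ncard_bigGaps_branch (hE : 2 ≤ Fintype.card E) (hA : Φ.AperiodicIrreducible)
    (hF : volume Φ.limitSet = 0) {s : ℝ} (hs : 0 ≤ s) {x : E → ℝ} (hx0 : ∀ e, 0 ≤ x e)
    (hx : ∀ e, x e ≤ (M.weight s).mulVec x e) : ∃ K ε₀ : ℝ, 0 < K ∧ 0 < ε₀ ∧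
      ∀ e ε, 0 < ε → ε ≤ ε₀ → K * x e * ε ^ (-s) ≤ (bigGaps (Φ.branch e) ε).ncard := by
  obtain ⟨c, hc, hc1, hcr⟩ := M.exists_le_ratio
  choose p hp using M.exists_gap_branch hE hA hF
  have hE' : Nonempty E := Fintype.card_pos_iff.1 (by omega)
  obtain ⟨f, hf⟩ := Finite.exists_min fun e => (p e).2 - (p e).1
  have hfp : 0 < (p f).2 - (p f).1 := sub_pos.2 (hp f).2.2.1
  -- A quarter of the shortest of the chosen gaps, so that each of them is longer than 2ε₀.
  set ε₀ := ((p f).2 - (p f).1) / 4 with hε₀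
  have hε₀p : 0 < ε₀ := by positivity
  have hone : ∀ e ε, 0 < ε → ε ≤ ε₀ → 1 ≤ (bigGaps (Φ.branch e) ε).ncard := by
    intro e ε hε hle
    rw [Nat.one_le_iff_ne_zero, ← Nat.pos_iff_ne_zero,
      Set.ncard_pos (finite_bigGaps (isCompact_branch e) hε)]
    exact ⟨p e, hp e, by linarith [hf e]⟩
  have hS : 0 ≤ ∑ e, x e := Finset.sum_nonneg fun e _ => hx0 e
  have hcs : 0 < (c * ε₀) ^ s := Real.rpow_pos_of_pos (by positivity) s
  -- Dividing by 1 + Σ x bounds the claimed quantity by 1 on the base scales and stays meaningful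
  -- for x = 0.
  refine ⟨(c * ε₀) ^ s / (1 + ∑ e, x e), ε₀, by positivity, hε₀p, ?_⟩
  refine M.scale_induction hε₀p hc ?_ hcr ?_
  · intro e ε h1 h2
    have hε : 0 < ε := (mul_pos hc hε₀p).trans_le h1
    have h3 : ((1 : ℕ) : ℝ) ≤ (bigGaps (Φ.branch e) ε).ncard := Nat.cast_le.2 (hone e ε hε h2)
    refine le_trans ?_ h3
    have hxe : x e ≤ 1 + ∑ e, x e := by
      linarith [Finset.single_le_sum (fun e _ => hx0 e) (Finset.mem_univ e)]
    have hεs : (c * ε₀) ^ s ≤ ε ^ s := Real.rpow_le_rpow (by positivity) h1 hs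
    have hεsp : 0 < ε ^ s := Real.rpow_pos_of_pos hε s
    rw [Real.rpow_neg hε.le, Nat.cast_one, ← div_eq_mul_inv, div_le_one hεsp]
    refine le_trans ?_ hεs
    rw [div_mul_eq_mul_div, div_le_iff₀ (by positivity)]
    exact mul_le_mul_of_nonneg_left hxe hcs.le
  · intro e ε hε ih
    have h1 : (∑ e' ∈ Φ.succs e, ((bigGaps (Φ.branch e') (ε / M.ratio e)).ncard : ℝ)) ≤
        (bigGaps (Φ.branch e) ε).ncard := by
      exact_mod_cast M.sum_ncard_bigGaps_branch_le e hε
    refine le_trans ?_ ((Finset.sum_le_sum fun e' _ => ih e').trans h1)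
    rw [← Finset.sum_mul, ← Finset.mul_sum, Real.div_rpow hε.le (M.ratio_pos e).le,
      Real.rpow_neg (M.ratio_pos e).le, div_inv_eq_mul]
    have h2 := hx e
    rw [weight_mulVec] at h2
    have h3 : 0 ≤ (c * ε₀) ^ s / (1 + ∑ e, x e) := by positivity
    calc (c * ε₀) ^ s / (1 + ∑ e, x e) * x e * ε ^ (-s)
        ≤ (c * ε₀) ^ s / (1 + ∑ e, x e) * (M.ratio e ^ s * ∑ e' ∈ Φ.succs e, x e') * ε ^ (-s) :=
          mul_le_mul_of_nonneg_right (mul_le_mul_of_nonneg_left h2 h3)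
            (Real.rpow_pos_of_pos hε _).le
      _ = _ := by ring

/-- With s = 1 there are at least K x_e / ε long gaps, so the neighbourhoods have volume at least K
x_e. But this volume tends to the volume of the compact null set π[e]. -/
theorem eq_zero_of_le_weight_one_mulVec (hE : 2 ≤ Fintype.card E) (hA : Φ.AperiodicIrreducible)
    (hF : volume Φ.limitSet = 0) (x : E → ℝ) (hx0 : ∀ e, 0 ≤ x e)
    (hx : ∀ e, x e ≤ (M.weight 1).mulVec x e) : x = 0 := by
  obtain ⟨K, ε₀, hK, hε₀, h⟩ := M.exists_le_ncard_bigGaps_branch hE hA hF zero_le_one hx0 hx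
  funext e
  by_contra hne
  have hxe : 0 < x e := (hx0 e).lt_of_ne (Ne.symm hne)
  have hlim := tendsto_measure_cthickening_of_isCompact (μ := volume) (isCompact_branch (Φ := Φ) e)
  rw [measure_mono_null (branch_subset_limitSet e) hF] at hlim
  have hpos : (0 : ℝ≥0∞) < ENNReal.ofReal (K * x e) := ENNReal.ofReal_pos.2 (mul_pos hK hxe)
  have hev : ∀ᶠ ε : ℝ in 𝓝[>] 0, volume (Metric.cthickening ε (Φ.branch e)) <
      ENNReal.ofReal (K * x e) :=
    (hlim.mono_left nhdsWithin_le_nhds).eventually (gt_mem_nhds hpos)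
  obtain ⟨ε, h1, h2, h3⟩ := (hev.and (Ioo_mem_nhdsGT hε₀)).exists
  refine absurd h1 (not_lt.2 (le_trans (ENNReal.ofReal_le_ofReal ?_)
    (volume_cthickening_ge (isCompact_branch e) h2)))
  have h4 := h e ε h2 h3.le
  rw [Real.rpow_neg_one, ← div_eq_mul_inv, div_le_iff₀ h2] at h4
  linarith

/-- As q is fixed, q_e ε^(-δ) and q_e ε^(1-δ) solve the recursions for 1 + N and for the volume with
equality. Hence bounds on one range of scales pass to all smaller scales with unchanged constants.
-/
theorem gapGrowth_branch (hE : 2 ≤ Fintype.card E) (hA : Φ.AperiodicIrreducible)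
    (hF : volume Φ.limitSet = 0) {δ : ℝ} (hδ0 : 0 ≤ δ) (hδ1 : δ < 1) {q : E → ℝ}
    (hq : ∀ e, 0 < q e) (hq1 : (M.weight δ).mulVec q = q) (e : E) :
    GapGrowth (Φ.branch e) δ := by
  obtain ⟨K, ε₀, hK, hε₀, hlow⟩ := M.exists_le_ncard_bigGaps_branch hE hA hF hδ0
    (fun e => (hq e).le) (fun e => (congrFun hq1 e).ge)
  obtain ⟨c, hc, hc1, hcr⟩ := M.exists_le_ratio
  have hE' : Nonempty E := Fintype.card_pos_iff.1 (by omega)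
  obtain ⟨f, hf⟩ := Finite.exists_min q
  have hq1' : ∀ e, M.ratio e ^ δ * ∑ e' ∈ Φ.succs e, q e' = q e := fun e => by
    rw [← weight_mulVec, hq1]
  obtain ⟨L, hL⟩ : ∃ L : ℝ, 0 ≤ L ∧ ∀ e ε, 0 < ε → ε ≤ 1 →
      (1 + (bigGaps (Φ.branch e) ε).ncard : ℝ) ≤ L * q e * ε ^ (-δ) := by
    obtain ⟨g, hg⟩ := Finite.exists_max fun e => (bigGaps (Φ.branch e) c).ncard
    refine ⟨(1 + (bigGaps (Φ.branch g) c).ncard) / q f, by have := hq f; positivity,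
      M.scale_induction one_pos hc ?_ hcr ?_⟩
    · intro e ε h1 h2
      rw [mul_one] at h1
      have hε : 0 < ε := hc.trans_le h1
      have h3 : (1 : ℝ) ≤ ε ^ (-δ) := Real.one_le_rpow_of_pos_of_le_one_of_nonpos hε h2 (by linarith)
      have h4 : ((bigGaps (Φ.branch e) ε).ncard : ℝ) ≤ (bigGaps (Φ.branch g) c).ncard := by
        exact_mod_cast (ncard_le_ncard (bigGaps_anti _ h1)
          (finite_bigGaps (isCompact_branch e) hc)).trans (hg e)
      have h5 : (1 + (bigGaps (Φ.branch g) c).ncard : ℝ) ≤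
          (1 + (bigGaps (Φ.branch g) c).ncard) / q f * q e := by
        rw [div_mul_eq_mul_div, le_div_iff₀ (hq f)]
        exact mul_le_mul_of_nonneg_left (hf e) (by positivity)
      calc (1 + (bigGaps (Φ.branch e) ε).ncard : ℝ) ≤ 1 + (bigGaps (Φ.branch g) c).ncard := by
            linarith
        _ ≤ _ := h5
        _ ≤ _ := le_mul_of_one_le_right (le_trans (by positivity) h5) h3
    · intro e ε hε ih
      have h1 : (1 + (bigGaps (Φ.branch e) ε).ncard : ℝ) ≤
          ∑ e' ∈ Φ.succs e, (1 + (bigGaps (Φ.branch e') (ε / M.ratio e)).ncard : ℝ) := by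
        exact_mod_cast M.one_add_ncard_bigGaps_branch_le hA e hε
      refine (h1.trans (Finset.sum_le_sum fun e' _ => ih e')).trans_eq ?_
      rw [← Finset.sum_mul, ← Finset.mul_sum, Real.div_rpow hε.le (M.ratio_pos e).le,
        Real.rpow_neg (M.ratio_pos e).le, div_inv_eq_mul, ← hq1' e]
      ring
  obtain ⟨L', hL'⟩ : ∃ L : ℝ, 0 ≤ L ∧ ∀ e ε, 0 < ε → ε ≤ 1 →
      (volume (Metric.cthickening ε (Φ.branch e))).toReal ≤ L * q e * ε ^ (1 - δ) := by
    obtain ⟨g, hg⟩ := Finite.exists_max fun e =>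
      (volume (Metric.cthickening 1 (Φ.branch e))).toReal
    have hcδ : 0 < c ^ (1 - δ) := Real.rpow_pos_of_pos hc _
    refine ⟨(volume (Metric.cthickening 1 (Φ.branch g))).toReal / (q f * c ^ (1 - δ)),
      by have := hq f; positivity, M.scale_induction one_pos hc ?_ hcr ?_⟩
    · intro e ε h1 h2
      rw [mul_one] at h1
      have hε : 0 < ε := hc.trans_le h1
      have h3 : c ^ (1 - δ) ≤ ε ^ (1 - δ) := Real.rpow_le_rpow hc.le h1 (by linarith)
      have h4 : (volume (Metric.cthickening ε (Φ.branch e))).toReal ≤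
          (volume (Metric.cthickening 1 (Φ.branch g))).toReal :=
        (ENNReal.toReal_mono (volume_cthickening_lt_top (isCompact_branch e) 1).ne
          (measure_mono (Metric.cthickening_mono h2 _))).trans (hg e)
      refine h4.trans ?_
      have := hq f
      rw [div_mul_eq_mul_div, div_mul_eq_mul_div, le_div_iff₀ (by positivity), mul_assoc]
      exact mul_le_mul_of_nonneg_left (mul_le_mul (hf e) h3 hcδ.le (hq e).le)
        ENNReal.toReal_nonneg
    · intro e ε hε ih
      refine ((M.volume_cthickening_branch_le e hε).trans (mul_le_mul_of_nonneg_left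
        (Finset.sum_le_sum fun e' _ => ih e') (M.ratio_pos e).le)).trans_eq ?_
      -- The factor r_e by which volume scales splits: r_e^(1-δ) cancels against the rescaling of ε,
      -- and r_e^δ is the weight in the fixed point equation of q.
      have hr : M.ratio e = M.ratio e ^ δ * M.ratio e ^ (1 - δ) := by
        rw [← Real.rpow_add (M.ratio_pos e), add_sub_cancel, Real.rpow_one]
      have hrp : 0 < M.ratio e ^ (1 - δ) := Real.rpow_pos_of_pos (M.ratio_pos e) _
      rw [← Finset.sum_mul, ← Finset.mul_sum, Real.div_rpow hε.le (M.ratio_pos e).le, ← hq1' e]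
      have hr' : M.ratio e * (ε ^ (1 - δ) / M.ratio e ^ (1 - δ)) =
          M.ratio e ^ δ * ε ^ (1 - δ) := by
        rw [← mul_div_assoc, div_eq_iff hrp.ne']
        linear_combination ε ^ (1 - δ) * hr
      linear_combination ((volume (Metric.cthickening 1 (Φ.branch g))).toReal /
        (q f * c ^ (1 - δ)) * ∑ e' ∈ Φ.succs e, q e') * hr'
  refine ⟨K * q e, max (L * q e) (L' * q e), mul_pos hK (hq e), ?_⟩
  filter_upwards [Ioo_mem_nhdsGT (lt_min hε₀ one_pos)] with ε hε
  have hεp : 0 < ε := hε.1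
  have hεδ : 0 < ε ^ δ := Real.rpow_pos_of_pos hεp δ
  have h1 := hlow e ε hεp (hε.2.le.trans (min_le_left _ _))
  have h2 := hL.2 e ε hεp (hε.2.le.trans (min_le_right _ _))
  have h3 := hL'.2 e ε hεp (hε.2.le.trans (min_le_right _ _))
  rw [Real.rpow_neg hεp.le, ← div_eq_mul_inv] at h1 h2
  rw [div_le_iff₀ hεδ] at h1
  rw [le_div_iff₀ hεδ] at h2
  refine ⟨by linarith, le_max_of_le_left (by linarith), le_max_of_le_right ?_⟩
  have h4 : ε ^ (δ - 1) * ε ^ (1 - δ) = 1 := by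
    rw [← Real.rpow_add hεp]; simp
  calc _ ≤ ε ^ (δ - 1) * (L' * q e * ε ^ (1 - δ)) :=
        mul_le_mul_of_nonneg_left h3 (Real.rpow_pos_of_pos hεp _).le
    _ = L' * q e * (ε ^ (δ - 1) * ε ^ (1 - δ)) := by ring
    _ = _ := by rw [h4, mul_one]

end AffineModel

end ConformalGDS

/-! ### Minkowski dimension and scaling exponents -/

theorem count_frontier_div_two {Y : Set ℝ} (hY : IsCompact Y) (hne : Y.Nonempty) {ε : ℝ}
    (hε : 0 < ε) : Measure.count (frontier (Metric.cthickening ε Y)) / 2 =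
      ENNReal.ofReal (1 + (bigGaps Y ε).ncard) := by
  rw [count_frontier_cthickening hY hne hε]
  have : (1 + (bigGaps Y ε).ncard : ℝ) = ((1 + (bigGaps Y ε).ncard : ℕ) : ℝ) := by push_cast; ring
  have h2 : ((2 + 2 * (bigGaps Y ε).ncard : ℕ) : ℝ≥0∞) = (1 + (bigGaps Y ε).ncard : ℕ) * 2 := by
    push_cast; ring
  rw [this, ENNReal.ofReal_natCast, h2, mul_div_assoc, ENNReal.div_self (by simp) (by simp),
    mul_one]

theorem GapGrowth.rescaled_count {Y : Set ℝ} {δ : ℝ} (h : GapGrowth Y δ) :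
    ∃ c C : ℝ, 0 < c ∧ ∀ᶠ ε : ℝ in 𝓝[>] 0, c ≤ ε ^ δ * (1 + (bigGaps Y ε).ncard) ∧
      ε ^ δ * (1 + (bigGaps Y ε).ncard) ≤ C := by
  obtain ⟨c, C, hc, hev⟩ := h
  refine ⟨c, C, hc, ?_⟩
  filter_upwards [hev, self_mem_nhdsWithin] with ε h hε
  have := Real.rpow_pos_of_pos (mem_Ioi.1 hε) δ
  exact ⟨h.1.trans (mul_le_mul_of_nonneg_left (by linarith) this.le), h.2.1⟩

/-- The lower bound for the volume is inherited from the number of gaps, each contributing at least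
ε. -/
theorem GapGrowth.rescaled_volume {Y : Set ℝ} {δ : ℝ} (h : GapGrowth Y δ) (hY : IsCompact Y) :
    ∃ c C : ℝ, 0 < c ∧ ∀ᶠ ε : ℝ in 𝓝[>] 0,
      c ≤ ε ^ (δ - 1) * (volume (Metric.cthickening ε Y)).toReal ∧
      ε ^ (δ - 1) * (volume (Metric.cthickening ε Y)).toReal ≤ C := by
  obtain ⟨c, C, hc, hev⟩ := h
  refine ⟨c, C, hc, ?_⟩
  filter_upwards [hev, self_mem_nhdsWithin] with ε h hε
  have hε : 0 < ε := hε
  refine ⟨h.1.trans ?_, h.2.2⟩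
  have h1 := ENNReal.toReal_mono (volume_cthickening_lt_top hY ε).ne (volume_cthickening_ge hY hε)
  rw [ENNReal.toReal_ofReal (by positivity)] at h1
  calc ε ^ δ * (bigGaps Y ε).ncard = ε ^ (δ - 1) * (ε * (bigGaps Y ε).ncard) := by
        rw [Real.rpow_sub_one hε.ne']; field_simp
    _ ≤ _ := mul_le_mul_of_nonneg_left h1 (Real.rpow_pos_of_pos hε _).le

/-- The rescaled volume lies between positive constants, so its logarithm is negligible against ln
ε. -/
theorem tendsto_log_volume_div_log {Y : Set ℝ} {δ : ℝ} (h : GapGrowth Y δ) (hY : IsCompact Y) :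
    Tendsto (fun ε : ℝ => Real.log (volume (Metric.cthickening ε Y)).toReal / Real.log ε)
      (𝓝[>] 0) (𝓝 (1 - δ)) := by
  obtain ⟨c, C, hc, hev⟩ := h.rescaled_volume hY
  have hlog : Tendsto (fun ε : ℝ => (Real.log ε)⁻¹) (𝓝[>] 0) (𝓝 0) :=
    Real.tendsto_log_nhdsGT_zero.inv_tendsto_atBot
  have hbd : Tendsto (fun ε : ℝ => (Real.log ε)⁻¹ *
      Real.log (ε ^ (δ - 1) * (volume (Metric.cthickening ε Y)).toReal)) (𝓝[>] 0) (𝓝 0) := by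
    refine bdd_le_mul_tendsto_zero' (max |Real.log c| |Real.log C|) ?_ hlog |>.congr fun ε =>
      mul_comm _ _
    filter_upwards [hev] with ε h
    exact abs_le_max_abs_abs (Real.log_le_log hc h.1)
      (Real.log_le_log (hc.trans_le h.1) h.2)
  have := hbd.const_add (1 - δ)
  rw [add_zero] at this
  refine this.congr' ?_
  filter_upwards [hev, Ioo_mem_nhdsGT one_pos] with ε h hε
  have hε0 : 0 < ε := hε.1
  have hl : Real.log ε ≠ 0 := (Real.log_neg hε0 hε.2).ne
  have hp : 0 < ε ^ (δ - 1) := Real.rpow_pos_of_pos hε0 _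
  have hv : 0 < (volume (Metric.cthickening ε Y)).toReal :=
    pos_of_mul_pos_right (hc.trans_le h.1) hp.le
  rw [Real.log_mul hp.ne' hv.ne', Real.log_rpow hε0]
  field_simp
  ring

theorem GapGrowth.hasMinkowskiDim {Y : Set ℝ} {δ : ℝ} (h : GapGrowth Y δ) (hY : IsCompact Y) :
    HasMinkowskiDim Y δ := by
  have ht := (continuous_coe_real_ereal.tendsto (1 - δ)).comp (tendsto_log_volume_div_log h hY)
  have e : (1 : EReal) - ((1 - δ : ℝ) : EReal) = δ := by
    rw [← EReal.coe_one, ← EReal.coe_sub, sub_sub_cancel]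
  constructor
  · rw [upperMinkowskiDim, ← e]
    exact congrArg _ ht.liminf_eq
  · rw [lowerMinkowskiDim, ← e]
    exact congrArg _ ht.limsup_eq

/-- Two-sided bounds at the exponent s identify the set of admissible exponents as exactly `Ioi s`.
-/
theorem sInf_setOf_tendsto_rpow_mul {f : ℝ → ℝ≥0∞} {s c C : ℝ} (hc : 0 < c)
    (h : ∀ᶠ ε : ℝ in 𝓝[>] 0, ENNReal.ofReal c ≤ ENNReal.ofReal (ε ^ s) * f ε ∧
      ENNReal.ofReal (ε ^ s) * f ε ≤ ENNReal.ofReal C) :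
    sInf {t : ℝ | Tendsto (fun ε : ℝ => ENNReal.ofReal (ε ^ t) * f ε) (𝓝[>] 0) (𝓝 0)} = s := by
  have hset : {t : ℝ | Tendsto (fun ε : ℝ => ENNReal.ofReal (ε ^ t) * f ε) (𝓝[>] 0) (𝓝 0)} =
      Ioi s := by
    ext t
    constructor
    · intro ht
      by_contra hts
      have hts : t ≤ s := not_lt.1 hts
      have ht' := (ht : Tendsto (fun ε : ℝ => ENNReal.ofReal (ε ^ t) * f ε) (𝓝[>] 0)
        (𝓝 0)).eventually (gt_mem_nhds (ENNReal.ofReal_pos.2 hc))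
      obtain ⟨ε, ⟨h1, h2⟩, h3⟩ := ((ht'.and h).and (Ioo_mem_nhdsGT one_pos)).exists
      refine absurd (h2.1.trans ?_) (not_le.2 h1)
      exact mul_le_mul_left (ENNReal.ofReal_le_ofReal
        (Real.rpow_le_rpow_of_exponent_ge h3.1 h3.2.le hts)) _
    · intro hts
      have hts : 0 < t - s := sub_pos.2 hts
      have h1 : Tendsto (fun ε : ℝ => ENNReal.ofReal (ε ^ (t - s) * C)) (𝓝[>] 0) (𝓝 0) := by
        have h2 : Tendsto (fun ε : ℝ => ε ^ (t - s)) (𝓝 0) (𝓝 (0 ^ (t - s))) :=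
          (Real.continuousAt_rpow_const 0 (t - s) (Or.inr hts.le)).tendsto
        rw [Real.zero_rpow hts.ne'] at h2
        have h3 := ENNReal.tendsto_ofReal ((h2.mono_left (nhdsWithin_le_nhds (s := Ioi 0))).mul_const C)
        rwa [zero_mul, ENNReal.ofReal_zero] at h3
      refine tendsto_of_tendsto_of_tendsto_of_le_of_le' tendsto_const_nhds h1
        (Eventually.of_forall fun _ => zero_le) ?_
      filter_upwards [h, self_mem_nhdsWithin] with ε h hε
      have hε : 0 < ε := hε
      have e : ε ^ t = ε ^ (t - s) * ε ^ s := by rw [← Real.rpow_add hε, sub_add_cancel]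
      have hp := (Real.rpow_pos_of_pos hε (t - s)).le
      rw [e, ENNReal.ofReal_mul hp, mul_assoc, ENNReal.ofReal_mul hp]
      exact mul_le_mul_right h.2 _
  rw [hset, csInf_Ioi]

theorem GapGrowth.scalingExponent0_eq {Y : Set ℝ} {δ : ℝ} (h : GapGrowth Y δ) (hY : IsCompact Y)
    (hne : Y.Nonempty) : scalingExponent0 Y = δ := by
  obtain ⟨c, C, hc, hev⟩ := h.rescaled_count
  refine sInf_setOf_tendsto_rpow_mul (c := 2 * c) (C := 2 * C) (by positivity) ?_
  filter_upwards [hev, self_mem_nhdsWithin] with ε h hε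
  have hε : 0 < ε := hε
  have hp := (Real.rpow_pos_of_pos hε δ).le
  have e : Measure.count (frontier (Metric.cthickening ε Y)) =
      ENNReal.ofReal (2 * (1 + (bigGaps Y ε).ncard)) := by
    rw [count_frontier_cthickening hY hne hε, ← ENNReal.ofReal_natCast]
    congr 1
    push_cast
    ring
  rw [e, ← ENNReal.ofReal_mul hp]
  exact ⟨ENNReal.ofReal_le_ofReal (by linarith), ENNReal.ofReal_le_ofReal (by linarith)⟩

theorem ofReal_rpow_mul_volume {Y : Set ℝ} (hY : IsCompact Y) {ε : ℝ} (hε : 0 < ε) (s : ℝ) :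
    ENNReal.ofReal (ε ^ s) * volume (Metric.cthickening ε Y) =
      ENNReal.ofReal (ε ^ s * (volume (Metric.cthickening ε Y)).toReal) := by
  rw [ENNReal.ofReal_mul (Real.rpow_pos_of_pos hε s).le,
    ENNReal.ofReal_toReal (volume_cthickening_lt_top hY ε).ne]

theorem GapGrowth.scalingExponent1_eq {Y : Set ℝ} {δ : ℝ} (h : GapGrowth Y δ) (hY : IsCompact Y) :
    scalingExponent1 Y = δ - 1 := by
  obtain ⟨c, C, hc, hev⟩ := h.rescaled_volume hY
  refine sInf_setOf_tendsto_rpow_mul (C := C) hc ?_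
  filter_upwards [hev, self_mem_nhdsWithin] with ε h hε
  rw [ofReal_rpow_mul_volume hY hε]
  exact ⟨ENNReal.ofReal_le_ofReal h.1, ENNReal.ofReal_le_ofReal h.2⟩

/-! ### Oscillation -/

/-- There are arbitrarily small scales `ε` such that no gap of `Y` has a length between
`2 * κ * ε` and `2 * ε`, for a fixed `κ < 1`. -/
def HasEmptyScales (Y : Set ℝ) : Prop :=
  ∃ κ : ℝ, 0 < κ ∧ κ < 1 ∧ ∃ u : ℕ → ℝ, Tendsto u atTop (𝓝[>] 0) ∧
    ∀ n, ∀ p ∈ gaps Y, 2 * (κ * u n) < p.2 - p.1 → 2 * u n < p.2 - p.1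

theorem bigGaps_eq_of_empty_scale {Y : Set ℝ} {a b t : ℝ}
    (h : ∀ p ∈ gaps Y, 2 * a < p.2 - p.1 → 2 * b < p.2 - p.1) (hat : a ≤ t) (htb : t ≤ b) :
    bigGaps Y t = bigGaps Y b :=
  Subset.antisymm (fun _ hp => ⟨hp.1, h _ hp.1 (by linarith [hp.2])⟩) (bigGaps_anti Y htb)

theorem tendsto_const_mul_nhdsGT_zero {ι : Type*} {l : Filter ι} {u : ι → ℝ} {κ : ℝ} (hκ : 0 < κ)
    (hu : Tendsto u l (𝓝[>] 0)) : Tendsto (fun n => κ * u n) l (𝓝[>] 0) := by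
  have := (tendsto_div_nhdsGT_zero (inv_pos.2 hκ)).comp hu
  refine this.congr fun n => ?_
  rw [Function.comp_apply, div_inv_eq_mul, mul_comm]

/-- The gap number is the same at κ u_n and at u_n, so a limit ℓ would satisfy ℓ = κ^δ ℓ, while the
lower bound in `GapGrowth` makes ℓ positive. -/
theorem HasEmptyScales.not_tendsto_count {Y : Set ℝ} (h : HasEmptyScales Y) {δ : ℝ} (hδ : 0 < δ)
    (hg : GapGrowth Y δ) (ℓ : ℝ) :
    ¬ Tendsto (fun ε : ℝ => ε ^ δ * (1 + (bigGaps Y ε).ncard : ℝ)) (𝓝[>] 0) (𝓝 ℓ) := by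
  intro ht
  obtain ⟨c, C, hc, hev⟩ := hg.rescaled_count
  obtain ⟨κ, hκ0, hκ1, u, hu, hgap⟩ := h
  have hℓ : 0 < ℓ := hc.trans_le (ge_of_tendsto ht (hev.mono fun _ h => h.1))
  have h1 := ht.comp hu
  have h2 := ht.comp (tendsto_const_mul_nhdsGT_zero hκ0 hu)
  have h3 : ℓ = κ ^ δ * ℓ := by
    refine tendsto_nhds_unique h2 ((h1.const_mul (κ ^ δ)).congr' ?_)
    filter_upwards [hu.eventually self_mem_nhdsWithin] with n hn
    have hn : 0 < u n := hn
    simp only [Function.comp_apply]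
    rw [bigGaps_eq_of_empty_scale (hgap n) le_rfl (by nlinarith), Real.mul_rpow hκ0.le hn.le]
    ring
  have h4 : κ ^ δ < 1 := Real.rpow_lt_one hκ0.le hκ1 hδ
  nlinarith

/-- On the window from κ u_n to u_n the volume is affine in the scale. A limit of the rescaled
volume would make it asymptotic to ℓ t^(1-δ) with ℓ > 0, and strict concavity of this power excludes
that. -/
theorem HasEmptyScales.not_tendsto_volume {Y : Set ℝ} (h : HasEmptyScales Y) {δ : ℝ} (hδ : 0 < δ)
    (hδ1 : δ < 1) (hY : IsCompact Y) (hne : Y.Nonempty) (hg : GapGrowth Y δ) (ℓ : ℝ) :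
    ¬ Tendsto (fun ε : ℝ => ε ^ (δ - 1) * (volume (Metric.cthickening ε Y)).toReal)
      (𝓝[>] 0) (𝓝 ℓ) := by
  intro ht
  obtain ⟨c, C, hc, hev⟩ := hg.rescaled_volume hY
  obtain ⟨κ, hκ0, hκ1, u, hu, hgap⟩ := h
  have hℓ : 0 < ℓ := hc.trans_le (ge_of_tendsto ht (hev.mono fun _ h => h.1))
  set g : ℝ → ℝ := fun ε => ε ^ (δ - 1) * (volume (Metric.cthickening ε Y)).toReal with hgdef
  -- The midpoint of the window, where affine and strictly concave functions disagree.
  set μ : ℝ := (1 + κ) / 2 with hμ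
  have hμ0 : 0 < μ := by positivity
  have h1 := ht.comp hu
  have h2 := ht.comp (tendsto_const_mul_nhdsGT_zero hκ0 hu)
  have h3 := ht.comp (tendsto_const_mul_nhdsGT_zero hμ0 hu)
  have hvol : ∀ n, 0 < u n → 2 * (volume (Metric.cthickening (μ * u n) Y)).toReal =
      (volume (Metric.cthickening (u n) Y)).toReal +
        (volume (Metric.cthickening (κ * u n) Y)).toReal := by
    intro n hn
    have hfin := finite_bigGaps hY hn
    have key : ∀ t, 0 < t → κ * u n ≤ t → t ≤ u n →
        (volume (Metric.cthickening t Y)).toReal = (sSup Y - sInf Y + 2 * t) -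
          ∑ p ∈ hfin.toFinset, (p.2 - p.1 - 2 * t) := by
      intro t h0 ht1 ht2
      rw [volume_cthickening_eq hY hne h0]
      congr 1
      refine Finset.sum_congr ?_ fun _ _ => rfl
      rw [Finite.toFinset_inj]
      exact bigGaps_eq_of_empty_scale (hgap n) ht1 ht2
    rw [key (μ * u n) (by positivity) (by nlinarith) (by nlinarith), key (u n) hn (by nlinarith)
      le_rfl, key (κ * u n) (by positivity) le_rfl (by nlinarith)]
    simp only [Finset.sum_sub_distrib, Finset.sum_const, nsmul_eq_mul, hμ]
    ring
  have hlim : 2 * (μ ^ (1 - δ) * ℓ) = ℓ + κ ^ (1 - δ) * ℓ := by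
    refine tendsto_nhds_unique ((h3.const_mul (μ ^ (1 - δ))).const_mul 2)
      ((h1.add (h2.const_mul (κ ^ (1 - δ)))).congr' ?_)
    filter_upwards [hu.eventually self_mem_nhdsWithin] with n hn
    have hn : 0 < u n := hn
    have e : ∀ t : ℝ, 0 < t → t ^ (1 - δ) * g (t * u n) =
        u n ^ (δ - 1) * (volume (Metric.cthickening (t * u n) Y)).toReal := by
      intro t h0
      have h5 : t ^ (1 - δ) * t ^ (δ - 1) = 1 := by rw [← Real.rpow_add h0]; simp
      rw [hgdef]
      simp only
      rw [Real.mul_rpow h0.le hn.le]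
      linear_combination (u n ^ (δ - 1) * (volume (Metric.cthickening (t * u n) Y)).toReal) * h5
    simp only [Function.comp_apply]
    rw [e κ hκ0, e μ hμ0, hgdef]
    simp only
    linear_combination (-u n ^ (δ - 1)) * hvol n hn
  have hconc := (Real.strictConcaveOn_rpow (p := 1 - δ) (by linarith) (by linarith)).2
    (show (1 : ℝ) ∈ Ici 0 by simp) (show κ ∈ Ici (0 : ℝ) from hκ0.le) hκ1.ne'
    (show (0 : ℝ) < 1 / 2 by norm_num) (show (0 : ℝ) < 1 / 2 by norm_num) (by norm_num)
  simp only [smul_eq_mul, Real.one_rpow] at hconc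
  have e : (1 / 2 * 1 + 1 / 2 * κ : ℝ) = μ := by rw [hμ]; ring
  rw [e] at hconc
  nlinarith

theorem liminf_lt_limsup_ofReal {g : ℝ → ℝ} {l : Filter ℝ} [l.NeBot] {c C : ℝ} (hc : 0 < c)
    (h : ∀ᶠ ε in l, c ≤ g ε ∧ g ε ≤ C) (hg : ∀ ℓ, ¬ Tendsto g l (𝓝 ℓ)) :
    0 < liminf (fun ε => ENNReal.ofReal (g ε)) l ∧
      liminf (fun ε => ENNReal.ofReal (g ε)) l < limsup (fun ε => ENNReal.ofReal (g ε)) l ∧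
      limsup (fun ε => ENNReal.ofReal (g ε)) l < ⊤ := by
  have hlow : ENNReal.ofReal c ≤ liminf (fun ε => ENNReal.ofReal (g ε)) l :=
    le_liminf_of_le (by isBoundedDefault) (h.mono fun ε h => ENNReal.ofReal_le_ofReal h.1)
  have hup : limsup (fun ε => ENNReal.ofReal (g ε)) l ≤ ENNReal.ofReal C :=
    limsup_le_of_le (by isBoundedDefault) (h.mono fun ε h => ENNReal.ofReal_le_ofReal h.2)
  refine ⟨(ENNReal.ofReal_pos.2 hc).trans_le hlow, lt_of_le_of_ne liminf_le_limsup fun heq => ?_,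
    hup.trans_lt ENNReal.ofReal_lt_top⟩
  have ht := tendsto_of_liminf_eq_limsup heq rfl
  have hfin : limsup (fun ε => ENNReal.ofReal (g ε)) l ≠ ⊤ :=
    (hup.trans_lt ENNReal.ofReal_lt_top).ne
  refine hg _ (((ENNReal.tendsto_toReal hfin).comp ht).congr' ?_)
  filter_upwards [h] with ε h
  exact ENNReal.toReal_ofReal (hc.le.trans h.1)

/-! ### Gaps with lattice lengths -/

/-- The logarithms of the gap lengths lie in finitely many cosets of `a ℤ`. -/
def LatticeGaps (a : ℝ) (Y : Set ℝ) : Prop :=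
  ∃ P : Set ℝ, P.Finite ∧ ∀ p ∈ gaps Y, ∃ d ∈ P, ∃ k : ℤ, Real.log (p.2 - p.1) = d + k * a

theorem LatticeGaps.image_affine {a : ℝ} {Y : Set ℝ} (h : LatticeGaps a Y) {s : ℝ} (b : ℝ)
    (hs : s ≠ 0) : LatticeGaps a ((fun x => s * x + b) '' Y) := by
  obtain ⟨P, hP, h⟩ := h
  refine ⟨(fun d => Real.log |s| + d) '' P, hP.image _, fun p hp => ?_⟩
  obtain ⟨q, hq, hlen⟩ := exists_gap_of_mem_gaps_image_affine hs hp
  obtain ⟨d, hd, k, hk⟩ := h q hq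
  refine ⟨_, mem_image_of_mem _ hd, k, ?_⟩
  rw [hlen, Real.log_mul (abs_pos.2 hs).ne' (sub_pos.2 hq.2.2.1).ne', hk]
  ring

theorem LatticeGaps.biUnion {ι : Type*} {s : Finset ι} {K J : ι → Set ℝ} {a : ℝ}
    (hKJ : NonOverlapping s K J) (h : ∀ i ∈ s, LatticeGaps a (K i)) :
    LatticeGaps a (⋃ i ∈ s, K i) := by
  choose! P hP h using h
  refine ⟨(⋃ i ∈ s, P i) ∪ ⋃ i ∈ s, ⋃ j ∈ s, {Real.log (sInf (K j) - sSup (K i))},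
    (s.finite_toSet.biUnion hP).union (s.finite_toSet.biUnion fun i _ =>
      s.finite_toSet.biUnion fun j _ => finite_singleton _), fun p hp => ?_⟩
  rcases hKJ.mem_gaps_or_eq hp with ⟨i, hi, hpi⟩ | ⟨i, hi, j, hj, rfl⟩
  · obtain ⟨d, hd, k, hk⟩ := h i hi p hpi
    exact ⟨d, Or.inl (mem_iUnion₂.2 ⟨i, hi, hd⟩), k, hk⟩
  · exact ⟨_, Or.inr (mem_iUnion₂.2 ⟨i, hi, mem_iUnion₂.2 ⟨j, hj, rfl⟩⟩), 0, by simp⟩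

theorem LatticeGaps.hasEmptyScales {a : ℝ} (ha : 0 < a) {Y : Set ℝ} (h : LatticeGaps a Y) :
    HasEmptyScales Y := by
  obtain ⟨P, hP, h⟩ := h
  set Q : Set ℝ := (fun d => Int.fract (d / a)) '' P with hQ
  have hQf : Q.Finite := hP.image _
  -- On the scale of logarithms divided by a, the gap lengths have only finitely many fractional
  -- parts. A point z and an interval of radius η around it avoid all of them, and so do the
  -- translates by integers.
  obtain ⟨z, hz, hzQ⟩ : ∃ z ∈ Ioo (0 : ℝ) 1, z ∉ Q :=
    ((Ioo_infinite zero_lt_one).exists_notMem_finite hQf)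
  have hopen : IsOpen (Ioo (0 : ℝ) 1 \ Q) := isOpen_Ioo.sdiff hQf.isClosed
  obtain ⟨η, hη, hsub⟩ := Metric.isOpen_iff.1 hopen z ⟨hz, hzQ⟩
  -- Twice the window then runs from exp(a(z - n - η/2)) to exp(a(z - n + η/2)); the division by 2
  -- reflects that gaps are compared with 2ε.
  refine ⟨Real.exp (-(a * η)), Real.exp_pos _, by rw [Real.exp_lt_one_iff]; nlinarith,
    fun n => Real.exp (a * (z - n + η / 2)) / 2, ?_, ?_⟩
  · refine tendsto_nhdsWithin_iff.2 ⟨?_, Eventually.of_forall fun n => by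
      simpa using Real.exp_pos _⟩
    rw [show (0 : ℝ) = 0 / 2 by norm_num]
    refine Tendsto.div_const (Real.tendsto_exp_atBot.comp ?_) 2
    refine Tendsto.const_mul_atBot ha ?_
    have : Tendsto (fun n : ℕ => -(n : ℝ) + (z + η / 2)) atTop atBot :=
      tendsto_atBot_add_const_right _ _ (tendsto_neg_atTop_atBot.comp tendsto_natCast_atTop_atTop)
    exact this.congr fun n => by ring
  · intro n p hp hlt
    by_contra hle
    have hle : p.2 - p.1 ≤ Real.exp (a * (z - n + η / 2)) := by linarith
    have hlen : 0 < p.2 - p.1 := sub_pos.2 hp.2.2.1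
    have hlt' : Real.exp (a * (z - n - η / 2)) < p.2 - p.1 := by
      refine lt_of_eq_of_lt ?_ hlt
      rw [mul_div_assoc', mul_div_cancel₀ _ two_ne_zero, ← Real.exp_add]
      congr 1; ring
    obtain ⟨d, hd, k, hk⟩ := h p hp
    have h1 : a * (z - n - η / 2) < d + k * a := by
      rw [← hk]; exact (Real.lt_log_iff_exp_lt hlen).2 hlt'
    have h2 : d + k * a ≤ a * (z - n + η / 2) := by
      rw [← hk]; exact (Real.log_le_iff_le_exp hlen).2 hle
    have e : d = a * (d / a) := by field_simp
    rw [e] at h1 h2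
    have h3 : z - η / 2 < d / a + k + n := by nlinarith
    have h4 : d / a + k + n ≤ z + η / 2 := by nlinarith
    have hmem : d / a + k + n ∈ Ioo (0 : ℝ) 1 \ Q := by
      refine hsub ?_
      rw [Metric.mem_ball, Real.dist_eq, abs_lt]
      constructor <;> linarith
    refine hmem.2 ⟨d, hd, ?_⟩
    have h5 : Int.fract (d / a + k + n) = d / a + k + n :=
      Int.fract_eq_self.2 ⟨hmem.1.1.le, hmem.1.2⟩
    rw [← h5]
    simp

namespace ConformalGDS

variable {V E : Type*} [Fintype V] [Fintype E] {Φ : ConformalGDS V E}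

/-! ### The lattice condition -/

theorem AffineModel.geometricPotential_eq (M : Φ.AffineModel) (ω : Φ.Words) :
    Φ.geometricPotential ω = -Real.log (M.ratio (ω.1 0)) := by
  have hx := Φ.code_shift_mem_X ω
  have h1 : HasDerivAt (M.map (ω.1 0)) (M.slope (ω.1 0)) (Φ.code (Φ.shift ω)) := by
    have := ((hasDerivAt_id (Φ.code (Φ.shift ω))).const_mul (M.slope (ω.1 0))).add_const
      (M.offset (ω.1 0))
    rwa [mul_one] at this
  have h2 : HasDerivWithinAt (Φ.φ (ω.1 0)) (M.slope (ω.1 0)) (Φ.X (Φ.term (ω.1 0)))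
      (Φ.code (Φ.shift ω)) :=
    h1.hasDerivWithinAt.congr (fun x hx => M.eq_affine _ x hx) (M.eq_affine _ _ hx)
  have hu := uniqueDiffWithinAt_convex (Φ.convex_X (Φ.term (ω.1 0)))
    (Φ.interior_X_nonempty _) (subset_closure hx)
  rw [geometricPotential, h2.derivWithin hu]
  rfl

/-- An infinite word, given as a sequence of consecutive edges. -/
def mkWord (p : ℕ → E) (h : ∀ n, Φ.Adj (p n) (p (n + 1))) : Φ.Words :=
  ⟨p, fun n => Φ.incidence_eq_one_iff.2 (h n)⟩

theorem mkWord_val (p : ℕ → E) (h : ∀ n, Φ.Adj (p n) (p (n + 1))) : (mkWord p h).1 = p := rfl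

/-- There is a path of length `n` from `e` to `f` whose product of ratios is `exp (-c)`. -/
def AffineModel.HasPath (M : Φ.AffineModel) (n : ℕ) (e f : E) (c : ℝ) : Prop :=
  ∃ ω : Φ.Words, ω.1 0 = e ∧ ω.1 n = f ∧ c = ∑ i ∈ Finset.range n, -Real.log (M.ratio (ω.1 i))

theorem AffineModel.HasPath.trans {M : Φ.AffineModel} {n m : ℕ} {e f g : E} {c d : ℝ}
    (h₁ : M.HasPath n e f c) (h₂ : M.HasPath m f g d) : M.HasPath (n + m) e g (c + d) := by
  obtain ⟨ω, h0, hn, hc⟩ := h₁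
  obtain ⟨ω', h0', hm, hd⟩ := h₂
  have hp : ∀ i, Φ.Adj (if i < n then ω.1 i else ω'.1 (i - n))
      (if i + 1 < n then ω.1 (i + 1) else ω'.1 (i + 1 - n)) := by
    intro i
    by_cases h : i + 1 < n
    · rw [if_pos h, if_pos (by omega)]; exact ω.adj i
    · by_cases h' : i < n
      · have hi : i + 1 = n := by omega
        rw [if_pos h', if_neg h, hi, Nat.sub_self, h0', ← hn, ← hi]
        exact ω.adj i
      · rw [if_neg h', if_neg h, show i + 1 - n = (i - n) + 1 by omega]
        exact ω'.adj _
  refine ⟨mkWord (fun i => if i < n then ω.1 i else ω'.1 (i - n)) hp, ?_, ?_, ?_⟩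
  · rw [mkWord_val]
    by_cases h : 0 < n
    · simpa [h] using h0
    · have : n = 0 := by omega
      subst this
      simpa [h0'] using hn.symm.trans h0
  · rw [mkWord_val]; simpa using hm
  · rw [mkWord_val, Finset.sum_range_add, hc, hd]
    congr 1
    · exact Finset.sum_congr rfl fun i hi => by simp [Finset.mem_range.1 hi]
    · exact Finset.sum_congr rfl fun i _ => by simp

theorem AffineModel.hasPath_one (M : Φ.AffineModel) (hA : Φ.AperiodicIrreducible) {e f : E}
    (h : Φ.Adj e f) : M.HasPath 1 e f (-Real.log (M.ratio e)) := by
  obtain ⟨ω, hω⟩ := hA.exists_word f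
  exact ⟨Φ.cons e ω (hω ▸ h), rfl, hω, by simp⟩

theorem AffineModel.exists_hasPath (M : Φ.AffineModel) (hA : Φ.AperiodicIrreducible) (e f : E) :
    ∃ n, 1 ≤ n ∧ ∃ c, M.HasPath n e f c := by
  obtain ⟨n, hn1, hn⟩ := id hA
  obtain ⟨ω, hω⟩ := hA.exists_word f
  obtain ⟨ω', h0, h1⟩ := Φ.exists_word_of_pow_incidence_pos (hn e (ω.1 0))
  exact ⟨n, hn1, _, ω', h0, by rw [← hω, ← h1, Φ.shift_iterate_apply, zero_add], rfl⟩

/-- Repeating the loop gives a periodic word. Over one period the coboundary telescopes to zero, so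
the sum of the potential equals a sum of values of ζ, which lie in `H`. -/
theorem AffineModel.HasPath.mem_of_loop {M : Φ.AffineModel} {n : ℕ} {e : E} {c : ℝ}
    (h : M.HasPath n e e c) (hn : 1 ≤ n) {ζ ψ : Φ.Words → ℝ}
    (hζ : ∀ ω, Φ.geometricPotential ω - ζ ω = ψ ω - ψ (Φ.shift ω)) {H : AddSubgroup ℝ}
    (hH : ∀ ω, ζ ω ∈ H) : c ∈ H := by
  obtain ⟨ω, h0, hn', rfl⟩ := h
  have hp : ∀ i, Φ.Adj (ω.1 (i % n)) (ω.1 ((i + 1) % n)) := by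
    intro i
    have hlt := Nat.mod_lt i hn
    have hadj := ω.adj (i % n)
    by_cases hi : i % n + 1 < n
    · have : (i + 1) % n = i % n + 1 := by
        rw [Nat.add_mod, Nat.mod_eq_of_lt (show 1 < n by omega), Nat.mod_eq_of_lt hi]
      rwa [this]
    · have hi' : i % n + 1 = n := by omega
      have : (i + 1) % n = 0 := by
        rw [← Nat.mod_add_mod, hi', Nat.mod_self]
      rw [hi', hn'] at hadj
      rwa [this, h0]
  let τ : Φ.Words := mkWord (fun i => ω.1 (i % n)) hp
  have hτ : Φ.shift^[n] τ = τ := by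
    refine Subtype.ext (funext fun i => ?_)
    rw [shift_iterate_apply]
    simp [τ, mkWord_val]
  have key : ∑ i ∈ Finset.range n, Φ.geometricPotential (Φ.shift^[i] τ) =
      ∑ i ∈ Finset.range n, ζ (Φ.shift^[i] τ) := by
    rw [← sub_eq_zero, ← Finset.sum_sub_distrib]
    simp only [hζ, ← Function.iterate_succ_apply']
    rw [Finset.sum_range_sub', hτ]
    simp
  have hsum : ∑ i ∈ Finset.range n, -Real.log (M.ratio (ω.1 i)) =
      ∑ i ∈ Finset.range n, Φ.geometricPotential (Φ.shift^[i] τ) := by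
    refine Finset.sum_congr rfl fun i hi => ?_
    rw [M.geometricPotential_eq, shift_iterate_apply, zero_add]
    simp [τ, mkWord_val, Nat.mod_eq_of_lt (Finset.mem_range.1 hi)]
  rw [hsum, key]
  exact H.sum_mem fun i _ => hH _

/-- In the lattice case the logarithms of the ratios are, up to a coboundary that depends on the
edges only, multiples of a positive number. -/
theorem AffineModel.exists_coboundary_of_isLattice (M : Φ.AffineModel) [Nonempty E]
    (hA : Φ.AperiodicIrreducible) (hL : Φ.IsLattice Φ.geometricPotential) :
    ∃ (a : ℝ) (θ : E → ℝ), 0 < a ∧ ∀ e e', Φ.Adj e e' →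
      ∃ k : ℤ, -Real.log (M.ratio e) = θ e - θ e' + k * a := by
  obtain ⟨ζ, ψ, hζ, H, hdisc, hH⟩ := hL
  obtain ⟨g, hg⟩ := (AddSubgroup.discrete_iff_addCyclic.2 hdisc).exists_generator
  have hmem : ∀ x ∈ H, ∃ k : ℤ, x = k * (g : ℝ) := fun x hx => by
    obtain ⟨k, hk⟩ := hg ⟨x, hx⟩
    refine ⟨k, ?_⟩
    have := congrArg Subtype.val hk
    simpa using this.symm
  obtain ⟨e₀⟩ := ‹Nonempty E›
  -- All ratios are below 1, so a loop has positive cost and the group cannot be trivial.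
  have hg0 : (g : ℝ) ≠ 0 := by
    obtain ⟨n, hn1, c, hc⟩ := M.exists_hasPath hA e₀ e₀
    obtain ⟨k, hk⟩ := hmem c (hc.mem_of_loop hn1 hζ hH)
    have hcpos : 0 < c := by
      obtain ⟨ω, -, -, rfl⟩ := hc
      refine Finset.sum_pos (fun i _ => ?_) (Finset.nonempty_range_iff.2 (by omega))
      exact neg_pos.2 (Real.log_neg (M.ratio_pos _) (M.ratio_lt_one _))
    intro h
    rw [h, mul_zero] at hk
    exact hcpos.ne' hk
  -- θ e is the cost of a chosen path from e to e₀. For an edge e' after e, the loops e₀ → e → e₀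
  -- and e₀ → e → e' → e₀ with the same first part differ in cost by -ln r_e + θ e' - θ e, which
  -- therefore lies in `H`.
  choose n hn1 θ hθ using fun e => M.exists_hasPath hA e e₀
  refine ⟨|(g : ℝ)|, θ, abs_pos.2 hg0, fun e e' h => ?_⟩
  obtain ⟨m, hm, c, hc⟩ := M.exists_hasPath hA e₀ e
  have h1 := (hc.trans (hθ e)).mem_of_loop (by omega) hζ hH
  have h2 := ((hc.trans (M.hasPath_one hA h)).trans (hθ e')).mem_of_loop (by omega) hζ hH
  obtain ⟨k, hk⟩ := hmem _ (H.sub_mem h2 h1)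
  rcases abs_choice (g : ℝ) with hab | hab
  · exact ⟨k, by rw [hab]; linarith⟩
  · exact ⟨-k, by rw [hab]; push_cast; linarith⟩

/-- A gap of π[e] is either the image of a gap of a successor branch or the image of one of finitely
many gaps between two branches. In the first case the logarithm of the length plus θ at the
respective edge is preserved modulo a. -/
theorem AffineModel.latticeGaps_branch (M : Φ.AffineModel) {a : ℝ} {θ : E → ℝ}
    (h : ∀ e e', Φ.Adj e e' → ∃ k : ℤ, -Real.log (M.ratio e) = θ e - θ e' + k * a) (e : E) :
    LatticeGaps a (Φ.branch e) := by
  obtain ⟨c, hc, -, hcr⟩ := M.exists_le_ratio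
  obtain ⟨D, hD, hX⟩ := Φ.exists_diam_X_le
  have hDlen : ∀ e, ∀ p ∈ gaps (Φ.branch e), p.2 - p.1 ≤ D := fun e p hp =>
    (le_abs_self _).trans (hX _ _ (branch_subset_X e hp.2.1) _ (branch_subset_X e hp.1))
  set P : Set ℝ := ⋃ e : E, ⋃ i : E, ⋃ j : E,
    {Real.log (M.ratio e) + Real.log (sInf (Φ.branch j) - sSup (Φ.branch i)) + θ e} with hP
  have hPf : P.Finite := finite_iUnion fun e => finite_iUnion fun i => finite_iUnion fun j =>
    finite_singleton _
  -- The induction starts at scales ε ≥ D + 1, where the claim is void because no gap is longer than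
  -- D.
  have key : ∀ e ε, 0 < ε → ε ≤ (D + 1) / c → ∀ p ∈ gaps (Φ.branch e), ε ≤ p.2 - p.1 →
      ∃ d ∈ P, ∃ k : ℤ, Real.log (p.2 - p.1) + θ e = d + k * a := by
    refine M.scale_induction (by positivity) hc ?_ hcr ?_
    · intro e ε h1 _ p hp hle
      rw [mul_div_cancel₀ _ hc.ne'] at h1
      linarith [hDlen e p hp]
    · intro e ε hε ih p hp hle
      rw [M.branch_eq e] at hp
      obtain ⟨q, hq, hlen⟩ := exists_gap_of_mem_gaps_image_affine (M.slope_ne_zero e) hp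
      change p.2 - p.1 = M.ratio e * (q.2 - q.1) at hlen
      have hq0 : 0 < q.2 - q.1 := sub_pos.2 hq.2.2.1
      have hlog : Real.log (p.2 - p.1) = Real.log (M.ratio e) + Real.log (q.2 - q.1) := by
        rw [hlen, Real.log_mul (M.ratio_pos e).ne' hq0.ne']
      rcases (M.nonOverlapping_branch (Φ.succs e)).mem_gaps_or_eq hq with
        ⟨i, hi, hqi⟩ | ⟨i, hi, j, hj, rfl⟩
      · have hle' : ε / M.ratio e ≤ q.2 - q.1 := by
          rw [div_le_iff₀ (M.ratio_pos e), mul_comm, ← hlen]; exact hle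
        obtain ⟨d, hd, k, hk⟩ := ih i q hqi hle'
        obtain ⟨k', hk'⟩ := h e i (mem_succs.1 hi)
        refine ⟨d, hd, k - k', ?_⟩
        push_cast
        linarith
      · refine ⟨_, mem_iUnion.2 ⟨e, mem_iUnion.2 ⟨i, mem_iUnion.2 ⟨j, rfl⟩⟩⟩, 0, ?_⟩
        rw [hlog]
        push_cast
        ring
  refine ⟨(fun d => d - θ e) '' P, hPf.image _, fun p hp => ?_⟩
  have hlen : 0 < p.2 - p.1 := sub_pos.2 hp.2.2.1
  obtain ⟨d, hd, k, hk⟩ := key e (min (p.2 - p.1) ((D + 1) / c))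
    (lt_min hlen (by positivity)) (min_le_right _ _) p hp (min_le_left _ _)
  exact ⟨_, mem_image_of_mem _ hd, k, by linarith⟩

/-! ### Finite unions of cylinder images -/

theorem initialWord_prefix (ω : Φ.Words) {k m : ℕ} (h : k ≤ m) :
    Φ.initialWord ω k <+: Φ.initialWord ω m := by
  have : Φ.initialWord ω k = (Φ.initialWord ω m).take k := by
    rw [initialWord, initialWord, ← List.map_take, List.take_range, min_eq_left h]
  rw [this]
  exact List.take_prefix _ _

theorem initialWord_eq_of_mem_cylinder {u : List E} {ω : Φ.Words} (h : ω ∈ Φ.cylinder u) :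
    Φ.initialWord ω u.length = u := by
  induction u generalizing ω with
  | nil => simp [initialWord]
  | cons e u ih =>
    obtain ⟨h0, h1⟩ := Φ.mem_cylinder_cons.1 h
    rw [List.length_cons, initialWord_succ, h0, ih h1]

theorem cylinder_subset_of_prefix {u w : List E} (h : u <+: w) : Φ.cylinder w ⊆ Φ.cylinder u := by
  obtain ⟨t, rfl⟩ := h
  intro ω hω k
  have := hω ⟨k, by simp; omega⟩
  simpa using this

/-- A finite union of cylinder images can be written with words of the same positive length. -/
theorem exists_words_same_length {S : Finset (List E)} :
    ∃ (S' : Finset (List E)) (m : ℕ), (∀ u ∈ S', u.length = m + 1 ∧ Φ.IsAdmissible u) ∧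
      ⋃ u ∈ S, Φ.code '' Φ.cylinder u = ⋃ u ∈ S', Φ.code '' Φ.cylinder u := by
  classical
  -- Words are extended to length m + 1, not m: the empty word may occur in `S`, and only for
  -- non-empty words is the image of the cylinder an affine copy of a branch.
  set m := S.sup List.length with hm
  have hfin := List.finite_length_eq E (m + 1)
  refine ⟨hfin.toFinset.filter fun w => Φ.IsAdmissible w ∧ ∃ u ∈ S, u <+: w, m,
    fun u hu => ?_, Subset.antisymm ?_ ?_⟩
  · rw [Finset.mem_filter, Finite.mem_toFinset] at hu
    exact ⟨hu.1, hu.2.1⟩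
  · refine iUnion₂_subset fun u hu => ?_
    rintro _ ⟨ω, hω, rfl⟩
    have hle : u.length ≤ m + 1 := (Finset.le_sup (f := List.length) hu).trans (Nat.le_succ m)
    refine mem_iUnion₂.2 ⟨Φ.initialWord ω (m + 1), ?_,
      mem_image_of_mem _ (Φ.mem_cylinder_initialWord ω _)⟩
    rw [Finset.mem_filter, Finite.mem_toFinset]
    refine ⟨by simp [initialWord], Φ.isAdmissible_initialWord ω _, u, hu, ?_⟩
    conv_lhs => rw [← initialWord_eq_of_mem_cylinder hω]
    exact initialWord_prefix ω hle
  · refine iUnion₂_subset fun w hw => ?_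
    rw [Finset.mem_filter] at hw
    obtain ⟨-, -, u, hu, hpre⟩ := hw
    exact (image_mono (cylinder_subset_of_prefix hpre)).trans
      (subset_biUnion_of_mem (u := fun u => Φ.code '' Φ.cylinder u) hu)

end ConformalGDS

/-! ### Localisation to a Borel set and oscillation of the curvatures -/

/-- Near a boundary point of the neighbourhood of F ∩ B, a point of F that is ε-close to a nearby
point is within 3ε of F ∩ B. The hypothesis at scale 3ε then places it in B, so that F and F ∩ B
have the same ε-neighbourhoods locally. -/
theorem frontier_cthickening_inter_eq {F B : Set ℝ} (hF : IsCompact F)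
    (hY : IsCompact (F ∩ B))
    (h : ∀ᶠ ε : ℝ in 𝓝[>] 0, Metric.cthickening ε F ∩ B = Metric.cthickening ε (F ∩ B)) :
    ∀ᶠ ε : ℝ in 𝓝[>] 0, frontier (Metric.cthickening ε F) ∩ B =
      frontier (Metric.cthickening ε (F ∩ B)) := by
  have h3 := (tendsto_const_mul_nhdsGT_zero (show (0 : ℝ) < 3 by norm_num) tendsto_id).eventually h
  filter_upwards [h, h3, self_mem_nhdsWithin] with ε h h3 hε
  have hε : 0 < ε := hε
  have hsub : Metric.cthickening ε (F ∩ B) ⊆ Metric.cthickening ε F :=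
    Metric.cthickening_subset_of_subset _ inter_subset_left
  rw [Metric.isClosed_cthickening.frontier_eq, Metric.isClosed_cthickening.frontier_eq]
  ext x
  constructor
  · rintro ⟨⟨h1, h2⟩, hB⟩
    exact ⟨h ▸ ⟨h1, hB⟩, fun h' => h2 (interior_mono hsub h')⟩
  · rintro ⟨h1, h2⟩
    have h1' := h1
    rw [← h] at h1'
    refine ⟨⟨h1'.1, fun h' => h2 ?_⟩, h1'.2⟩
    rw [mem_interior_iff_mem_nhds] at h' ⊢
    filter_upwards [h', Metric.ball_mem_nhds x hε] with y hy hyx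
    rw [mem_cthickening_iff_of_isCompact hF hε.le] at hy
    rw [mem_cthickening_iff_of_isCompact hY hε.le] at h1 ⊢
    obtain ⟨f, hf, hyf⟩ := hy
    obtain ⟨g, hg, hxg⟩ := h1
    refine ⟨f, ⟨hf, ?_⟩, hyf⟩
    rw [Metric.mem_ball, Real.dist_eq] at hyx
    have hfg : |f - g| ≤ 3 * ε := by
      rw [abs_le] at hyf hxg ⊢
      rw [abs_lt] at hyx
      constructor <;> linarith [hyf.1, hyf.2, hxg.1, hxg.2, hyx.1, hyx.2]
    have : f ∈ Metric.cthickening (3 * ε) (F ∩ B) :=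
      (mem_cthickening_iff_of_isCompact hY (by positivity)).2 ⟨g, hg, hfg⟩
    rw [id_eq] at h3
    rw [← h3] at this
    exact this.2

/-- The exponents are those of F, while the curvatures on B are those of F ∩ B. They fit together
because both sets have gap growth with the same δ. -/
theorem fractalCurvature_oscillates {F B : Set ℝ} {δ : ℝ} (hδ : 0 < δ) (hδ1 : δ < 1)
    (hF : IsCompact F) (hFne : F.Nonempty) (hFg : GapGrowth F δ) (hY : IsCompact (F ∩ B))
    (hYne : (F ∩ B).Nonempty) (hYg : GapGrowth (F ∩ B) δ) (hosc : HasEmptyScales (F ∩ B))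
    (h : ∀ᶠ ε : ℝ in 𝓝[>] 0, Metric.cthickening ε F ∩ B = Metric.cthickening ε (F ∩ B))
    (k : Fin 2) : 0 < lowerFractalCurvature k F B ∧
      lowerFractalCurvature k F B < upperFractalCurvature k F B ∧
      upperFractalCurvature k F B < ⊤ := by
  obtain ⟨g, c, C, hc, hbd, hg, heq⟩ : ∃ (g : ℝ → ℝ) (c C : ℝ), 0 < c ∧
      (∀ᶠ ε in 𝓝[>] 0, c ≤ g ε ∧ g ε ≤ C) ∧ (∀ ℓ, ¬ Tendsto g (𝓝[>] 0) (𝓝 ℓ)) ∧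
      rescaledCurvature k F B =ᶠ[𝓝[>] 0] fun ε => ENNReal.ofReal (g ε) := by
    fin_cases k
    · obtain ⟨c, C, hc, hev⟩ := hYg.rescaled_count
      refine ⟨_, c, C, hc, hev, hosc.not_tendsto_count hδ hYg, ?_⟩
      filter_upwards [frontier_cthickening_inter_eq hF hY h, self_mem_nhdsWithin] with ε hε hε0
      simp only [rescaledCurvature, Fin.zero_eta, if_true, rescaledCurvature0]
      rw [hFg.scalingExponent0_eq hF hFne, hε, mul_div_assoc,
        count_frontier_div_two hY hYne hε0,
        ENNReal.ofReal_mul (Real.rpow_pos_of_pos (mem_Ioi.1 hε0) δ).le]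
    · obtain ⟨c, C, hc, hev⟩ := hYg.rescaled_volume hY
      refine ⟨_, c, C, hc, hev, hosc.not_tendsto_volume hδ hδ1 hY hYne hYg, ?_⟩
      filter_upwards [h, self_mem_nhdsWithin] with ε hε hε0
      simp only [rescaledCurvature, Fin.mk_one, one_ne_zero, if_false, rescaledCurvature1]
      rw [hFg.scalingExponent1_eq hF, hε, ofReal_rpow_mul_volume hY hε0]
  rw [lowerFractalCurvature, upperFractalCurvature, liminf_congr heq, limsup_congr heq]
  exact liminf_lt_limsup_ofReal hc hbd hg

/-! ### Eigenmeasure and eigenfunction of the Perron-Frobenius operator -/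

/-- A continuous linear functional on a compact space that is positive on strictly positive
functions and maps `1` to `1` is the integral with respect to a probability measure. -/
theorem exists_isProbabilityMeasure_of_positive {X : Type*} [TopologicalSpace X] [CompactSpace X]
    [T2Space X] [MeasurableSpace X] [BorelSpace X] (Λ : C(X, ℝ) →L[ℝ] ℝ) (h1 : Λ 1 = 1)
    (hpos : ∀ f : C(X, ℝ), (∀ x, 0 < f x) → 0 ≤ Λ f) :
    ∃ ν : Measure X, IsProbabilityMeasure ν ∧ ∀ f : C(X, ℝ), ∫ x, f x ∂ν = Λ f := by
  have hnn : ∀ f : C(X, ℝ), (∀ x, 0 ≤ f x) → 0 ≤ Λ f := by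
    intro f hf
    refine le_of_forall_pos_le_add fun ε hε => ?_
    have := hpos (f + ε • 1) fun x => by
      simpa using add_pos_of_nonneg_of_pos (hf x) hε
    rwa [map_add, map_smul, h1, smul_eq_mul, mul_one] at this
  -- On a compact space every continuous function has compact support, so the Riesz-Markov-Kakutani
  -- theorem applies.
  let L : CompactlySupportedContinuousMap X ℝ →ₗ[ℝ] ℝ :=
    { toFun := fun f => Λ f.toContinuousMap
      map_add' := fun f g => map_add Λ f.toContinuousMap g.toContinuousMap
      map_smul' := fun c f => map_smul Λ c f.toContinuousMap }
  let P : CompactlySupportedContinuousMap X ℝ →ₚ[ℝ] ℝ :=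
    PositiveLinearMap.mk₀ L fun f hf => hnn _ fun x => hf x
  have hint : ∀ f : C(X, ℝ), ∫ x, f x ∂(RealRMK.rieszMeasure P) = Λ f := fun f =>
    RealRMK.integral_rieszMeasure P (CompactlySupportedContinuousMap.continuousMapEquiv f)
  have hfin : IsFiniteMeasure (RealRMK.rieszMeasure P) := by
    have : (RealRMK.rieszMeasure P).Regular := by infer_instance
    infer_instance
  refine ⟨RealRMK.rieszMeasure P, ⟨?_⟩, hint⟩
  have h := hint 1
  simp only [ContinuousMap.one_apply, integral_const, smul_eq_mul, mul_one, h1] at h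
  rw [Measure.real, ENNReal.toReal_eq_one_iff] at h
  exact h

namespace ConformalGDS

variable {V E : Type*} [Fintype V] [Fintype E] {Φ : ConformalGDS V E}

/-! ### The Perron-Frobenius operator -/

open Classical in
/-- The word `ω` preceded by `e`, or `ω` itself if `e` cannot precede `ω`. -/
noncomputable def prepend (e : E) (ω : Φ.Words) : Φ.Words :=
  if h : Φ.Adj e (ω.1 0) then Φ.cons e ω h else ω

theorem prepend_of_adj {e : E} {ω : Φ.Words} (h : Φ.Adj e (ω.1 0)) :
    prepend e ω = Φ.cons e ω h := dif_pos h

theorem continuous_prepend (e : E) : Continuous (prepend (Φ := Φ) e) := by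
  refine Φ.continuous_words_iff.2 fun k f => ?_
  have : {ω : Φ.Words | (prepend e ω).1 k = f} =
      ({ω | Φ.Adj e (ω.1 0)} ∩ {ω | if k = 0 then e = f else ω.1 (k - 1) = f}) ∪
        ({ω | ¬ Φ.Adj e (ω.1 0)} ∩ {ω | ω.1 k = f}) := by
    ext ω
    by_cases h : Φ.Adj e (ω.1 0)
    · cases k <;> simp [h, prepend_of_adj h]
    · simp [h, prepend]
  rw [this]
  refine ((Φ.isOpen_coord 0 fun e' => Φ.Adj e e').inter ?_).union
    ((Φ.isOpen_coord 0 fun e' => ¬ Φ.Adj e e').inter (Φ.isOpen_coord k fun e' => e' = f))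
  by_cases hk : k = 0
  · simp [hk]
  · simpa [hk] using Φ.isOpen_coord (k - 1) fun e' => e' = f

namespace AffineModel

variable (M : Φ.AffineModel)

theorem weight_of_adj (δ : ℝ) {e f : E} (h : Φ.Adj e f) : M.weight δ e f = M.ratio e ^ δ := by
  rw [weight, Φ.incidence_eq_one_iff.2 h, Nat.cast_one, mul_one]

theorem weight_of_not_adj (δ : ℝ) {e f : E} (h : ¬ Φ.Adj e f) : M.weight δ e f = 0 := by
  have : Φ.incidence e f = 0 := by simpa [incidence, Adj] using h
  rw [weight, this, Nat.cast_zero, mul_zero]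

theorem weight_nonneg (δ : ℝ) (e f : E) : 0 ≤ M.weight δ e f :=
  mul_nonneg (Real.rpow_pos_of_pos (M.ratio_pos e) δ).le (Nat.cast_nonneg _)

/-- Edges that cannot precede ω have weight zero, so the default value of `prepend` plays no role
and the sum may run over all edges. -/
theorem perronFrobenius_eq (δ : ℝ) (ψ : Φ.Words → ℝ) (ω : Φ.Words) :
    Φ.perronFrobenius (fun ω => -δ * Φ.geometricPotential ω) ψ ω =
      ∑ e, M.weight δ e (ω.1 0) * ψ (prepend e ω) := by
  classical
  have hset : {u | Φ.shift u = ω} =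
      (fun e => prepend e ω) '' (Finset.univ.filter fun e => Φ.Adj e (ω.1 0) : Finset E) := by
    ext u
    simp only [mem_ofPred_eq, mem_image, Finset.coe_filter, Finset.mem_univ, true_and]
    constructor
    · rintro rfl
      refine ⟨u.1 0, u.adj 0, ?_⟩
      rw [prepend_of_adj (ω := Φ.shift u) (u.adj 0)]
      exact Φ.words_ext rfl rfl
    · rintro ⟨e, he, rfl⟩
      rw [prepend_of_adj he, shift_cons]
  have hval : ∀ e, Φ.Adj e (ω.1 0) → (prepend e ω).1 0 = e := fun e he => by
    rw [prepend_of_adj he, cons_zero]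
  have hinj : InjOn (fun e => prepend e ω)
      (Finset.univ.filter fun e => Φ.Adj e (ω.1 0) : Finset E) := by
    intro e he f hf h
    simp only [Finset.coe_filter, Finset.mem_univ, true_and, mem_ofPred_eq] at he hf
    rw [← hval e he, ← hval f hf]
    exact congrArg (fun u : Φ.Words => u.1 0) h
  rw [perronFrobenius, hset, finsum_mem_image hinj, finsum_mem_coe_finset, Finset.sum_filter]
  refine Finset.sum_congr rfl fun e _ => ?_
  split_ifs with he
  · rw [M.geometricPotential_eq, hval e he, M.weight_of_adj δ he, neg_mul_neg,
      Real.rpow_def_of_pos (M.ratio_pos e), mul_comm δ]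
  · rw [M.weight_of_not_adj δ he, zero_mul]

/-- The Perron-Frobenius operator as a linear map on the space of continuous functions. -/
noncomputable def transfer (δ : ℝ) : C(Φ.Words, ℝ) →ₗ[ℝ] C(Φ.Words, ℝ) where
  toFun ψ := ⟨fun ω => ∑ e, M.weight δ e (ω.1 0) * ψ (prepend e ω),
    continuous_finsetSum _ fun e _ => (Φ.continuous_of_coord 0 (M.weight δ e)).mul
      (ψ.continuous.comp (continuous_prepend e))⟩
  map_add' ψ χ := by
    ext ω
    simp [mul_add, Finset.sum_add_distrib]
  map_smul' c ψ := by
    ext ω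
    simp only [ContinuousMap.smul_apply, ContinuousMap.coe_mk, smul_eq_mul, RingHom.id_apply,
      Finset.mul_sum]
    exact Finset.sum_congr rfl fun e _ => by ring

theorem transfer_apply (δ : ℝ) (ψ : C(Φ.Words, ℝ)) (ω : Φ.Words) :
    M.transfer δ ψ ω = ∑ e, M.weight δ e (ω.1 0) * ψ (prepend e ω) := rfl

theorem perronFrobenius_eq_transfer (δ : ℝ) (ψ : C(Φ.Words, ℝ)) (ω : Φ.Words) :
    Φ.perronFrobenius (fun ω => -δ * Φ.geometricPotential ω) ψ ω = M.transfer δ ψ ω :=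
  M.perronFrobenius_eq δ ψ ω

/-- The continuous function on words that depends on the first letter only. -/
def firstLetter (F : E → ℝ) : C(Φ.Words, ℝ) := ⟨fun ω => F (ω.1 0), Φ.continuous_of_coord 0 F⟩

theorem transfer_firstLetter (δ : ℝ) (F : E → ℝ) :
    M.transfer δ (firstLetter F) = firstLetter ((M.weight δ).vecMul F) := by
  ext ω
  rw [transfer_apply]
  simp only [firstLetter, ContinuousMap.coe_mk, Matrix.vecMul, dotProduct]
  refine Finset.sum_congr rfl fun e _ => ?_
  by_cases h : Φ.Adj e (ω.1 0)
  · rw [prepend_of_adj h, cons_zero, mul_comm]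
  · rw [M.weight_of_not_adj δ h, zero_mul, mul_zero]

theorem transfer_mono (δ : ℝ) {ψ χ : C(Φ.Words, ℝ)} (h : ∀ ω, ψ ω ≤ χ ω) (ω : Φ.Words) :
    M.transfer δ ψ ω ≤ M.transfer δ χ ω := by
  rw [transfer_apply, transfer_apply]
  exact Finset.sum_le_sum fun e _ => mul_le_mul_of_nonneg_left (h _) (M.weight_nonneg δ _ _)

/-- Existence of the eigenmeasure of the dual operator. -/
theorem exists_isEigenmeasure (δ : ℝ) [Nonempty Φ.Words] {h : C(Φ.Words, ℝ)} (hpos : ∀ ω, 0 < h ω)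
    (hh : M.transfer δ h = h) :
    ∃ ν, Φ.IsEigenmeasure (fun ω => -δ * Φ.geometricPotential ω) 1 ν := by
  set T : C(Φ.Words, ℝ) →ₗ[ℝ] C(Φ.Words, ℝ) := M.transfer δ - LinearMap.id with hT
  set s : Set C(Φ.Words, ℝ) := {f | MapsTo f univ (Ioi 0)} with hs
  have hsmem : ∀ f : C(Φ.Words, ℝ), f ∈ s ↔ ∀ ω, 0 < f ω := fun f => by
    simp [hs, MapsTo]
  have hso : IsOpen s := ContinuousMap.isOpen_setOfPred_mapsTo isCompact_univ isOpen_Ioi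
  have hsc : Convex ℝ s := by
    intro f hf g hg a b ha hb hab
    rw [hsmem] at hf hg ⊢
    intro ω
    rcases ha.eq_or_lt with rfl | ha
    · have : b = 1 := by linarith
      simpa [this] using hg ω
    · simpa using add_pos_of_pos_of_nonneg (mul_pos ha (hf ω)) (mul_nonneg hb (hg ω).le)
  -- At a maximum of ψ / h, monotonicity and the fixed function h give that the transfer of ψ is at
  -- most ψ; so the range of `T` contains no strictly positive function.
  have hdis : Disjoint s (LinearMap.range T : Set C(Φ.Words, ℝ)) := by
    rw [Set.disjoint_left]
    rintro _ hf ⟨ψ, rfl⟩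
    rw [hsmem] at hf
    have hc : Continuous fun ω => ψ ω / h ω :=
      ψ.continuous.div h.continuous fun ω => (hpos ω).ne'
    obtain ⟨ω₀, -, hmax⟩ := isCompact_univ.exists_isMaxOn univ_nonempty hc.continuousOn
    have h1 : ∀ ω, ψ ω ≤ ((ψ ω₀ / h ω₀) • h) ω := fun ω => by
      have := hmax (mem_univ ω)
      simp only [mem_ofPred_eq] at this
      exact (div_le_iff₀ (hpos ω)).1 this
    have h2 := M.transfer_mono δ h1 ω₀
    rw [map_smul, hh, ContinuousMap.smul_apply, smul_eq_mul, div_mul_cancel₀ _ (hpos ω₀).ne'] at h2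
    have h3 := hf ω₀
    simp only [hT, LinearMap.sub_apply, LinearMap.id_apply, ContinuousMap.sub_apply] at h3
    linarith
  -- A functional bounded below on a subspace vanishes there. The separating functional is therefore
  -- invariant; it is negative on positive functions, and division by f 1 < 0 makes it positive and
  -- normalised.
  obtain ⟨f, u, hfs, hft⟩ := geometric_hahn_banach_open hsc hso
    (LinearMap.range T).convex hdis
  have hu : u ≤ 0 := by simpa using hft 0 (LinearMap.range T).zero_mem
  have hf0 : ∀ b ∈ LinearMap.range T, f b = 0 := by
    intro b hb
    by_contra hne
    have := hft (((u - 1) / f b) • b) ((LinearMap.range T).smul_mem _ hb)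
    rw [map_smul, smul_eq_mul, div_mul_cancel₀ _ hne] at this
    linarith
  have hf1 : f 1 < 0 := (hfs 1 ((hsmem 1).2 fun ω => by simp)).trans_le hu
  obtain ⟨ν, hν, hint⟩ := exists_isProbabilityMeasure_of_positive ((f 1)⁻¹ • f)
    (by simp [hf1.ne]) (fun g hg => by
      have := (hfs g ((hsmem g).2 hg)).trans_le hu
      exact mul_nonneg_of_nonpos_of_nonpos (inv_nonpos.2 hf1.le) this.le)
  refine ⟨ν, hν, fun ψ => ?_⟩
  simp only [M.perronFrobenius_eq_transfer]
  rw [hint, hint, one_mul]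
  have h4 := hf0 (T ψ) ⟨ψ, rfl⟩
  rw [hT, LinearMap.sub_apply, LinearMap.id_apply, map_sub, sub_eq_zero] at h4
  simp [h4]

open Classical in
/-- The eigenmeasure of the first level cylinders is the normalised fixed vector. -/
theorem integral_firstLetter_of_isEigenmeasure [Nonempty E] (hA : Φ.AperiodicIrreducible) {δ : ℝ}
    {q : E → ℝ} (hq : ∀ e, 0 < q e) (hq1 : (M.weight δ).mulVec q = q) (hqs : ∑ e, q e = 1)
    {ν : Measure Φ.Words} (hν : Φ.IsEigenmeasure (fun ω => -δ * Φ.geometricPotential ω) 1 ν)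
    (F : E → ℝ) : ∫ ω, firstLetter (Φ := Φ) F ω ∂ν = F ⬝ᵥ q := by
  obtain ⟨hprob, hν⟩ := hν
  have hint : ∀ f : C(Φ.Words, ℝ), Integrable f ν := fun f =>
    f.continuous.integrable_of_hasCompactSupport (HasCompactSupport.of_compactSpace f)
  set m : E → ℝ := fun e => ∫ ω, firstLetter (Φ := Φ) (Pi.single e 1) ω ∂ν with hm
  have hF : ∀ F : E → ℝ, ∫ ω, firstLetter (Φ := Φ) F ω ∂ν = F ⬝ᵥ m := by
    intro F
    have : ∀ ω, firstLetter (Φ := Φ) F ω =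
        ∑ e, F e * firstLetter (Φ := Φ) (Pi.single e 1) ω := by
      intro ω
      simp [firstLetter, Pi.single_apply]
    simp only [this]
    rw [integral_finsetSum _ fun e _ => (hint _).const_mul _]
    simp only [integral_const_mul, hm, dotProduct]
  -- Duality tested on the indicator of a first letter makes the vector of cylinder masses a fixed
  -- column vector, hence a multiple of q.
  have hmfix : (M.weight δ).mulVec m = m := by
    funext e
    have h := hν (firstLetter (Pi.single e 1))
    simp only [M.perronFrobenius_eq_transfer] at h
    rw [M.transfer_firstLetter, hF, one_mul, ← Matrix.dotProduct_mulVec] at h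
    rw [single_one_dotProduct] at h
    exact h
  have hmsum : ∑ e, m e = 1 := by
    have h := hF 1
    simpa [firstLetter, dotProduct] using h.symm
  obtain ⟨n, -, hn⟩ := id hA
  have hBn : ∀ i j, 0 < (M.weight δ ^ n) i j := fun i j =>
    (pow_pos_of_pos_imp_pos (M.weight_nonneg δ) (fun i j h => by
      rw [M.weight_of_adj δ (Φ.incidence_pos_iff.1 h)]
      exact Real.rpow_pos_of_pos (M.ratio_pos i) δ) n i j).2 (hn i j)
  obtain ⟨t, ht⟩ := eq_smul_of_mulVec_eq_self hBn hq hq1 hmfix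
  have ht1 : t = 1 := by
    rw [ht] at hmsum
    simpa [← Finset.mul_sum, hqs] using hmsum
  rw [hF, ht, ht1, one_smul]

/-- A nonnegative continuous fixed function of the transfer operator that has a zero vanishes. -/
theorem eq_zero_of_transfer_eq_self (hA : Φ.AperiodicIrreducible) {δ : ℝ} {g : C(Φ.Words, ℝ)}
    (hg : ∀ ω, 0 ≤ g ω) (hfix : M.transfer δ g = g) {ω₀ : Φ.Words} (h0 : g ω₀ = 0) : g = 0 := by
  -- The value at a word is a sum of nonnegative terms over its preimages, so a zero passes to all
  -- of them; the iterated preimages of one word are dense.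
  have hstep : ∀ u, g (Φ.shift u) = 0 → g u = 0 := by
    intro u hu
    rw [← hfix, transfer_apply] at hu
    have h1 := (Finset.sum_eq_zero_iff_of_nonneg
      (fun e _ => mul_nonneg (M.weight_nonneg δ _ _) (hg _))).1 hu (u.1 0) (Finset.mem_univ _)
    have hadj : Φ.Adj (u.1 0) ((Φ.shift u).1 0) := u.adj 0
    rw [M.weight_of_adj δ hadj, prepend_of_adj hadj] at h1
    have h2 : Φ.cons (u.1 0) (Φ.shift u) hadj = u := Φ.words_ext rfl rfl
    rw [h2] at h1
    exact (mul_eq_zero.1 h1).resolve_left (Real.rpow_pos_of_pos (M.ratio_pos _) δ).ne'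
  have hiter : ∀ k u, g (Φ.shift^[k] u) = 0 → g u = 0 := by
    intro k
    induction k with
    | zero => exact fun u hu => hu
    | succ k ih => exact fun u hu => hstep u (ih _ hu)
  ext ω
  by_contra hne
  obtain ⟨N, hN⟩ := Φ.exists_agree_subset_of_mem_nhds
    ((isOpen_ne_fun g.continuous continuous_const).mem_nhds (show ω ∈ {ω | g ω ≠ 0} from hne))
  obtain ⟨u, k, hu, hk⟩ := hA.exists_shift_iterate_eq ω₀ N ω
  exact hN u hu (hiter k u (by rw [hk, h0]))

/-- Subtracting from g the smallest value of g / h times h leaves a nonnegative fixed function with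
a zero. -/
theorem exists_smul_eq_of_transfer_eq_self (hA : Φ.AperiodicIrreducible) [Nonempty Φ.Words]
    {δ : ℝ} {g h : C(Φ.Words, ℝ)} (hpos : ∀ ω, 0 < h ω) (hh : M.transfer δ h = h)
    (hg : M.transfer δ g = g) : ∃ t : ℝ, g = t • h := by
  have hc : Continuous fun ω => g ω / h ω :=
    g.continuous.div h.continuous fun ω => (hpos ω).ne'
  obtain ⟨ω₀, -, hmin⟩ := isCompact_univ.exists_isMinOn univ_nonempty hc.continuousOn
  refine ⟨g ω₀ / h ω₀, ?_⟩
  rw [← sub_eq_zero]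
  refine M.eq_zero_of_transfer_eq_self hA (δ := δ) (ω₀ := ω₀) (fun ω => ?_) ?_ ?_
  · have := hmin (mem_univ ω)
    simp only [mem_ofPred_eq] at this
    rw [le_div_iff₀ (hpos ω)] at this
    simpa using this
  · rw [map_sub, map_smul, hg, hh]
  · simp [div_mul_cancel₀ _ (hpos ω₀).ne']

/-- The normalised eigenfunction exists, is unique and is given by the fixed row vector. -/
theorem isPerronEigenfunction_iff [Nonempty E] (hA : Φ.AperiodicIrreducible) {δ : ℝ}
    {q H : E → ℝ} (hq : ∀ e, 0 < q e) (hq1 : (M.weight δ).mulVec q = q) (hqs : ∑ e, q e = 1)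
    (hH : ∀ e, 0 < H e) (hH1 : (M.weight δ).vecMul H = H) (hHq : H ⬝ᵥ q = 1)
    (h : C(Φ.Words, ℝ)) :
    Φ.IsPerronEigenfunction (fun ω => -δ * Φ.geometricPotential ω) h ↔ h = firstLetter H := by
  have hne : Nonempty Φ.Words := (hA.exists_word (Classical.arbitrary E)).nonempty
  have hHpos : ∀ ω, 0 < firstLetter (Φ := Φ) H ω := fun ω => hH _
  have hHfix : M.transfer δ (firstLetter H) = firstLetter H := by
    rw [M.transfer_firstLetter, hH1]
  constructor
  · rintro ⟨hpos, hfix, ν, hν, hint⟩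
    have hfix' : M.transfer δ h = h := by
      ext ω
      rw [← M.perronFrobenius_eq_transfer, hfix]
    obtain ⟨t, rfl⟩ := M.exists_smul_eq_of_transfer_eq_self hA hHpos hHfix hfix'
    have h1 := M.integral_firstLetter_of_isEigenmeasure hA hq hq1 hqs hν H
    simp only [ContinuousMap.smul_apply, smul_eq_mul, integral_const_mul] at hint
    rw [h1, hHq, mul_one] at hint
    rw [hint, one_smul]
  · rintro rfl
    obtain ⟨ν, hν⟩ := M.exists_isEigenmeasure δ hHpos hHfix
    refine ⟨hHpos, fun ω => ?_, ν, hν, ?_⟩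
    · rw [M.perronFrobenius_eq_transfer, hHfix]
    · rw [M.integral_firstLetter_of_isEigenmeasure hA hq hq1 hqs hν H, hHq]

end AffineModel

end ConformalGDS

/-! ### Components of the complement of finitely many intervals -/

theorem convexHull_eq_Icc {K : Set ℝ} (hK : IsCompact K) (hne : K.Nonempty) :
    convexHull ℝ K = Icc (sInf K) (sSup K) := by
  refine Subset.antisymm (convexHull_min (fun x hx => ⟨csInf_le hK.bddBelow hx,
    le_csSup hK.bddAbove hx⟩) (convex_Icc _ _)) ?_
  exact (convex_convexHull ℝ K).ordConnected.out (subset_convexHull ℝ K (hK.sInf_mem hne))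
    (subset_convexHull ℝ K (hK.sSup_mem hne))

/-- The convex hull of the union of the sets `K i`, `i ∈ I`, without their convex hulls. -/
def hullGap {ι : Type*} (I : Set ι) (K : ι → Set ℝ) : Set ℝ :=
  convexHull ℝ (⋃ i ∈ I, K i) \ ⋃ i ∈ I, convexHull ℝ (K i)

section HullGap

variable {ι : Type*} [Finite ι] {I : Set ι} {K : ι → Set ℝ}

theorem isCompact_biUnion_of_finite (hK : ∀ i ∈ I, IsCompact (K i)) :
    IsCompact (⋃ i ∈ I, K i) := (Set.toFinite I).isCompact_biUnion hK

theorem isClosed_biUnion_convexHull (hK : ∀ i ∈ I, IsCompact (K i))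
    (hne : ∀ i ∈ I, (K i).Nonempty) : IsClosed (⋃ i ∈ I, convexHull ℝ (K i)) :=
  (Set.toFinite I).isClosed_biUnion fun i hi => by
    rw [convexHull_eq_Icc (hK i hi) (hne i hi)]; exact isClosed_Icc

theorem isOpen_hullGap (hK : ∀ i ∈ I, IsCompact (K i)) (hne : ∀ i ∈ I, (K i).Nonempty) :
    IsOpen (hullGap I K) := by
  rcases I.eq_empty_or_nonempty with rfl | ⟨j, hj⟩
  · simp [hullGap]
  have hA := isCompact_biUnion_of_finite hK
  have hAne : (⋃ i ∈ I, K i).Nonempty := (hne j hj).mono (subset_biUnion_of_mem (u := K) hj)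
  have hsub : ⋃ i ∈ I, K i ⊆ ⋃ i ∈ I, convexHull ℝ (K i) :=
    iUnion₂_mono fun i _ => subset_convexHull ℝ (K i)
  have : hullGap I K = Ioo (sInf (⋃ i ∈ I, K i)) (sSup (⋃ i ∈ I, K i)) \
      ⋃ i ∈ I, convexHull ℝ (K i) := by
    rw [hullGap, convexHull_eq_Icc hA hAne]
    ext x
    refine ⟨fun ⟨h1, h2⟩ => ⟨⟨h1.1.lt_of_ne ?_, h1.2.lt_of_ne ?_⟩, h2⟩,
      fun ⟨h1, h2⟩ => ⟨Ioo_subset_Icc_self h1, h2⟩⟩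
    · rintro rfl; exact h2 (hsub (hA.sInf_mem hAne))
    · rintro rfl; exact h2 (hsub (hA.sSup_mem hAne))
  rw [this]
  exact isOpen_Ioo.sdiff (isClosed_biUnion_convexHull hK hne)

theorem hullGap_bounded (hK : ∀ i ∈ I, IsCompact (K i)) :
    Bornology.IsBounded (hullGap I K) :=
  (isBounded_convexHull.2 (isCompact_biUnion_of_finite hK).isBounded).subset sdiff_subset

/-- The right end of a component is the left end of one of the sets. -/
theorem exists_sSup_component_eq (hK : ∀ i ∈ I, IsCompact (K i)) (hne : ∀ i ∈ I, (K i).Nonempty)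
    {x : ℝ} (hx : x ∈ hullGap I K) :
    ∃ i ∈ I, sSup (connectedComponentIn (hullGap I K) x) = sInf (K i) := by
  set L := connectedComponentIn (hullGap I K) x with hL
  have hLsub : L ⊆ hullGap I K := connectedComponentIn_subset _ _
  have hxL : x ∈ L := mem_connectedComponentIn hx
  have hLb : BddAbove L := ((hullGap_bounded hK).subset hLsub).bddAbove
  have hLo : IsOpen L := (isOpen_hullGap hK hne).connectedComponentIn
  have hLc : IsPreconnected L := isPreconnected_connectedComponentIn
  have hsnot : sSup L ∉ L := fun h => by
    obtain ⟨ε, hε, hb⟩ := Metric.isOpen_iff.1 hLo _ h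
    have := le_csSup hLb (hb (show sSup L + ε / 2 ∈ Metric.ball (sSup L) ε by
      rw [Metric.mem_ball, Real.dist_eq, add_sub_cancel_left, abs_of_pos (by positivity)]
      linarith))
    linarith
  have hscl : sSup L ∈ closure L := csSup_mem_closure ⟨x, hxL⟩ hLb
  have hlt : ∀ y ∈ L, y < sSup L := fun y hy =>
    (le_csSup hLb hy).lt_of_ne fun h => hsnot (h ▸ hy)
  -- Otherwise the supremum would belong to the region and could be adjoined to the component, which
  -- is open and does not contain its supremum.
  have hmem : sSup L ∈ ⋃ i ∈ I, convexHull ℝ (K i) := by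
    by_contra hnot
    have hhull : sSup L ∈ convexHull ℝ (⋃ i ∈ I, K i) := by
      have hcl : IsClosed (convexHull ℝ (⋃ i ∈ I, K i)) := by
        rcases (⋃ i ∈ I, K i).eq_empty_or_nonempty with h | h
        · rw [h, convexHull_empty]; exact isClosed_empty
        · rw [convexHull_eq_Icc (isCompact_biUnion_of_finite hK) h]; exact isClosed_Icc
      exact closure_minimal (hLsub.trans sdiff_subset) hcl hscl
    have hsg : sSup L ∈ hullGap I K := ⟨hhull, hnot⟩
    have hpre : IsPreconnected (insert (sSup L) L) :=
      hLc.subset_closure (subset_insert _ _) (insert_subset hscl subset_closure)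
    exact hsnot (hpre.subset_connectedComponentIn (mem_insert_of_mem _ hxL)
      (insert_subset hsg hLsub) (mem_insert _ _))
  obtain ⟨i, hi, hsi⟩ := mem_iUnion₂.1 hmem
  refine ⟨i, hi, ?_⟩
  rw [convexHull_eq_Icc (hK i hi) (hne i hi)] at hsi
  refine le_antisymm (not_lt.1 fun h => ?_) hsi.1
  obtain ⟨y, hy, hyi⟩ := exists_lt_of_lt_csSup ⟨x, hxL⟩ h
  refine (hLsub hy).2 (mem_iUnion₂.2 ⟨i, hi, ?_⟩)
  rw [convexHull_eq_Icc (hK i hi) (hne i hi)]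
  exact ⟨hyi.le, (hlt y hy).le.trans hsi.2⟩

/-- A component is determined by its right end, and this is the minimum of one of finitely many
sets. -/
theorem finite_components_hullGap (hK : ∀ i ∈ I, IsCompact (K i))
    (hne : ∀ i ∈ I, (K i).Nonempty) :
    {L | ∃ x ∈ hullGap I K, L = connectedComponentIn (hullGap I K) x}.Finite := by
  refine Set.Finite.of_injOn (f := sSup) (t := (fun i => sInf (K i)) '' I) ?_ ?_
    ((Set.toFinite I).image _)
  · rintro _ ⟨x, hx, rfl⟩
    obtain ⟨i, hi, h⟩ := exists_sSup_component_eq hK hne hx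
    exact ⟨i, hi, h.symm⟩
  · have key : ∀ x ∈ hullGap I K, ∀ y ∈ hullGap I K,
        sSup (connectedComponentIn (hullGap I K) x) = sSup (connectedComponentIn (hullGap I K) y) →
        x ≤ y → connectedComponentIn (hullGap I K) x = connectedComponentIn (hullGap I K) y := by
      intro x hx y hy h hxy
      have hbd : ∀ z, BddAbove (connectedComponentIn (hullGap I K) z) := fun z =>
        ((hullGap_bounded hK).subset (connectedComponentIn_subset _ _)).bddAbove
      obtain ⟨i, hi, hsy⟩ := exists_sSup_component_eq hK hne hy
      have hylt : y < sSup (connectedComponentIn (hullGap I K) y) := by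
        refine (le_csSup (hbd y) (mem_connectedComponentIn hy)).lt_of_ne fun he => ?_
        refine hy.2 (mem_iUnion₂.2 ⟨i, hi, subset_convexHull ℝ (K i) ?_⟩)
        rw [he, hsy]
        exact (hK i hi).sInf_mem (hne i hi)
      rw [← h] at hylt
      obtain ⟨z, hz, hyz⟩ := exists_lt_of_lt_csSup ⟨x, mem_connectedComponentIn hx⟩ hylt
      refine connectedComponentIn_eq ?_
      exact isPreconnected_connectedComponentIn.ordConnected.out (mem_connectedComponentIn hx) hz
        ⟨hxy, hyz.le⟩
    rintro _ ⟨x, hx, rfl⟩ _ ⟨y, hy, rfl⟩ h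
    rcases le_total x y with hxy | hxy
    · exact key x hx y hy h hxy
    · exact (key y hy x hx h.symm hxy).symm

theorem diam_component_pos (hK : ∀ i ∈ I, IsCompact (K i)) (hne : ∀ i ∈ I, (K i).Nonempty)
    {x : ℝ} (hx : x ∈ hullGap I K) :
    0 < Metric.diam (connectedComponentIn (hullGap I K) x) := by
  have hLb := (hullGap_bounded hK).subset (connectedComponentIn_subset (hullGap I K) x)
  have hxL := mem_connectedComponentIn hx
  obtain ⟨ε, hε, hb⟩ := Metric.isOpen_iff.1 (isOpen_hullGap hK hne).connectedComponentIn x hxL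
  have hy : x + ε / 2 ∈ connectedComponentIn (hullGap I K) x := hb (by
    rw [Metric.mem_ball, Real.dist_eq, add_sub_cancel_left, abs_of_pos (by positivity)]
    linarith)
  have := Metric.dist_le_diam_of_mem hLb hy hxL
  rw [Real.dist_eq, add_sub_cancel_left, abs_of_pos (by positivity)] at this
  linarith

end HullGap

theorem diam_image_eq_mul {S : Set ℝ} (hS : Bornology.IsBounded S) {f : ℝ → ℝ} {c : ℝ} (hc : 0 < c)
    (hf : ∀ x ∈ S, ∀ y ∈ S, |f x - f y| = c * |x - y|) :
    Metric.diam (f '' S) = c * Metric.diam S := by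
  have h1 : ∀ x ∈ f '' S, ∀ y ∈ f '' S, dist x y ≤ c * Metric.diam S := by
    rintro _ ⟨x, hx, rfl⟩ _ ⟨y, hy, rfl⟩
    rw [Real.dist_eq, hf x hx y hy, ← Real.dist_eq]
    exact mul_le_mul_of_nonneg_left (Metric.dist_le_diam_of_mem hS hx hy) hc.le
  have hb : Bornology.IsBounded (f '' S) := Metric.isBounded_iff.2 ⟨_, fun x hx y hy => h1 x hx y hy⟩
  refine le_antisymm (Metric.diam_le_of_forall_dist_le
    (mul_nonneg hc.le Metric.diam_nonneg) h1) ?_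
  rw [mul_comm, ← le_div_iff₀ hc]
  refine Metric.diam_le_of_forall_dist_le (div_nonneg Metric.diam_nonneg hc.le) fun x hx y hy => ?_
  rw [le_div_iff₀ hc, mul_comm, Real.dist_eq, ← hf x hx y hy, ← Real.dist_eq]
  exact Metric.dist_le_diam_of_mem hb (mem_image_of_mem f hx) (mem_image_of_mem f hy)

namespace ConformalGDS

variable {V E : Type*} [Fintype V] [Fintype E] {Φ : ConformalGDS V E}

/-! ### Primary gaps -/

theorem gapRegion_eq_hullGap (v : V) :
    Φ.gapRegion v = hullGap {e | Φ.init e = v} Φ.branch := rfl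

theorem AperiodicIrreducible.finite_primaryGaps (hA : Φ.AperiodicIrreducible) (v : V) :
    (Φ.primaryGaps v).Finite :=
  finite_components_hullGap (fun e _ => isCompact_branch e) fun e _ => hA.branch_nonempty e

theorem AperiodicIrreducible.diam_primaryGap_pos (hA : Φ.AperiodicIrreducible) {v : V} {L : Set ℝ}
    (hL : L ∈ Φ.primaryGaps v) : 0 < Metric.diam L := by
  obtain ⟨x, hx, rfl⟩ := hL
  exact diam_component_pos (fun e _ => isCompact_branch e) (fun e _ => hA.branch_nonempty e) hx

theorem primaryGap_subset_X {v : V} {L : Set ℝ} (hL : L ∈ Φ.primaryGaps v) : L ⊆ Φ.X v := by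
  obtain ⟨x, hx, rfl⟩ := hL
  refine (connectedComponentIn_subset _ _).trans (sdiff_subset.trans
    (convexHull_min (iUnion₂_subset fun e he => ?_) (Φ.convex_X v)))
  have he : Φ.init e = v := he
  exact he ▸ branch_subset_X e

theorem primaryGaps_eq_empty {v : V} (hv : ¬ ∃ e, Φ.init e = v) : Φ.primaryGaps v = ∅ := by
  have hset : {e | Φ.init e = v} = (∅ : Set E) := eq_empty_of_forall_notMem fun e he => hv ⟨e, he⟩
  rw [eq_empty_iff_forall_notMem]
  rintro L ⟨x, hx, -⟩
  rw [gapRegion_eq_hullGap, hset] at hx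
  simp [hullGap] at hx

/-- Without primary gaps the hull of each branch is covered by images of hulls of branches.
Iteration makes every branch dense in its hull, hence equal to it, although as a nontrivial null set
it has a gap. -/
theorem AffineModel.exists_primaryGap (M : Φ.AffineModel) (hE : 2 ≤ Fintype.card E)
    (hA : Φ.AperiodicIrreducible) (hF : volume Φ.limitSet = 0) :
    ∃ v, (Φ.primaryGaps v).Nonempty := by
  by_contra! hno
  have hempty : ∀ v, Φ.gapRegion v = ∅ := fun v => by
    rw [eq_empty_iff_forall_notMem]
    intro x hx
    exact (hno v).le (show connectedComponentIn _ x ∈ Φ.primaryGaps v from ⟨x, hx, rfl⟩)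
  have hE' : Nonempty E := Fintype.card_pos_iff.1 (by omega)
  obtain ⟨D, hD, hX⟩ := Φ.exists_diam_X_le
  obtain ⟨f, hf⟩ := Finite.exists_max M.ratio
  have key : ∀ n : ℕ, ∀ e, ∀ x ∈ convexHull ℝ (Φ.branch e), ∃ y ∈ Φ.branch e,
      |x - y| ≤ M.ratio f ^ n * D := by
    intro n
    induction n with
    | zero =>
      intro e x hx
      obtain ⟨y, hy⟩ := hA.branch_nonempty e
      refine ⟨y, hy, ?_⟩
      rw [pow_zero, one_mul]
      exact hX _ _ (convexHull_min (branch_subset_X e) (Φ.convex_X _) hx) _ (branch_subset_X e hy)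
    | succ n ih =>
      intro e x hx
      have hsub : convexHull ℝ (Φ.branch e) ⊆
          M.map e '' convexHull ℝ (⋃ e' ∈ Φ.succs e, Φ.branch e') := by
        conv_lhs => rw [M.branch_eq e]
        exact convexHull_min (image_mono (subset_convexHull ℝ _))
          (M.convex_image_map e (convex_convexHull ℝ _))
      obtain ⟨z, hz, rfl⟩ := hsub hx
      have hz' : z ∈ ⋃ e' ∈ Φ.succs e, convexHull ℝ (Φ.branch e') := by
        by_contra hnot
        have hset : {e' | Φ.init e' = Φ.term e} = (Φ.succs e : Set E) := by
          ext e'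
          simp [Adj, eq_comm]
        have : z ∈ Φ.gapRegion (Φ.term e) := by
          rw [gapRegion_eq_hullGap, hset]
          exact ⟨by simpa using hz, by simpa using hnot⟩
        rw [hempty] at this
        exact this
      obtain ⟨e', he', hz'⟩ := mem_iUnion₂.1 hz'
      obtain ⟨y, hy, hle⟩ := ih e' z hz'
      refine ⟨M.map e y, ?_, ?_⟩
      · rw [M.branch_eq e]
        exact mem_image_of_mem _ (mem_iUnion₂.2 ⟨e', he', hy⟩)
      · rw [M.abs_map_sub, pow_succ', mul_assoc]
        exact mul_le_mul (hf e) hle (abs_nonneg _) (M.ratio_pos f).le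
  obtain ⟨e⟩ := hE'
  obtain ⟨p, hp⟩ := M.exists_gap_branch hE hA hF e
  obtain ⟨x, hx1, hx2⟩ := exists_between hp.2.2.1
  have hxh : x ∈ convexHull ℝ (Φ.branch e) :=
    (convex_convexHull ℝ _).ordConnected.out (subset_convexHull ℝ _ hp.1)
      (subset_convexHull ℝ _ hp.2.1) ⟨hx1.le, hx2.le⟩
  have hlim : Tendsto (fun n : ℕ => M.ratio f ^ n * D) atTop (𝓝 0) := by
    simpa using (tendsto_pow_atTop_nhds_zero_of_lt_one (M.ratio_pos f).le
      (M.ratio_lt_one f)).mul_const D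
  have hxb : x ∈ Φ.branch e := by
    rw [← (isCompact_branch e).isClosed.closure_eq, Metric.mem_closure_iff]
    intro ε hε
    obtain ⟨n, hn⟩ := (hlim.eventually (gt_mem_nhds hε)).exists
    obtain ⟨y, hy, hle⟩ := key n e x hxh
    exact ⟨y, hy, by rw [Real.dist_eq]; exact hle.trans_lt hn⟩
  rcases hp.2.2.2 x hxb with h | h <;> linarith

/-! ### Sums over image gaps -/

namespace AffineModel

variable (M : Φ.AffineModel)

/-- The contraction ratio of a word. -/
noncomputable def wordRatio (u : List E) : ℝ := (u.map M.ratio).prod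

theorem wordRatio_pos (u : List E) : 0 < M.wordRatio u :=
  List.prod_pos fun x hx => by
    obtain ⟨e, -, rfl⟩ := List.mem_map.1 hx
    exact M.ratio_pos e

theorem wordMap_similarity {u : List E} (hu : Φ.IsAdmissible u) {f : E} (hf : f ∈ u.getLast?) :
    (∀ x ∈ Φ.X (Φ.term f), ∀ y ∈ Φ.X (Φ.term f),
      |Φ.wordMap u x - Φ.wordMap u y| = M.wordRatio u * |x - y|) ∧
      ∀ g ∈ u.head?, MapsTo (Φ.wordMap u) (Φ.X (Φ.term f)) (Φ.X (Φ.init g)) := by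
  have hφ : ∀ e, ∀ x ∈ Φ.X (Φ.term e), ∀ y ∈ Φ.X (Φ.term e),
      |Φ.φ e x - Φ.φ e y| = M.ratio e * |x - y| := fun e x hx y hy => by
    rw [M.eq_affine e x hx, M.eq_affine e y hy]
    exact M.abs_map_sub e x y
  induction u with
  | nil => simp at hf
  | cons e u ih =>
    cases u with
    | nil =>
      obtain rfl : e = f := by simpa using hf
      refine ⟨fun x hx y hy => ?_, fun g hg => ?_⟩
      · simpa [wordMap, wordRatio] using hφ e x hx y hy
      · obtain rfl : e = g := by simpa using hg
        exact Φ.mapsTo e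
    | cons e' u =>
      have hadj := Φ.incidence_eq_one_iff.1 (List.isChain_cons_cons.1 hu).1
      obtain ⟨h1, h2⟩ := ih (List.isChain_cons_cons.1 hu).2 (by simpa using hf)
      have h3 : MapsTo (Φ.wordMap (e' :: u)) (Φ.X (Φ.term f)) (Φ.X (Φ.term e)) := by
        have := h2 e' rfl
        rwa [← hadj] at this
      refine ⟨fun x hx y hy => ?_, fun g hg => ?_⟩
      · have e1 : M.wordRatio (e :: e' :: u) = M.ratio e * M.wordRatio (e' :: u) := by
          simp [wordRatio]
        rw [e1, mul_assoc, ← h1 x hx y hy]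
        exact hφ e _ (h3 hx) _ (h3 hy)
      · obtain rfl : e = g := by simpa using hg
        exact (Φ.mapsTo e).comp h3

/-- The words of length `m` that can be followed by `e`. -/
def wordsBefore (Φ : ConformalGDS V E) (e : E) (m : ℕ) : Set (List E) :=
  {u | u.length = m ∧ Φ.IsAdmissible (u ++ [e])}

/-- The two sets differ at m = 0, where `wordsTo` is empty while `wordsBefore` contains the empty
word and can start an induction. -/
theorem wordsTo_eq_wordsBefore (e : E) {m : ℕ} (hm : 1 ≤ m) :
    Φ.wordsTo (Φ.init e) m = wordsBefore Φ e m := by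
  ext u
  simp only [wordsTo, wordsBefore, mem_ofPred_eq, IsAdmissible, List.isChain_append]
  refine and_congr_right fun hlen => and_congr_right fun _ => ?_
  have hne : u ≠ [] := fun h => by simp [h] at hlen; omega
  rw [List.getLast?_eq_getLast_of_ne_nil hne]
  simp [incidence]

theorem finite_wordsBefore (e : E) (m : ℕ) : (wordsBefore Φ e m).Finite :=
  (List.finite_length_eq E m).subset fun _ hu => hu.1

theorem wordsBefore_succ (e : E) (m : ℕ) : wordsBefore Φ e (m + 1) =
    ⋃ f ∈ {f | Φ.Adj f e}, (fun u => u ++ [f]) '' wordsBefore Φ f m := by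
  ext u
  simp only [wordsBefore, mem_ofPred_eq, mem_iUnion, mem_image, exists_prop]
  constructor
  · rintro ⟨hlen, hadm⟩
    have hne : u ≠ [] := fun h => by simp [h] at hlen
    have hu := List.dropLast_append_getLast hne
    refine ⟨u.getLast hne, ?_, u.dropLast, ⟨by simp [hlen], ?_⟩, hu⟩
    · have := (List.isChain_append.1 hadm).2.2 (u.getLast hne)
        (by rw [List.getLast?_eq_getLast_of_ne_nil hne]; rfl) e rfl
      exact Φ.incidence_eq_one_iff.1 this
    · rw [hu]; exact (List.isChain_append.1 hadm).1
  · rintro ⟨f, hf, w, ⟨hlen, hadm⟩, rfl⟩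
    refine ⟨by simp [hlen], List.isChain_append.2 ⟨hadm, by simp, ?_⟩⟩
    intro x hx y hy
    simp at hx hy
    subst hx hy
    exact Φ.incidence_eq_one_iff.2 hf

-- Removing the last letter of a word corresponds to removing the last factor of the matrix power.
open Classical in
theorem finsum_wordRatio_rpow (δ : ℝ) (e : E) (m : ℕ) :
    ∑ᶠ u ∈ wordsBefore Φ e m, M.wordRatio u ^ δ = Matrix.vecMul 1 (M.weight δ ^ m) e := by
  induction m generalizing e with
  | zero =>
    have : wordsBefore Φ e 0 = {[]} := by
      ext u
      simp only [wordsBefore, mem_ofPred_eq, mem_singleton_iff, List.length_eq_zero_iff]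
      refine ⟨fun h => h.1, ?_⟩
      rintro rfl
      exact ⟨rfl, by simp [IsAdmissible]⟩
    rw [this, finsum_mem_singleton]
    simp [wordRatio]
  | succ m ih =>
    have hinj : ∀ f : E, Function.Injective fun u : List E => u ++ [f] := fun f u w h =>
      List.append_cancel_right h
    rw [wordsBefore_succ, finsum_mem_biUnion _ (Set.toFinite _)
      (fun f _ => (finite_wordsBefore f m).image _)]
    · have h1 : ∀ f ∈ {f | Φ.Adj f e}, ∑ᶠ u ∈ (fun u => u ++ [f]) '' wordsBefore Φ f m,
          M.wordRatio u ^ δ = Matrix.vecMul 1 (M.weight δ ^ m) f * M.ratio f ^ δ := by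
        intro f _
        rw [finsum_mem_image (hinj f).injOn, ← ih, finsum_mem_mul]
        refine finsum_mem_congr rfl fun u _ => ?_
        rw [← Real.mul_rpow (M.wordRatio_pos u).le (M.ratio_pos f).le]
        simp [wordRatio]
      rw [finsum_mem_congr rfl h1]
      have h2 : {f | Φ.Adj f e} = (Finset.univ.filter fun f => Φ.Adj f e : Finset E) := by
        ext; simp
      rw [h2, finsum_mem_coe_finset, Finset.sum_filter, pow_succ, ← Matrix.vecMul_vecMul]
      refine Finset.sum_congr rfl fun f _ => ?_
      change _ = _ * M.weight δ f e
      split_ifs with h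
      · rw [M.weight_of_adj δ h]
      · rw [M.weight_of_not_adj δ h, mul_zero]
    · intro f _ g _ hfg
      change Disjoint _ _
      rw [Set.disjoint_left]
      rintro _ ⟨u, -, rfl⟩ ⟨w, -, h⟩
      have := (List.append_inj' h rfl).2
      simp at this
      exact hfg this.symm

open Classical in
theorem imageGapSum_eq {δ : ℝ} {ev : V → E}
    (hev : ∀ v, (∃ e, Φ.init e = v) → Φ.init (ev v) = v) {m : ℕ} (hm : 1 ≤ m) :
    Φ.imageGapSum δ m = ∑ v, ∑ᶠ L ∈ Φ.primaryGaps v,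
      Matrix.vecMul 1 (M.weight δ ^ m) (ev v) * Metric.diam L ^ δ := by
  refine Finset.sum_congr rfl fun v _ => finsum_mem_congr rfl fun L hL => ?_
  by_cases hv : ∃ e, Φ.init e = v
  · have hLX := primaryGap_subset_X hL
    have h1 : ∀ u ∈ Φ.wordsTo v m, Metric.diam (Φ.wordMap u '' L) ^ δ =
        M.wordRatio u ^ δ * Metric.diam L ^ δ := by
      rintro u ⟨-, hadm, f, hf, rfl⟩
      rw [diam_image_eq_mul ((Φ.isCompact_X _).isBounded.subset hLX) (M.wordRatio_pos u)
        (fun x hx y hy => (M.wordMap_similarity hadm hf).1 x (hLX hx) y (hLX hy)),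
        Real.mul_rpow (M.wordRatio_pos u).le Metric.diam_nonneg]
    have h2 : Φ.wordsTo v m = wordsBefore Φ (ev v) m := by
      rw [← wordsTo_eq_wordsBefore _ hm, hev v hv]
    rw [finsum_mem_congr rfl h1, h2, ← finsum_mem_mul,
      M.finsum_wordRatio_rpow]
  · rw [primaryGaps_eq_empty hv] at hL
    exact hL.elim

open Classical in
theorem tendsto_imageGapSum [Nonempty E] (hA : Φ.AperiodicIrreducible) {δ : ℝ}
    {q H : E → ℝ} (hq : ∀ e, 0 < q e) (hq1 : (M.weight δ).mulVec q = q) (hqs : ∑ e, q e = 1)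
    (hH : ∀ e, 0 < H e) (hH1 : (M.weight δ).vecMul H = H) (hHq : H ⬝ᵥ q = 1) {ev : V → E}
    (hev : ∀ v, (∃ e, Φ.init e = v) → Φ.init (ev v) = v) :
    Tendsto (fun m : ℕ => Φ.imageGapSum δ m) atTop
      (𝓝 (∑ v, ∑ᶠ L ∈ Φ.primaryGaps v, H (ev v) * Metric.diam L ^ δ)) := by
  obtain ⟨n, -, hn⟩ := id hA
  have hBn : ∀ i j, 0 < (M.weight δ ^ n) i j := fun i j =>
    (pow_pos_of_pos_imp_pos (M.weight_nonneg δ) (fun i j h => by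
      rw [M.weight_of_adj δ (Φ.incidence_pos_iff.1 h)]
      exact Real.rpow_pos_of_pos (M.ratio_pos i) δ) n i j).2 (hn i j)
  have ht := tendsto_vecMul_pow (M.weight_nonneg δ) hBn hq hq1 hH hH1 1
  have h1q : (1 : E → ℝ) ⬝ᵥ q = 1 := by rw [one_dotProduct, hqs]
  simp only [h1q, hHq, div_one, one_mul] at ht
  have h2 : Tendsto (fun m : ℕ => ∑ v, ∑ᶠ L ∈ Φ.primaryGaps v,
      Matrix.vecMul 1 (M.weight δ ^ m) (ev v) * Metric.diam L ^ δ) atTop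
      (𝓝 (∑ v, ∑ᶠ L ∈ Φ.primaryGaps v, H (ev v) * Metric.diam L ^ δ)) := by
    refine tendsto_finsetSum _ fun v _ => ?_
    simp only [finsum_mem_eq_finite_toFinset_sum _ (hA.finite_primaryGaps v)]
    exact tendsto_finsetSum _ fun L _ => (ht (ev v)).mul_const _
  refine h2.congr' ?_
  filter_upwards [eventually_ge_atTop 1] with m hm
  exact (M.imageGapSum_eq hev hm).symm

theorem gapSum_pos (M : Φ.AffineModel) (hE : 2 ≤ Fintype.card E) (hA : Φ.AperiodicIrreducible)
    (hF : volume Φ.limitSet = 0) (δ : ℝ) {H : E → ℝ} (hH : ∀ e, 0 < H e) (ev : V → E) :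
    0 < ∑ v, ∑ᶠ L ∈ Φ.primaryGaps v, H (ev v) * Metric.diam L ^ δ := by
  have hterm : ∀ v, ∀ L ∈ Φ.primaryGaps v, 0 < H (ev v) * Metric.diam L ^ δ := fun v L hL =>
    mul_pos (hH _) (Real.rpow_pos_of_pos (hA.diam_primaryGap_pos hL) δ)
  simp only [finsum_mem_eq_finite_toFinset_sum _ (hA.finite_primaryGaps _)]
  obtain ⟨v, hv⟩ := M.exists_primaryGap hE hA hF
  refine Finset.sum_pos' (fun v _ => Finset.sum_nonneg fun L hL =>
    (hterm v L ((Finite.mem_toFinset _).1 hL)).le) ⟨v, Finset.mem_univ v, ?_⟩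
  exact Finset.sum_pos (fun L hL => hterm v L ((Finite.mem_toFinset _).1 hL))
    ((Finite.toFinset_nonempty _).2 hv)

/-- A fixed row vector depends on the initial vertex only. -/
theorem eq_of_init_eq {δ : ℝ} {H : E → ℝ} (hH1 : (M.weight δ).vecMul H = H) {e f : E}
    (h : Φ.init e = Φ.init f) : H e = H f := by
  rw [← hH1]
  refine Finset.sum_congr rfl fun g _ => ?_
  have hg : Φ.incidence g e = Φ.incidence g f := by
    unfold incidence
    rw [h]
  simp only [weight, hg]

end AffineModel

end ConformalGDS

/-! ### The exponent and its eigenvectors -/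

namespace ConformalGDS

variable {V E : Type*} [Fintype V] [Fintype E] {Φ : ConformalGDS V E}

namespace AffineModel

variable (M : Φ.AffineModel)

open Classical in
theorem weight_zero_pow (n : ℕ) (e f : E) :
    (M.weight 0 ^ n) e f = ((Φ.incidence ^ n) e f : ℕ) := by
  have h : M.weight 0 = Φ.incidence.map (Nat.castRingHom ℝ) := by
    ext e f
    simp [weight]
  rw [h, ← Matrix.map_pow]
  rfl

/-- For δ = 0 a power of the matrix has only positive integers as entries, so each q_e would be at
least the sum of all coordinates of q, which is impossible with two edges. -/
theorem exponent_ne_zero (hE : 2 ≤ Fintype.card E) (hA : Φ.AperiodicIrreducible) {δ : ℝ}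
    {q : E → ℝ} (hq : ∀ e, 0 < q e) (hq1 : (M.weight δ).mulVec q = q) : δ ≠ 0 := by
  classical
  rintro rfl
  obtain ⟨n, -, hn⟩ := id hA
  obtain ⟨e, f, hef⟩ := Fintype.one_lt_card_iff.1 hE
  have h1 := congrFun (pow_mulVec_eq_self hq1 n) e
  have h2 : ∑ g, q g ≤ ((M.weight 0 ^ n).mulVec q) e := by
    refine Finset.sum_le_sum fun g _ => ?_
    have h3 : (1 : ℝ) ≤ (M.weight 0 ^ n) e g := by
      have := M.weight_zero_pow n e g
      rw [show (M.weight 0 ^ n) e g = _ from this]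
      exact_mod_cast hn e g
    exact le_mul_of_one_le_left (hq g).le h3
  have h3 : q e + q f ≤ ∑ g, q g := by
    rw [← Finset.sum_pair hef]
    exact Finset.sum_le_sum_of_subset_of_nonneg (Finset.subset_univ _) fun g _ _ => (hq g).le
  have := hq f
  linarith

/-- The exponent, the right eigenvector and the left eigenvector of the matrices of ratios. -/
theorem exists_exponent (hE : 2 ≤ Fintype.card E) (hA : Φ.AperiodicIrreducible)
    (hF : volume Φ.limitSet = 0) :
    ∃ δ : ℝ, 0 < δ ∧ δ < 1 ∧ ∃ q H : E → ℝ, (∀ e, 0 < q e) ∧ (M.weight δ).mulVec q = q ∧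
      ∑ e, q e = 1 ∧ (∀ e, 0 < H e) ∧ (M.weight δ).vecMul H = H ∧ H ⬝ᵥ q = 1 := by
  classical
  have hE' : Nonempty E := Fintype.card_pos_iff.1 (by omega)
  obtain ⟨n, hn1, hn⟩ := id hA
  obtain ⟨δ, hδ0, hδ1, q, hq, hq1⟩ := exists_exponent_mulVec_eq_self hn1 hn M.ratio_pos M.weight
    (fun _ _ _ => rfl) (M.eq_zero_of_le_weight_one_mulVec hE hA hF)
  have hBn : ∀ i j, 0 < (M.weight δ ^ n) i j := fun i j =>
    (pow_pos_of_pos_imp_pos (M.weight_nonneg δ) (fun i j h => by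
      rw [M.weight_of_adj δ (Φ.incidence_pos_iff.1 h)]
      exact Real.rpow_pos_of_pos (M.ratio_pos i) δ) n i j).2 (hn i j)
  obtain ⟨H, hH, hH1⟩ := exists_pos_vecMul_eq_self (M.weight_nonneg δ) hBn hq hq1
  have hs : 0 < ∑ e, q e := Finset.sum_pos (fun e _ => hq e) Finset.univ_nonempty
  have ht : 0 < H ⬝ᵥ q := Finset.sum_pos (fun e _ => mul_pos (hH e) (hq e)) Finset.univ_nonempty
  refine ⟨δ, hδ0.lt_of_ne (M.exponent_ne_zero hE hA hq hq1).symm, hδ1, (∑ e, q e)⁻¹ • q,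
    ((∑ e, q e) / H ⬝ᵥ q) • H, fun e => mul_pos (inv_pos.2 hs) (hq e), ?_, ?_,
    fun e => mul_pos (div_pos hs ht) (hH e), ?_, ?_⟩
  · rw [Matrix.mulVec_smul, hq1]
  · simp only [Pi.smul_apply, smul_eq_mul]
    rw [← Finset.mul_sum, inv_mul_cancel₀ hs.ne']
  · rw [Matrix.smul_vecMul, hH1]
  · rw [smul_dotProduct, dotProduct_smul, smul_eq_mul, smul_eq_mul]
    field_simp

end AffineModel

end ConformalGDS

/-! ### Proof of the main theorem -/

theorem mainTheorem5 {V E : Type*} [Fintype V] [Fintype E] (Φ : ConformalGDS V E)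
    (hE : 2 ≤ Fintype.card E) (hA : Φ.AperiodicIrreducible) (hΦ : Φ.IsSGDS)
    (hF : volume Φ.limitSet = 0) :
    ∃ δ : ℝ, HasMinkowskiDim Φ.limitSet δ ∧
      (∀ v, (Φ.primaryGaps v).Finite) ∧
      (∃! h : C(Φ.Words, ℝ),
        Φ.IsPerronEigenfunction (fun ω => -δ * Φ.geometricPotential ω) h) ∧
      (∃ c : ℝ, 0 < c ∧ Tendsto (fun m : ℕ => Φ.imageGapSum δ m) atTop (𝓝 c) ∧
        ∀ h : C(Φ.Words, ℝ),
          Φ.IsPerronEigenfunction (fun ω => -δ * Φ.geometricPotential ω) h →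
          ∀ ω : V → Φ.Words,
            (∀ v, (∃ e, Φ.init e = v) → Φ.init ((ω v).1 0) = v) →
            c = ∑ v, ∑ᶠ L ∈ Φ.primaryGaps v, h (ω v) * Metric.diam L ^ δ) ∧
      (Φ.IsLattice Φ.geometricPotential →
        ∀ (k : Fin 2) (B : Set ℝ), MeasurableSet B →
          (Φ.limitSet ∩ B).Nonempty →
          (∃ S : Finset (List E), (∀ u ∈ S, Φ.IsAdmissible u) ∧
            Φ.limitSet ∩ B = ⋃ u ∈ S, Φ.code '' Φ.cylinder u) →
          (∀ᶠ ε : ℝ in 𝓝[>] 0,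
            Metric.cthickening ε Φ.limitSet ∩ B = Metric.cthickening ε (Φ.limitSet ∩ B)) →
          0 < lowerFractalCurvature k Φ.limitSet B ∧
            lowerFractalCurvature k Φ.limitSet B < upperFractalCurvature k Φ.limitSet B ∧
            upperFractalCurvature k Φ.limitSet B < ⊤) := by
  obtain ⟨M⟩ := hΦ.nonempty_affineModel
  have hE' : Nonempty E := Fintype.card_pos_iff.1 (by omega)
  obtain ⟨δ, hδ0, hδ1, q, H, hq, hq1, hqs, hH, hH1, hHq⟩ := M.exists_exponent hE hA hF
  have hbranch := M.gapGrowth_branch hE hA hF hδ0.le hδ1 hq hq1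
  have hFg : GapGrowth Φ.limitSet δ := by
    have := GapGrowth.biUnion Finset.univ_nonempty (M.nonOverlapping_branch Finset.univ)
      (fun e _ => hA.branch_nonempty e) (fun e _ => hbranch e)
    simpa [ConformalGDS.limitSet_eq_iUnion_branch] using this
  have hperron := M.isPerronEigenfunction_iff hA hq hq1 hqs hH hH1 hHq
  refine ⟨δ, hFg.hasMinkowskiDim Φ.isCompact_limitSet, hA.finite_primaryGaps,
    ⟨ConformalGDS.AffineModel.firstLetter H, (hperron _).2 rfl, fun h hh => (hperron h).1 hh⟩, ?_, ?_⟩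
  -- A vertex without outgoing edges gets an arbitrary edge; it has no primary gaps, so the choice
  -- is invisible in the sums.
  · have hex : ∀ v, ∃ e, (∃ e, Φ.init e = v) → Φ.init e = v := fun v => by
      by_cases hv : ∃ e, Φ.init e = v
      · exact hv.imp fun e he _ => he
      · exact ⟨Classical.arbitrary E, fun h => absurd h hv⟩
    choose ev hev using hex
    refine ⟨_, M.gapSum_pos hE hA hF δ hH ev,
      M.tendsto_imageGapSum hA hq hq1 hqs hH hH1 hHq hev, fun h hh ω hω => ?_⟩
    rw [(hperron h).1 hh]
    refine Finset.sum_congr rfl fun v _ => ?_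
    by_cases hv : ∃ e, Φ.init e = v
    · rw [M.eq_of_init_eq hH1 ((hev v hv).trans (hω v hv).symm)]
      rfl
    · simp [ConformalGDS.primaryGaps_eq_empty hv]
  -- Words of one common length make F ∩ B a non-overlapping union of affine copies of branches, and
  -- both gap growth and lattice gaps pass to such unions.
  · rintro hL k B - hne ⟨S, -, hS⟩ hB
    obtain ⟨S', m, hS', heq⟩ := ConformalGDS.exists_words_same_length (Φ := Φ) (S := S)
    rw [heq] at hS
    have hno := M.nonOverlapping_words (S := S') fun u hu => (hS' u hu).1
    have himage : ∀ u ∈ S', ∃ s b : ℝ, s ≠ 0 ∧ ∃ e : E,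
        Φ.code '' Φ.cylinder u = (fun x => s * x + b) '' Φ.branch e := fun u hu =>
      M.code_image_cylinder_eq (hS' u hu).2 fun h => by simpa [h] using (hS' u hu).1
    have hS'ne : S'.Nonempty := by
      rw [hS] at hne
      obtain ⟨x, hx⟩ := hne
      obtain ⟨u, hu, -⟩ := mem_iUnion₂.1 hx
      exact ⟨u, hu⟩
    obtain ⟨a, θ, ha, hθ⟩ := M.exists_coboundary_of_isLattice hA hL
    have hgrowth : GapGrowth (Φ.limitSet ∩ B) δ := by
      rw [hS]
      refine GapGrowth.biUnion hS'ne hno (fun u hu => ?_) fun u hu => ?_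
      · obtain ⟨s, b, -, e, he⟩ := himage u hu
        rw [he]
        exact (hA.branch_nonempty e).image _
      · obtain ⟨s, b, hs, e, he⟩ := himage u hu
        rw [he]
        exact (hbranch e).image_affine (ConformalGDS.isCompact_branch e) b hs
    have hlattice : LatticeGaps a (Φ.limitSet ∩ B) := by
      rw [hS]
      refine LatticeGaps.biUnion hno fun u hu => ?_
      obtain ⟨s, b, hs, e, he⟩ := himage u hu
      rw [he]
      exact (M.latticeGaps_branch hθ e).image_affine b hs
    have hcompact : IsCompact (Φ.limitSet ∩ B) := by
      rw [hS]
      exact S'.isCompact_biUnion hno.isCompact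
    exact fractalCurvature_oscillates hδ0 hδ1 Φ.isCompact_limitSet
      (hne.mono inter_subset_left) hFg hcompact hne hgrowth (hlattice.hasEmptyScales ha) hB k
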